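/- **Theorem 1.** Let $P,\mu:(0,\infty)\to(0,\infty)$ be $C^2$ functions with $P'(\rho)>0$ for all $\rho>0$ and $P((0,\infty))=(0,\infty)$. For $\rho^*>0$ and $\rho>0$ put $$k(\rho)=\int_{\rho^*}^{\rho}\frac{\mu(\tau)}{\tau}\,d\tau,\qquad Q(\rho)=\rho\int_{\rho^*}^{\rho}\frac{P(\tau)}{\tau^2}\,d\tau-\frac{P(\rho^*)}{\rho^*}\rho+P(\rho^*),\qquad G(\rho)=\int_{\rho^*}^{\rho}\frac{\mu(l)}{l^{3/2}}\sqrt{Q(l)}\,dl,$$ and assume that for every $\rho^*>0$: $G(\rho)\to+\infty$ as $\rho\to+\infty$, $G(\rho)\to-\infty$ as $\rho\to0^+$, and $k(\rho)\to+\infty$ as $\rho\to+\infty$. Let $P_{ext}>0$ and let $\rho^*>0$ be the unique solution of $P(\rho^*)=P_{ext}$; from now on $k$ and $Q$ refer to this $\rho^*$. *Classical solutions.* For $a,b:[0,\infty)\to\mathbb R$ with $a<b$ let $\Omega=\{(t,x):t>0,\ a(t)<x<b(t)\}$, $\tilde\Omega=\{(t,x):t>0,\ a(t)\le x\le b(t)\}$,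 $\bar\Omega=\{(t,x):t\ge0,\ a(t)\le x\le b(t)\}$. A function is of class $C^1$ on $\tilde\Omega$ or $\bar\Omega$ if it is continuous there, $C^1$ in $\Omega$, and its first derivatives extend continuously to that set. A classical solution with input $u\in C^0([0,\infty))$ consists of $a,b\in C^1([0,\infty))\cap C^2((0,\infty))$ with $a(t)<b(t)$ for all $t\ge0$, $\rho\in C^1(\bar\Omega;(0,\infty))\cap C^2(\Omega)$ and $v\in C^0(\bar\Omega)\cap C^1(\tilde\Omega)$ with $v(t,\cdot)\in C^2((a(t),b(t)))$ for each $t>0$, such that $$\rho_t+(\rho v)_x=0\ \ (t>0,\ x\in[a(t),b(t)]),\qquad \rho v_t+\rho v v_x=\big(\mu(\rho)v_x-P(\rho)\big)_x\ \ (t>0,\ x\in(a(t),b(t))),$$ $$v(t,a(t))=\dot a(t),\qquad v(t,b(t))=\dot b(t)\qquad(t\ge0),$$ $$\ddot b(t)=P(\rho(t,b(t)))-\mu(\rho(t,b(t)))v_x(t,b(t))-P_{ext},\qquad \ddot a(t)=u(t)+P_{ext}-P(\rho(t,a(t)))+\mu(\rho(t,a(t)))v_x(t,a(t))\qquad(t>0),$$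 and $\int_{a(t)}^{b(t)}\rho(t,x)\,dx=1$ for all $t\ge0$. *Lyapunov functional.* For $r>0$, real numbers $a<b$, and profiles $\rho\in C^0([a,b];(0,\infty))\cap H^1(a,b)$ and $v\in C^0([a,b])$ with $\int_a^b\rho\,dx=1$, let $V=W+rE$, where $$E=\tfrac12v(a)^2+\tfrac12v(b)^2+\tfrac12\int_a^b\rho v^2\,dx+\int_a^bQ(\rho)\,dx,$$ $$W=\tfrac12\int_a^b\tfrac1\rho\big(\rho v+(k(\rho))_x\big)^2dx+\tfrac12\big(v(b)-k(\rho(b))\big)^2+\tfrac12\big(v(a)+k(\rho(a))\big)^2+\int_a^bQ(\rho)\,dx.$$ *State space.* Let $\Phi(a,b,\rho,v)=(\tilde\rho,\tilde v)$ with $\tilde\rho(\theta)=\rho(a+(b-a)\theta)$, $\tilde v(\theta)=v(a+(b-a)\theta)$ for $\theta\in[0,1]$, and let $X=H^1(0,1)\times C^0([0,1])$ have the norm $$\|(\rho,v)\|_X=\sqrt{v(0)^2+v(1)^2}+\Big(\int_0^1v^2\,d\theta\Big)^{1/2}+\max_{[0,1]}|\rho|+\Big(\int_0^1(\rho')^2\,d\theta\Big)^{1/2}.$$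 *Claim.* For every $R,r>0$ and $S\ge0$ there are constants $M,\sigma>0$ (depending, for the given $P$ and $\mu$, only on $\rho^*$, $R$, $r$ and $S$) such that every classical solution with $$u(t)=-R\big((r+1)v(t,a(t))+k(\rho(t,a(t)))\big)\quad\text{for }t>0$$ and $V(a(0),b(0),\rho(0,\cdot),v(0,\cdot))\le S$ satisfies, for all $t\ge0$, $\Phi(a(t),b(t),\rho(t,\cdot),v(t,\cdot))\in\big(C^0([0,1];(0,\infty))\cap H^1(0,1)\big)\times C^0([0,1])$ and $$\big\|\Phi(a(t),b(t),\rho(t,\cdot),v(t,\cdot))-(\rho^*,0)\big\|_X\le M e^{-\sigma t}\,\big\|\Phi(a(0),b(0),\rho(0,\cdot),v(0,\cdot))-(\rho^*,0)\big\|_X .$$ -/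

import Mathlib

open Set Filter Topology MeasureTheory

namespace TwoPiston

noncomputable section

/-! ### Gas laws -/

/-- `k(ρ) = ∫_{ρ*}^{ρ} μ(τ)/τ dτ`. -/
def k (μ : ℝ → ℝ) (ρs : ℝ) (ρ : ℝ) : ℝ :=
  ∫ τ in ρs..ρ, μ τ / τ

/-- `Q(ρ) = ρ ∫_{ρ*}^{ρ} P(τ)/τ² dτ - (P(ρ*)/ρ*) ρ + P(ρ*)`. -/
def Q (P : ℝ → ℝ) (ρs : ℝ) (ρ : ℝ) : ℝ :=
  ρ * (∫ τ in ρs..ρ, P τ / τ ^ 2) - P ρs / ρs * ρ + P ρs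

/-- `G(ρ) = ∫_{ρ*}^{ρ} μ(l) l^{-3/2} √(Q(l)) dl`. -/
def G (P μ : ℝ → ℝ) (ρs : ℝ) (ρ : ℝ) : ℝ :=
  ∫ l in ρs..ρ, μ l / l ^ (3 / 2 : ℝ) * √(Q P ρs l)

/-- Assumption (H) on the pressure law `P` and the viscosity law `μ`, which are functions on
`(0, ∞)` (their values elsewhere are irrelevant). -/
structure AssumptionH (P μ : ℝ → ℝ) : Prop where
  P_pos : ∀ ρ, 0 < ρ → 0 < P ρ
  μ_pos : ∀ ρ, 0 < ρ → 0 < μ ρ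
  P_contDiff : ContDiffOn ℝ 2 P (Ioi 0)
  μ_contDiff : ContDiffOn ℝ 2 μ (Ioi 0)
  deriv_P_pos : ∀ ρ, 0 < ρ → 0 < deriv P ρ
  P_onto : P '' Ioi 0 = Ioi 0
  G_atTop : ∀ ρs, 0 < ρs → Tendsto (G P μ ρs) atTop atTop
  G_zero : ∀ ρs, 0 < ρs → Tendsto (G P μ ρs) (𝓝[>] 0) atBot
  k_atTop : ∀ ρs, 0 < ρs → Tendsto (k μ ρs) atTop atTop

/-! ### The Lyapunov functional

The density `ρ` and the velocity `v` are profiles on `[a, b]`. The profile `ρ` is continuous,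
positive and of class `H¹(a, b)`, hence absolutely continuous, so that `deriv` is almost everywhere
on `(a, b)` its weak derivative. -/

/-- Potential energy. -/
def U (P : ℝ → ℝ) (ρs a b : ℝ) (ρ : ℝ → ℝ) : ℝ :=
  ∫ x in a..b, Q P ρs (ρ x)

/-- Mechanical energy. -/
def E (P : ℝ → ℝ) (ρs a b : ℝ) (ρ v : ℝ → ℝ) : ℝ :=
  v a ^ 2 / 2 + v b ^ 2 / 2 + (1 / 2) * (∫ x in a..b, ρ x * v x ^ 2) + U P ρs a b ρ

/-- Energy of the transformed velocity `ρ v + (k(ρ))ₓ`. -/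
def W (P μ : ℝ → ℝ) (ρs a b : ℝ) (ρ v : ℝ → ℝ) : ℝ :=
  (1 / 2) * (∫ x in a..b, 1 / ρ x * (ρ x * v x + deriv (fun y => k μ ρs (ρ y)) x) ^ 2)
    + (1 / 2) * (v b - k μ ρs (ρ b)) ^ 2 + (1 / 2) * (v a + k μ ρs (ρ a)) ^ 2 + U P ρs a b ρ

/-- The control Lyapunov functional `V = W + r E`. -/
def V (P μ : ℝ → ℝ) (ρs r a b : ℝ) (ρ v : ℝ → ℝ) : ℝ :=
  W P μ ρs a b ρ v + r * E P ρs a b ρ v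

/-! ### The state space -/

/-- `f ∈ H¹(c, d)`: `f` and its weak derivative on `(c, d)` are in `L²(c, d)`. -/
def MemH1 (c d : ℝ) (f : ℝ → ℝ) : Prop :=
  MemLp f 2 (volume.restrict (Ioo c d)) ∧
    ∃ g : ℝ → ℝ, MemLp g 2 (volume.restrict (Ioo c d)) ∧
      ∀ φ : ℝ → ℝ, ContDiff ℝ (⊤ : ℕ∞) φ → HasCompactSupport φ → tsupport φ ⊆ Ioo c d →
        ∫ x in Ioo c d, f x * deriv φ x = -∫ x in Ioo c d, g x * φ x

/-- The cone `(C⁰([0,1]; (0,∞)) ∩ H¹(0,1)) × C⁰([0,1])` of rescaled states. -/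
def stateCone : Set ((ℝ → ℝ) × (ℝ → ℝ)) :=
  {p | ContinuousOn p.1 (Icc 0 1) ∧ (∀ θ ∈ Icc (0 : ℝ) 1, 0 < p.1 θ) ∧ MemH1 0 1 p.1 ∧
    ContinuousOn p.2 (Icc 0 1)}

/-- The rescaling `Φ(a, b, ρ, v)` of the profiles on `[a, b]` to profiles on `[0, 1]`. -/
def Φ (a b : ℝ) (ρ v : ℝ → ℝ) : (ℝ → ℝ) × (ℝ → ℝ) :=
  (fun θ => ρ (a + (b - a) * θ), fun θ => v (a + (b - a) * θ))

/-- The rescaled equilibrium `(ρ* χ_{[0,1]}, 0 χ_{[0,1]})`. -/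
def equilibrium (ρs : ℝ) : (ℝ → ℝ) × (ℝ → ℝ) :=
  ((Icc (0 : ℝ) 1).indicator fun _ => ρs, (Icc (0 : ℝ) 1).indicator fun _ => 0)

/-- The norm of `X = H¹(0,1) × C⁰([0,1])`; `deriv` is almost everywhere on `(0, 1)` the weak
derivative of an absolutely continuous representative. -/
def normX (p : (ℝ → ℝ) × (ℝ → ℝ)) : ℝ :=
  √(p.2 0 ^ 2 + p.2 1 ^ 2) + √(∫ θ in (0 : ℝ)..1, p.2 θ ^ 2)
    + sSup ((fun θ => |p.1 θ|) '' Icc 0 1) + √(∫ θ in (0 : ℝ)..1, deriv p.1 θ ^ 2)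

/-! ### Classical solutions -/

/-- `Ω`: the points `(t, x)` with `t > 0`, `a(t) < x < b(t)`. -/
def Ω (a b : ℝ → ℝ) : Set (ℝ × ℝ) := {z | 0 < z.1 ∧ z.2 ∈ Ioo (a z.1) (b z.1)}

/-- The points `(t, x)` with `t > 0`, `a(t) ≤ x ≤ b(t)`. -/
def Ωtilde (a b : ℝ → ℝ) : Set (ℝ × ℝ) := {z | 0 < z.1 ∧ z.2 ∈ Icc (a z.1) (b z.1)}

/-- The points `(t, x)` with `t ≥ 0`, `a(t) ≤ x ≤ b(t)`. -/
def Ωbar (a b : ℝ → ℝ) : Set (ℝ × ℝ) := {z | 0 ≤ z.1 ∧ z.2 ∈ Icc (a z.1) (b z.1)}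

/-- `f ∈ C¹(A)`, where `S` is the interior of `A` and `A` is contained in the closure of `S`: `f` is
continuous on `A`, continuously differentiable in `S`, and its derivative extends continuously
to `A`. -/
def C1UpTo (S A : Set (ℝ × ℝ)) (f : ℝ × ℝ → ℝ) : Prop :=
  ContinuousOn f A ∧ ContDiffOn ℝ 1 f S ∧
    ∃ g : ℝ × ℝ → ℝ × ℝ →L[ℝ] ℝ, ContinuousOn g A ∧ EqOn g (fderiv ℝ f) S

/-- Classical solutions `(a, b, ρ, v)`, with total mass `1`, of the two-piston system with gas laws
`P`, `μ`, external pressure `Pext` and input `u`. -/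
structure IsClassicalSolution (P μ : ℝ → ℝ) (Pext : ℝ) (u a b : ℝ → ℝ) (ρ v : ℝ → ℝ → ℝ) :
    Prop where
  u_cont : ContinuousOn u (Ici 0)
  a_C1 : ContDiffOn ℝ 1 a (Ici 0)
  a_C2 : ContDiffOn ℝ 2 a (Ioi 0)
  b_C1 : ContDiffOn ℝ 1 b (Ici 0)
  b_C2 : ContDiffOn ℝ 2 b (Ioi 0)
  a_lt_b : ∀ t, 0 ≤ t → a t < b t
  ρ_pos : ∀ t, 0 ≤ t → ∀ x ∈ Icc (a t) (b t), 0 < ρ t x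
  ρ_C1 : C1UpTo (Ω a b) (Ωbar a b) (Function.uncurry ρ)
  ρ_C2 : ContDiffOn ℝ 2 (Function.uncurry ρ) (Ω a b)
  v_C0 : ContinuousOn (Function.uncurry v) (Ωbar a b)
  v_C1 : C1UpTo (Ω a b) (Ωtilde a b) (Function.uncurry v)
  v_C2 : ∀ t, 0 < t → ContDiffOn ℝ 2 (v t) (Ioo (a t) (b t))
  /-- Conservation of mass. By continuity of the extended derivatives it is equivalent to ask for
  it on `(a(t), b(t))` and on `[a(t), b(t)]`. -/
  mass_eq : ∀ t, 0 < t → ∀ x ∈ Ioo (a t) (b t),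
    deriv (fun s => ρ s x) t + deriv (fun y => ρ t y * v t y) x = 0
  /-- Balance of momentum. -/
  momentum_eq : ∀ t, 0 < t → ∀ x ∈ Ioo (a t) (b t),
    ρ t x * deriv (fun s => v s x) t + ρ t x * v t x * deriv (v t) x
      = deriv (fun y => μ (ρ t y) * deriv (v t) y - P (ρ t y)) x
  /-- The gas moves with the pistons. -/
  left_velocity : ∀ t, 0 ≤ t → v t (a t) = derivWithin a (Ici 0) t
  right_velocity : ∀ t, 0 ≤ t → v t (b t) = derivWithin b (Ici 0) t
  /-- Newton's law for the two pistons; `vₓ` at an end point is the one-sided derivative. -/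
  right_newton : ∀ t, 0 < t → deriv (deriv b) t
    = P (ρ t (b t)) - μ (ρ t (b t)) * derivWithin (v t) (Icc (a t) (b t)) (b t) - Pext
  left_newton : ∀ t, 0 < t → deriv (deriv a) t
    = u t + Pext - P (ρ t (a t)) + μ (ρ t (a t)) * derivWithin (v t) (Icc (a t) (b t)) (a t)
  /-- The total mass is normalized. -/
  mass_one : ∀ t, 0 ≤ t → ∫ x in (a t)..(b t), ρ t x = 1

end

end TwoPiston

namespace TwoPiston

/-! ### Calculus on the half line -/

/-! The functional V is a strict Lyapunov functional. Write D for the material derivative along the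
gas. Conservation of mass gives D k(ρ) = -μ(ρ) vₓ, so the balance of momentum reads ρ Dv = -(D
k(ρ))ₓ - P(ρ)ₓ. Hence the transformed momentum T = ρv + k(ρ)ₓ satisfies DT = -P(ρ)ₓ - vₓ T: the
viscous stress has disappeared (`IsFlow.material_transformedMomentum`). The quantities v(b) -
k(ρ(b)) and v(a) + k(ρ(a)) remove the viscous force from the pistons' equations in the same way.
Thus E dissipates through viscosity, W dissipates through the pressure gradient and through the
boundary terms k(ρ)(P(ρ) - P(ρ*)), and the input works on (r+1)v(a) + k(ρ(a)), so that the feedback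
makes its contribution a negative square (`IsFlow.hasDerivAt_lyapunov`).

To turn dissipation into a rate, the density must stay in a fixed compact subset of (0,∞). On V ≤ S
the oscillation of G(ρ) is bounded, since the derivative of G(ρ(x)) is a product of the square roots
of the gradient energy density and of Q(ρ). Unit mass forbids a density that is small everywhere,
because Q(l)/l blows up at 0, and v(b) together with v(b) - k(ρ(b)) bounds ρ(b) from above. The
limits of G then give two-sided bounds (`IsProfile.exists_density_bounds`). On such a range all
constitutive functions are comparable to powers of l - ρ* (`AssumptionH.exists_comparable`), V is
equivalent to the squared distance to equilibrium (`IsProfile.normX_le`,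
`IsProfile.lyapunov_le_normX`), and V is at most a constant times the dissipation
(`IsProfile.exists_lyapunov_le_dissipation`). Since V does not increase, these constants serve for
all times, and a Grönwall argument concludes.

The analytic difficulty is regularity: the second derivatives of ρ need not extend to the pistons,
so T cannot be differentiated up to the boundary. Its material derivative does extend. Integrals are
therefore differentiated on shrunken intervals, and the relative flux left at their ends vanishes in
the limit (`hasDerivAt_integral_of_flux`, `MovingInterval.hasDerivAt_integral_of_transport`). -/

theorem hasDerivAt_integral_of_continuousOn_Ioi {f : ℝ → ℝ} (hf : ContinuousOn f (Ioi 0)) {c x : ℝ}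
    (hc : 0 < c) (hx : 0 < x) : HasDerivAt (fun y => ∫ τ in c..y, f τ) (f x) x := by
  have hsub : uIcc c x ⊆ Ioi 0 := fun y hy => lt_of_lt_of_le (lt_min hc hx) hy.1
  exact intervalIntegral.integral_hasDerivAt_right (hf.mono hsub).intervalIntegrable
    (hf.stronglyMeasurableAtFilter isOpen_Ioi x hx) (hf.continuousAt (Ioi_mem_nhds hx))

theorem abs_sub_le_of_deriv_le {f f' : ℝ → ℝ} {s : Set ℝ} (hs : s.OrdConnected)
    (hf : ∀ x ∈ s, HasDerivAt f (f' x) x) {C : ℝ} (hC : ∀ x ∈ s, |f' x| ≤ C) {x y : ℝ}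
    (hx : x ∈ s) (hy : y ∈ s) : |f x - f y| ≤ C * |x - y| :=
  hs.convex.norm_image_sub_le_of_norm_hasDerivWithin_le
    (fun z hz => (hf z hz).hasDerivWithinAt) hC hy hx

/-- Mean value theorem; for positive C the hypothesis is f' ≥ 1/C, written without division. -/
theorem abs_sub_le_of_le_deriv {f f' : ℝ → ℝ} {s : Set ℝ} (hs : s.OrdConnected)
    (hf : ∀ x ∈ s, HasDerivAt f (f' x) x) {C : ℝ} (hC0 : 0 ≤ C) (hC : ∀ x ∈ s, 1 ≤ C * f' x)
    {x y : ℝ} (hx : x ∈ s) (hy : y ∈ s) : |x - y| ≤ C * |f x - f y| := by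
  wlog hxy : y < x generalizing x y
  · rcases eq_or_lt_of_le (not_lt.1 hxy) with h | h
    · simp [h]
    · rw [abs_sub_comm, abs_sub_comm (f x)]
      exact this hy hx h
  obtain ⟨c, hc, hcs⟩ := exists_hasDerivAt_eq_slope f f' hxy
    (fun z hz => (hf z (hs.out hy hx hz)).continuousAt.continuousWithinAt)
    (fun z hz => hf z (hs.out hy hx ⟨hz.1.le, hz.2.le⟩))
  have h1 := hC c (hs.out hy hx ⟨hc.1.le, hc.2.le⟩)
  have hpos : 0 < x - y := sub_pos.2 hxy
  rw [hcs] at h1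
  rw [abs_of_pos hpos]
  calc x - y = 1 * (x - y) := (one_mul _).symm
    _ ≤ C * ((f x - f y) / (x - y)) * (x - y) := by gcongr
    _ = C * (f x - f y) := by field_simp
    _ ≤ C * |f x - f y| := by gcongr; exact le_abs_self _

/-! ### Constitutive functions and their comparison with powers of l - ρ*. -/

section GasLaws

variable {P μ : ℝ → ℝ} {ρs : ℝ}

/-- Two-sided comparison, with constant `C`, of the constitutive functions at the density `l` with
powers of `l - ρ*`. -/
structure Comparable (P μ : ℝ → ℝ) (ρs C l : ℝ) : Prop where
  le : l ≤ C
  one_le : 1 ≤ C * l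
  μ_le : μ l ≤ C
  one_le_μ : 1 ≤ C * μ l
  one_le_deriv_P : 1 ≤ C * deriv P l
  k_le : |k μ ρs l| ≤ C * |l - ρs|
  le_k : |l - ρs| ≤ C * |k μ ρs l|
  sq_le_k_mul : (l - ρs) ^ 2 ≤ C * (k μ ρs l * (P l - P ρs))
  Q_le : Q P ρs l ≤ C * (l - ρs) ^ 2

namespace AssumptionH

theorem hasDerivAt_P (hH : AssumptionH P μ) {l : ℝ} (hl : 0 < l) :
    HasDerivAt P (deriv P l) l :=
  ((hH.P_contDiff.contDiffAt (Ioi_mem_nhds hl)).differentiableAt (by norm_num)).hasDerivAt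

theorem continuousOn_P (hH : AssumptionH P μ) : ContinuousOn P (Ioi 0) :=
  hH.P_contDiff.continuousOn

theorem continuousOn_μ (hH : AssumptionH P μ) : ContinuousOn μ (Ioi 0) :=
  hH.μ_contDiff.continuousOn

theorem continuousOn_deriv_P (hH : AssumptionH P μ) : ContinuousOn (deriv P) (Ioi 0) :=
  hH.P_contDiff.continuousOn_deriv_of_isOpen isOpen_Ioi (by norm_num)

theorem strictMonoOn_P (hH : AssumptionH P μ) : StrictMonoOn P (Ioi 0) :=
  strictMonoOn_of_deriv_pos (convex_Ioi 0) hH.continuousOn_P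
    fun x hx => hH.deriv_P_pos x (by simpa using hx)

theorem continuousOn_k' (hH : AssumptionH P μ) : ContinuousOn (fun l => μ l / l) (Ioi 0) :=
  hH.continuousOn_μ.div continuousOn_id fun _ hx => ne_of_gt hx

theorem hasDerivAt_k (hH : AssumptionH P μ) (hρs : 0 < ρs) {l : ℝ} (hl : 0 < l) :
    HasDerivAt (k μ ρs) (μ l / l) l :=
  hasDerivAt_integral_of_continuousOn_Ioi hH.continuousOn_k' hρs hl

theorem continuousOn_k (hH : AssumptionH P μ) (hρs : 0 < ρs) :
    ContinuousOn (k μ ρs) (Ioi 0) :=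
  fun _ hl => (hH.hasDerivAt_k hρs hl).continuousAt.continuousWithinAt

theorem contDiffOn_k (hH : AssumptionH P μ) (hρs : 0 < ρs) :
    ContDiffOn ℝ 2 (k μ ρs) (Ioi 0) := by
  have h1 : ContDiffOn ℝ (1 + 1) (k μ ρs) (Ioi 0) := by
    rw [contDiffOn_succ_iff_deriv_of_isOpen isOpen_Ioi]
    refine ⟨fun l hl => (hH.hasDerivAt_k hρs hl).differentiableAt.differentiableWithinAt,
      by simp, ?_⟩
    have h2 : ContDiffOn ℝ 1 (fun l => μ l / l) (Ioi 0) :=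
      (hH.μ_contDiff.of_le (by norm_num)).div contDiffOn_id fun _ hx => ne_of_gt hx
    exact h2.congr fun l hl => (hH.hasDerivAt_k hρs hl).deriv
  exact h1.of_le (by norm_num)

theorem strictMonoOn_k (hH : AssumptionH P μ) (hρs : 0 < ρs) :
    StrictMonoOn (k μ ρs) (Ioi 0) :=
  strictMonoOn_of_deriv_pos (convex_Ioi 0) (hH.continuousOn_k hρs) fun l hl => by
    rw [interior_Ioi] at hl
    rw [(hH.hasDerivAt_k hρs hl).deriv]
    exact div_pos (hH.μ_pos l hl) hl

/-- Both factors increase and vanish at ρ*, so they have the same sign. This makes the boundary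
terms of the dissipation nonnegative. -/
theorem k_mul_nonneg (hH : AssumptionH P μ) (hρs : 0 < ρs) {l : ℝ} (hl : 0 < l) :
    0 ≤ k μ ρs l * (P l - P ρs) := by
  have hk0 : k μ ρs ρs = 0 := by simp [k]
  rcases le_total l ρs with h | h
  · have h1 := (hH.strictMonoOn_k hρs).monotoneOn hl hρs h
    have h2 := hH.strictMonoOn_P.monotoneOn hl hρs h
    exact mul_nonneg_of_nonpos_of_nonpos (by linarith) (by linarith)
  · have h1 := (hH.strictMonoOn_k hρs).monotoneOn hρs hl h
    have h2 := hH.strictMonoOn_P.monotoneOn hρs hl h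
    exact mul_nonneg (by linarith) (by linarith)

theorem continuousOn_specific (hH : AssumptionH P μ) (c : ℝ) :
    ContinuousOn (fun τ => (P τ - c) / τ ^ 2) (Ioi 0) :=
  (hH.continuousOn_P.sub continuousOn_const).div (continuousOn_id.pow 2)
    fun _ hx => pow_ne_zero 2 (ne_of_gt hx)

/-- The potential energy per unit mass. -/
theorem Q_eq_mul (hH : AssumptionH P μ) (hρs : 0 < ρs) {l : ℝ} (hl : 0 < l) :
    Q P ρs l = l * ∫ τ in ρs..l, (P τ - P ρs) / τ ^ 2 := by
  have hsub : uIcc ρs l ⊆ Ioi 0 := fun y hy => lt_of_lt_of_le (lt_min hρs hl) hy.1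
  have h1 : IntervalIntegrable (fun τ => P τ / τ ^ 2) volume ρs l := by
    have := ((hH.continuousOn_specific 0).mono hsub).intervalIntegrable (μ := volume)
    simpa using this
  have hc : ContinuousOn (fun τ : ℝ => P ρs / τ ^ 2) (uIcc ρs l) :=
    continuousOn_const.div (continuousOn_id.pow 2) fun x hx => pow_ne_zero 2 (hsub hx).ne'
  have h2 : ∫ τ in ρs..l, P ρs / τ ^ 2 = -P ρs / l - -P ρs / ρs := by
    refine intervalIntegral.integral_eq_sub_of_hasDerivAt (f := fun τ => -P ρs / τ)
      (fun x hx => ?_) hc.intervalIntegrable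
    have hx0 : x ≠ 0 := (hsub hx).ne'
    refine ((hasDerivAt_const x (-P ρs)).div (hasDerivAt_id x) hx0).congr_deriv ?_
    simp
  simp_rw [sub_div]
  rw [intervalIntegral.integral_sub h1 hc.intervalIntegrable, h2, Q]
  have := hρs.ne'
  have := hl.ne'
  field_simp
  ring

theorem hasDerivAt_Q (hH : AssumptionH P μ) (hρs : 0 < ρs) {l : ℝ} (hl : 0 < l) :
    HasDerivAt (Q P ρs) ((Q P ρs l + (P l - P ρs)) / l) l := by
  have h1 := (hasDerivAt_id l).mul
    (hasDerivAt_integral_of_continuousOn_Ioi (hH.continuousOn_specific (P ρs)) hρs hl)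
  have h2 : HasDerivAt (Q P ρs) _ l := h1.congr_of_eventuallyEq (by
    filter_upwards [Ioi_mem_nhds hl] with y hy
    exact hH.Q_eq_mul hρs hy)
  convert h2 using 1
  rw [hH.Q_eq_mul hρs hl]
  have := hl.ne'
  simp only [id]
  field_simp

theorem continuousOn_Q (hH : AssumptionH P μ) (hρs : 0 < ρs) :
    ContinuousOn (Q P ρs) (Ioi 0) :=
  fun _ hl => (hH.hasDerivAt_Q hρs hl).continuousAt.continuousWithinAt

theorem contDiffOn_Q (hH : AssumptionH P μ) (hρs : 0 < ρs) :
    ContDiffOn ℝ 1 (Q P ρs) (Ioi 0) := by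
  have h1 : ContDiffOn ℝ (0 + 1) (Q P ρs) (Ioi 0) := by
    rw [contDiffOn_succ_iff_deriv_of_isOpen isOpen_Ioi]
    refine ⟨fun l hl => (hH.hasDerivAt_Q hρs hl).differentiableAt.differentiableWithinAt,
      by simp, contDiffOn_zero.2 ?_⟩
    have h2 : ContinuousOn (fun l => (Q P ρs l + (P l - P ρs)) / l) (Ioi 0) :=
      ((hH.continuousOn_Q hρs).add (hH.continuousOn_P.sub continuousOn_const)).div
        continuousOn_id fun _ hx => ne_of_gt hx
    exact h2.congr fun l hl => (hH.hasDerivAt_Q hρs hl).deriv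
  simpa using h1

theorem Q_nonneg (hH : AssumptionH P μ) (hρs : 0 < ρs) {l : ℝ} (hl : 0 < l) :
    0 ≤ Q P ρs l := by
  rw [hH.Q_eq_mul hρs hl]
  refine mul_nonneg hl.le ?_
  rcases le_total l ρs with h | h
  · rw [intervalIntegral.integral_symm, ← intervalIntegral.integral_neg]
    refine intervalIntegral.integral_nonneg h fun u hu => ?_
    have h2 := hH.strictMonoOn_P.monotoneOn (hl.trans_le hu.1) hρs hu.2
    rw [← neg_div]
    exact div_nonneg (by linarith) (sq_nonneg u)
  · refine intervalIntegral.integral_nonneg h fun u hu => ?_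
    have h2 := hH.strictMonoOn_P.monotoneOn hρs (hρs.trans_le hu.1) hu.1
    exact div_nonneg (by linarith) (sq_nonneg u)

theorem continuousOn_G' (hH : AssumptionH P μ) (hρs : 0 < ρs) :
    ContinuousOn (fun l => μ l / l ^ (3 / 2 : ℝ) * √(Q P ρs l)) (Ioi 0) := by
  refine ContinuousOn.mul (hH.continuousOn_μ.div ?_ ?_) (hH.continuousOn_Q hρs).sqrt
  · exact continuousOn_id.rpow_const fun x hx => Or.inl (ne_of_gt hx)
  · exact fun x hx => (Real.rpow_pos_of_pos hx _).ne'

theorem hasDerivAt_G (hH : AssumptionH P μ) (hρs : 0 < ρs) {l : ℝ} (hl : 0 < l) :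
    HasDerivAt (G P μ ρs) (μ l / l ^ (3 / 2 : ℝ) * √(Q P ρs l)) l :=
  hasDerivAt_integral_of_continuousOn_Ioi (hH.continuousOn_G' hρs) hρs hl

theorem monotoneOn_G (hH : AssumptionH P μ) (hρs : 0 < ρs) :
    MonotoneOn (G P μ ρs) (Ioi 0) := by
  refine monotoneOn_of_deriv_nonneg (convex_Ioi 0)
    (fun l hl => (hH.hasDerivAt_G hρs hl).continuousAt.continuousWithinAt) ?_ ?_
  · rw [interior_Ioi]
    exact fun l hl => (hH.hasDerivAt_G hρs hl).differentiableAt.differentiableWithinAt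
  · rw [interior_Ioi]
    intro l hl
    rw [(hH.hasDerivAt_G hρs hl).deriv]
    exact mul_nonneg (div_nonneg (hH.μ_pos l hl).le (Real.rpow_nonneg (le_of_lt hl) _))
      (Real.sqrt_nonneg _)

/-- The potential energy per unit mass blows up in the vacuum limit. -/
theorem exists_lt_specific (hH : AssumptionH P μ) (hρs : 0 < ρs) (S : ℝ) :
    ∃ δ, 0 < δ ∧ ∀ l, 0 < l → l ≤ δ → S * l < Q P ρs l := by
  -- For τ ≤ ρ*/2 monotonicity gives P(ρ*) - P(τ) ≥ c, so Q(l)/l dominates the integral of c/τ² from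
  -- l to ρ*/2, which is c(1/l - 2/ρ*).
  set c := P ρs - P (ρs / 2) with hc
  have hc0 : 0 < c := sub_pos.2 (hH.strictMonoOn_P (half_pos hρs) hρs (half_lt_self hρs))
  have hlim : Tendsto (fun l : ℝ => c * (l⁻¹ - 2 / ρs)) (𝓝[>] 0) atTop :=
    (tendsto_atTop_add_const_right _ _ tendsto_inv_nhdsGT_zero).const_mul_atTop hc0
  obtain ⟨δ, hδ, hδS⟩ := mem_nhdsGT_iff_exists_Ioc_subset.1
    (inter_mem (hlim.eventually_gt_atTop S) (Ioo_mem_nhdsGT (half_pos hρs)))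
  refine ⟨δ, hδ, fun l hl hlδ => ?_⟩
  obtain ⟨h1, -, h2⟩ := hδS ⟨hl, hlδ⟩
  rw [hH.Q_eq_mul hρs hl, mul_comm]
  refine mul_lt_mul_of_pos_left (lt_of_lt_of_le h1 ?_) hl
  have hint : ∀ x y, 0 < x → 0 < y →
      IntervalIntegrable (fun τ => (P ρs - P τ) / τ ^ 2) volume x y := fun x y hx hy => by
    have := (((hH.continuousOn_specific (P ρs)).mono
      fun z hz => lt_of_lt_of_le (lt_min hx hy) hz.1).intervalIntegrable
        (μ := volume) (a := x) (b := y)).neg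
    refine this.congr (fun z _ => ?_)
    simp only [Pi.neg_apply]
    ring
  have hsym : ∫ τ in ρs..l, (P τ - P ρs) / τ ^ 2 = ∫ τ in l..ρs, (P ρs - P τ) / τ ^ 2 := by
    rw [intervalIntegral.integral_symm, ← intervalIntegral.integral_neg]
    congr 1
    ext τ
    ring
  have h2' : l < ρs / 2 := h2
  rw [hsym, ← intervalIntegral.integral_add_adjacent_intervals (hint l (ρs / 2) hl (half_pos hρs))
    (hint (ρs / 2) ρs (half_pos hρs) hρs)]
  have hA : 0 ≤ ∫ τ in (ρs / 2)..ρs, (P ρs - P τ) / τ ^ 2 :=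
    intervalIntegral.integral_nonneg (half_le_self hρs.le) fun u hu =>
      div_nonneg (sub_nonneg.2 (hH.strictMonoOn_P.monotoneOn ((half_pos hρs).trans_le hu.1) hρs hu.2))
        (sq_nonneg u)
  have hcc : ContinuousOn (fun τ : ℝ => c / τ ^ 2) (uIcc l (ρs / 2)) :=
    continuousOn_const.div (continuousOn_id.pow 2) fun x hx =>
      pow_ne_zero 2 (lt_of_lt_of_le (lt_min hl (half_pos hρs)) hx.1).ne'
  have hB : ∫ τ in l..(ρs / 2), c / τ ^ 2 = c * (l⁻¹ - 2 / ρs) := by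
    rw [intervalIntegral.integral_eq_sub_of_hasDerivAt (f := fun τ => -c / τ) (fun x hx => ?_)
      hcc.intervalIntegrable]
    · have := hρs.ne'
      have := hl.ne'
      field_simp
      ring
    · have hx0 : x ≠ 0 := (lt_of_lt_of_le (lt_min hl (half_pos hρs)) hx.1).ne'
      refine ((hasDerivAt_const x (-c)).div (hasDerivAt_id x) hx0).congr_deriv ?_
      simp
  have hC : ∫ τ in l..(ρs / 2), c / τ ^ 2 ≤ ∫ τ in l..(ρs / 2), (P ρs - P τ) / τ ^ 2 := by
    refine intervalIntegral.integral_mono_on h2'.le hcc.intervalIntegrable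
      (hint l (ρs / 2) hl (half_pos hρs)) fun u hu => ?_
    have := hH.strictMonoOn_P.monotoneOn (hl.trans_le hu.1) (half_pos hρs) hu.2
    exact div_le_div_of_nonneg_right (by linarith) (sq_nonneg u)
  linarith

/-- By compactness one constant D bounds l, μ, P' and their reciprocals. Since k and P - P(ρ*)
vanish at ρ*, the mean value theorem turns this into two-sided linear bounds, and integrating the
bound for P - P(ρ*) gives the quadratic one for Q. -/
theorem exists_comparable (hH : AssumptionH P μ) (hρs : 0 < ρs) {m M : ℝ} (hm : 0 < m) :
    ∃ C, 1 ≤ C ∧ ∀ l ∈ Icc m M, Comparable P μ ρs C l := by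
  -- The range is enlarged to contain ρ*, with which every l is compared.
  set K := Icc (min m ρs) (max M ρs) with hK
  have hpos : ∀ l ∈ K, 0 < l := fun l hl => (lt_min hm hρs).trans_le hl.1
  have hbdd : ∀ f : ℝ → ℝ, ContinuousOn f (Ioi 0) → ∃ C, ∀ l ∈ K, |f l| ≤ C := fun f hf =>
    isCompact_Icc.exists_bound_of_continuousOn (hf.mono hpos)
  obtain ⟨C1, h1⟩ := hbdd id continuousOn_id
  obtain ⟨C2, h2⟩ := hbdd (fun l => l⁻¹) (continuousOn_id.inv₀ fun x hx => ne_of_gt hx)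
  obtain ⟨C3, h3⟩ := hbdd μ hH.continuousOn_μ
  obtain ⟨C4, h4⟩ := hbdd (fun l => (μ l)⁻¹)
    (hH.continuousOn_μ.inv₀ fun x hx => (hH.μ_pos x hx).ne')
  obtain ⟨C5, h5⟩ := hbdd (deriv P) hH.continuousOn_deriv_P
  obtain ⟨C6, h6⟩ := hbdd (fun l => (deriv P l)⁻¹)
    (hH.continuousOn_deriv_P.inv₀ fun x hx => (hH.deriv_P_pos x hx).ne')
  obtain ⟨D, hD1, hD⟩ : ∃ D, 1 ≤ D ∧ ∀ l ∈ K, l ≤ D ∧ l⁻¹ ≤ D ∧ μ l ≤ D ∧ (μ l)⁻¹ ≤ D ∧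
      |deriv P l| ≤ D ∧ (deriv P l)⁻¹ ≤ D := by
    refine ⟨1 + |C1| + |C2| + |C3| + |C4| + |C5| + |C6|, ?_, fun l hl => ?_⟩
    · linarith [abs_nonneg C1, abs_nonneg C2, abs_nonneg C3, abs_nonneg C4, abs_nonneg C5,
        abs_nonneg C6]
    · have e1 := (le_abs_self _).trans ((h1 l hl).trans (le_abs_self _))
      have e2 := (le_abs_self _).trans ((h2 l hl).trans (le_abs_self _))
      have e3 := (le_abs_self _).trans ((h3 l hl).trans (le_abs_self _))
      have e4 := (le_abs_self _).trans ((h4 l hl).trans (le_abs_self _))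
      have e5 := (h5 l hl).trans (le_abs_self _)
      have e6 := (le_abs_self _).trans ((h6 l hl).trans (le_abs_self _))
      have := abs_nonneg C1
      have := abs_nonneg C2
      have := abs_nonneg C3
      have := abs_nonneg C4
      have := abs_nonneg C5
      have := abs_nonneg C6
      simp only [id] at e1
      refine ⟨?_, ?_, ?_, ?_, ?_, ?_⟩ <;> linarith
  have hD0 : 0 < D := by linarith
  have hρK : ρs ∈ K := ⟨min_le_right _ _, le_max_right _ _⟩
  have hord : K.OrdConnected := ordConnected_Icc
  have hinv : ∀ l ∈ K, 1 ≤ D * l ∧ 1 ≤ D * μ l ∧ 1 ≤ D * deriv P l := fun l hl => by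
    obtain ⟨-, e2, -, e4, -, e6⟩ := hD l hl
    exact ⟨(inv_le_iff_one_le_mul₀ (hpos l hl)).1 e2,
      (inv_le_iff_one_le_mul₀ (hH.μ_pos l (hpos l hl))).1 e4,
      (inv_le_iff_one_le_mul₀ (hH.deriv_P_pos l (hpos l hl))).1 e6⟩
  have hk0 : k μ ρs ρs = 0 := by simp [k]
  have hkup : ∀ l ∈ K, |k μ ρs l| ≤ D ^ 2 * |l - ρs| := fun l hl => by
    have := abs_sub_le_of_deriv_le hord (fun x hx => hH.hasDerivAt_k hρs (hpos x hx))
      (C := D ^ 2) (fun x hx => ?_) hl hρK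
    · rwa [hk0, sub_zero] at this
    · obtain ⟨-, e2, e3, -⟩ := hD x hx
      rw [abs_of_pos (div_pos (hH.μ_pos x (hpos x hx)) (hpos x hx)), div_eq_mul_inv, pow_two]
      exact mul_le_mul e3 e2 (inv_nonneg.2 (hpos x hx).le) hD0.le
  have hklow : ∀ l ∈ K, |l - ρs| ≤ D ^ 2 * |k μ ρs l| := fun l hl => by
    have := abs_sub_le_of_le_deriv hord (fun x hx => hH.hasDerivAt_k hρs (hpos x hx))
      (C := D ^ 2) (by positivity) (fun x hx => ?_) hl hρK
    · rwa [hk0, sub_zero] at this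
    · have hx0 := hpos x hx
      rw [← mul_div_assoc, le_div_iff₀ hx0]
      have e1 := (hD x hx).1
      have e4 := (hinv x hx).2.1
      calc 1 * x ≤ D * 1 := by linarith
        _ ≤ D * (D * μ x) := by gcongr
        _ = D ^ 2 * μ x := by ring
  have hPlow : ∀ l ∈ K, |l - ρs| ≤ D * |P l - P ρs| := fun l hl =>
    abs_sub_le_of_le_deriv hord (fun x hx => hH.hasDerivAt_P (hpos x hx)) hD0.le
      (fun x hx => (hinv x hx).2.2) hl hρK
  have hPup : ∀ l ∈ K, |P l - P ρs| ≤ D * |l - ρs| := fun l hl =>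
    abs_sub_le_of_deriv_le hord (fun x hx => hH.hasDerivAt_P (hpos x hx))
      (fun x hx => (hD x hx).2.2.2.2.1) hl hρK
  have hDp : ∀ n : ℕ, D ^ n ≤ D ^ (n + 1) := fun n => pow_le_pow_right₀ hD1 n.le_succ
  have hD14 : D ≤ D ^ 5 := by
    simpa using pow_le_pow_right₀ hD1 (show 1 ≤ 5 by norm_num)
  have hD24 : D ^ 2 ≤ D ^ 5 := pow_le_pow_right₀ hD1 (by norm_num)
  have hD34 : D ^ 3 ≤ D ^ 5 := pow_le_pow_right₀ hD1 (by norm_num)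
  -- The individual estimates need powers of D up to the fourth; as D ≥ 1, one higher power covers
  -- all of them.
  refine ⟨D ^ 5, hD1.trans hD14, fun l hlm => ?_⟩
  have hl : l ∈ K := ⟨(min_le_left _ _).trans hlm.1, hlm.2.trans (le_max_left _ _)⟩
  have hl0 := hpos l hl
  obtain ⟨e1, e2, e3⟩ := hinv l hl
  refine ⟨(hD l hl).1.trans hD14, e1.trans ?_, (hD l hl).2.2.1.trans hD14, e2.trans ?_,
    e3.trans ?_, (hkup l hl).trans ?_, (hklow l hl).trans ?_, ?_, ?_⟩
  · gcongr
  · have := hH.μ_pos l hl0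
    gcongr
  · have := hH.deriv_P_pos l hl0
    gcongr
  · gcongr
  · gcongr
  · calc (l - ρs) ^ 2 = |l - ρs| * |l - ρs| := by rw [← sq_abs, pow_two]
      _ ≤ (D ^ 2 * |k μ ρs l|) * (D * |P l - P ρs|) :=
        mul_le_mul (hklow l hl) (hPlow l hl) (abs_nonneg _) (by positivity)
      _ = D ^ 3 * |k μ ρs l * (P l - P ρs)| := by rw [abs_mul]; ring
      _ = D ^ 3 * (k μ ρs l * (P l - P ρs)) := by rw [abs_of_nonneg (hH.k_mul_nonneg hρs hl0)]
      _ ≤ D ^ 5 * (k μ ρs l * (P l - P ρs)) :=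
        mul_le_mul_of_nonneg_right hD34 (hH.k_mul_nonneg hρs hl0)
  · have hint : |∫ τ in ρs..l, (P τ - P ρs) / τ ^ 2| ≤ D ^ 3 * |l - ρs| * |l - ρs| := by
      refine intervalIntegral.norm_integral_le_of_norm_le_const (E := ℝ) fun τ hτ => ?_
      have hτ' : τ ∈ uIcc ρs l := uIoc_subset_uIcc hτ
      have hτK : τ ∈ K := hord.uIcc_subset hρK hl hτ'
      have hτ0 := hpos τ hτK
      have hτl : |τ - ρs| ≤ |l - ρs| := abs_sub_left_of_mem_uIcc hτ'
      rw [Real.norm_eq_abs, abs_div, abs_of_nonneg (sq_nonneg τ), div_eq_mul_inv, ← inv_pow]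
      have e2 := (hD τ hτK).2.1
      calc |P τ - P ρs| * τ⁻¹ ^ 2 ≤ (D * |l - ρs|) * D ^ 2 := by
            gcongr
            exact (hPup τ hτK).trans (by gcongr)
        _ = D ^ 3 * |l - ρs| := by ring
    rw [hH.Q_eq_mul hρs hl0]
    calc l * ∫ τ in ρs..l, (P τ - P ρs) / τ ^ 2
        ≤ l * (D ^ 3 * |l - ρs| * |l - ρs|) := by gcongr; exact (le_abs_self _).trans hint
      _ ≤ D * (D ^ 3 * |l - ρs| * |l - ρs|) := by gcongr; exact (hD l hl).1
      _ = D ^ 4 * (l - ρs) ^ 2 := by rw [← sq_abs (l - ρs)]; ring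
      _ ≤ D ^ 5 * (l - ρs) ^ 2 := by gcongr 1; exact hDp 4

end AssumptionH

end GasLaws


/-! ### Integrals of continuous functions -/

theorem integral_le_integral_of_continuousOn {f g : ℝ → ℝ} {a b : ℝ} (hab : a ≤ b)
    (hf : ContinuousOn f (Icc a b)) (hg : ContinuousOn g (Icc a b))
    (h : ∀ x ∈ Icc a b, f x ≤ g x) : ∫ x in a..b, f x ≤ ∫ x in a..b, g x :=
  intervalIntegral.integral_mono_on hab (hf.intervalIntegrable_of_Icc hab)
    (hg.intervalIntegrable_of_Icc hab) h

/-- Cauchy–Schwarz, read off from the nonnegative integral of (f - c)² with c the mean of f. -/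
theorem sq_integral_le {f : ℝ → ℝ} {a b : ℝ} (hab : a ≤ b) (hf : ContinuousOn f (Icc a b)) :
    (∫ x in a..b, f x) ^ 2 ≤ (b - a) * ∫ x in a..b, f x ^ 2 := by
  rcases eq_or_lt_of_le hab with rfl | hlt
  · simp
  set c := (∫ x in a..b, f x) / (b - a) with hc
  have hba : 0 < b - a := sub_pos.2 hlt
  have h0 : 0 ≤ ∫ x in a..b, (f x - c) ^ 2 :=
    intervalIntegral.integral_nonneg hab fun _ _ => sq_nonneg _
  have hi1 : IntervalIntegrable (fun x => f x ^ 2) volume a b :=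
    (hf.pow 2).intervalIntegrable_of_Icc hab
  have hi2 : IntervalIntegrable (fun x => 2 * c * f x) volume a b :=
    (hf.intervalIntegrable_of_Icc hab).const_mul _
  have h1 : ∫ x in a..b, (f x - c) ^ 2
      = (∫ x in a..b, f x ^ 2) - 2 * c * (∫ x in a..b, f x) + (b - a) * c ^ 2 := by
    rw [← intervalIntegral.integral_const_mul, ← intervalIntegral.integral_sub hi1 hi2,
      show (b - a) * c ^ 2 = ∫ _ in a..b, c ^ 2 by simp,
      ← intervalIntegral.integral_add (hi1.sub hi2) (by simp)]
    refine intervalIntegral.integral_congr fun x _ => ?_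
    ring
  have h2 : (b - a) * c = ∫ x in a..b, f x := by rw [hc]; field_simp
  rw [h1, ← h2] at h0
  rw [← h2]
  nlinarith

/-- The square of an increment is controlled by the `L²` norm of the derivative. -/
theorem sq_sub_le_integral_sq {f f' : ℝ → ℝ} {a b : ℝ} (hf : ContinuousOn f (Icc a b))
    (hf' : ContinuousOn f' (Icc a b)) (hd : ∀ x ∈ Ioo a b, HasDerivAt f (f' x) x) {x y : ℝ}
    (hx : x ∈ Icc a b) (hy : y ∈ Icc a b) :
    (f x - f y) ^ 2 ≤ (b - a) * ∫ z in a..b, f' z ^ 2 := by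
  wlog hxy : y ≤ x generalizing x y
  · rw [← neg_sub, neg_sq]
    exact this hy hx (le_of_not_ge hxy)
  have hsub : Icc y x ⊆ Icc a b := Icc_subset_Icc hy.1 hx.2
  have hab : a ≤ b := hx.1.trans hx.2
  rw [← intervalIntegral.integral_eq_sub_of_hasDerivAt_of_le hxy (hf.mono hsub)
    (fun z hz => hd z ⟨hy.1.trans_lt hz.1, hz.2.trans_le hx.2⟩)
    ((hf'.mono hsub).intervalIntegrable_of_Icc hxy)]
  refine (sq_integral_le hxy (hf'.mono hsub)).trans ?_
  refine mul_le_mul (by linarith [hx.2, hy.1]) ?_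
    (intervalIntegral.integral_nonneg hxy fun _ _ => sq_nonneg _) (by linarith)
  exact intervalIntegral.integral_mono_interval hy.1 hxy hx.2
    (Eventually.of_forall fun _ => sq_nonneg _) ((hf'.pow 2).intervalIntegrable_of_Icc hab)

/-! ### Regular profiles -/

/-- Profiles on `[a, b]` of a density with derivative `ρ'` and of a velocity. -/
structure IsProfile (a b : ℝ) (ρ ρ' v : ℝ → ℝ) : Prop where
  lt : a < b
  pos : ∀ x ∈ Icc a b, 0 < ρ x
  cont : ContinuousOn ρ (Icc a b)
  cont' : ContinuousOn ρ' (Icc a b)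
  hasDerivAt : ∀ x ∈ Ioo a b, HasDerivAt ρ (ρ' x) x
  cont_v : ContinuousOn v (Icc a b)
  mass : ∫ x in a..b, ρ x = 1

/-- The Lyapunov functional of a profile whose density has the derivative `ρ'`. -/
noncomputable def lyapunov (P μ : ℝ → ℝ) (ρs r a b : ℝ) (ρ ρ' v : ℝ → ℝ) : ℝ :=
  (1 / 2) * (∫ x in a..b, 1 / ρ x * (ρ x * v x + μ (ρ x) / ρ x * ρ' x) ^ 2)
    + (1 / 2) * (v b - k μ ρs (ρ b)) ^ 2 + (1 / 2) * (v a + k μ ρs (ρ a)) ^ 2 + U P ρs a b ρ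
    + r * (v a ^ 2 / 2 + v b ^ 2 / 2 + (1 / 2) * (∫ x in a..b, ρ x * v x ^ 2) + U P ρs a b ρ)

/-- The dissipation of the Lyapunov functional under the feedback law. -/
noncomputable def dissipation (P μ : ℝ → ℝ) (ρs R r a b : ℝ) (ρ ρ' v v' : ℝ → ℝ) : ℝ :=
  (∫ x in a..b, deriv P (ρ x) * μ (ρ x) / ρ x ^ 2 * ρ' x ^ 2)
    + r * (∫ x in a..b, μ (ρ x) * v' x ^ 2)
    + k μ ρs (ρ b) * (P (ρ b) - P ρs) + k μ ρs (ρ a) * (P (ρ a) - P ρs)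
    + R * ((r + 1) * v a + k μ ρs (ρ a)) ^ 2

namespace IsProfile

variable {P μ : ℝ → ℝ} {ρs r R a b C : ℝ} {ρ ρ' v v' : ℝ → ℝ}

theorem left_mem (h : IsProfile a b ρ ρ' v) : a ∈ Icc a b := left_mem_Icc.2 h.lt.le

theorem right_mem (h : IsProfile a b ρ ρ' v) : b ∈ Icc a b := right_mem_Icc.2 h.lt.le

theorem comp (h : IsProfile a b ρ ρ' v) {F : ℝ → ℝ} (hF : ContinuousOn F (Ioi 0)) :
    ContinuousOn (fun x => F (ρ x)) (Icc a b) :=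
  hF.comp h.cont h.pos

/-- The chain rule identifies the integrands on the open interval. At the end points `deriv` may
take another value, but these form a null set. -/
theorem V_eq_lyapunov (h : IsProfile a b ρ ρ' v) (hH : AssumptionH P μ) (hρs : 0 < ρs) :
    V P μ ρs r a b ρ v = lyapunov P μ ρs r a b ρ ρ' v := by
  have : ∫ x in a..b, 1 / ρ x * (ρ x * v x + deriv (fun y => k μ ρs (ρ y)) x) ^ 2
      = ∫ x in a..b, 1 / ρ x * (ρ x * v x + μ (ρ x) / ρ x * ρ' x) ^ 2 := by
    rw [intervalIntegral.integral_of_le h.lt.le, intervalIntegral.integral_of_le h.lt.le,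
      integral_Ioc_eq_integral_Ioo, integral_Ioc_eq_integral_Ioo]
    refine setIntegral_congr_fun measurableSet_Ioo fun x hx => ?_
    have := ((hH.hasDerivAt_k hρs (h.pos x (Ioo_subset_Icc_self hx))).comp x
      (h.hasDerivAt x hx)).deriv
    simp only [Function.comp_def] at this
    simp only [this]
  rw [V, W, E, this, lyapunov]

theorem cont_w (h : IsProfile a b ρ ρ' v) (hH : AssumptionH P μ) :
    ContinuousOn (fun x => 1 / ρ x * (ρ x * v x + μ (ρ x) / ρ x * ρ' x) ^ 2) (Icc a b) :=
  (continuousOn_const.div h.cont fun x hx => (h.pos x hx).ne').mul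
    (((h.cont.mul h.cont_v).add ((h.comp hH.continuousOn_k').mul h.cont')).pow 2)

theorem cont_kinetic (h : IsProfile a b ρ ρ' v) :
    ContinuousOn (fun x => ρ x * v x ^ 2) (Icc a b) :=
  h.cont.mul (h.cont_v.pow 2)

theorem cont_gradient (h : IsProfile a b ρ ρ' v) (hH : AssumptionH P μ) :
    ContinuousOn (fun x => 1 / ρ x * (μ (ρ x) / ρ x * ρ' x) ^ 2) (Icc a b) :=
  (continuousOn_const.div h.cont fun x hx => (h.pos x hx).ne').mul
    (((h.comp hH.continuousOn_k').mul h.cont').pow 2)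

theorem integral_w_nonneg (h : IsProfile a b ρ ρ' v) :
    0 ≤ ∫ x in a..b, 1 / ρ x * (ρ x * v x + μ (ρ x) / ρ x * ρ' x) ^ 2 :=
  intervalIntegral.integral_nonneg h.lt.le fun x hx =>
    mul_nonneg (one_div_nonneg.2 (h.pos x hx).le) (sq_nonneg _)

theorem integral_kinetic_nonneg (h : IsProfile a b ρ ρ' v) :
    0 ≤ ∫ x in a..b, ρ x * v x ^ 2 :=
  intervalIntegral.integral_nonneg h.lt.le fun x hx => mul_nonneg (h.pos x hx).le (sq_nonneg _)

theorem U_nonneg (h : IsProfile a b ρ ρ' v) (hH : AssumptionH P μ) (hρs : 0 < ρs) :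
    0 ≤ U P ρs a b ρ :=
  intervalIntegral.integral_nonneg h.lt.le fun x hx => hH.Q_nonneg hρs (h.pos x hx)

/-- Each term of the Lyapunov functional is controlled by the whole. -/
theorem terms_le_lyapunov (h : IsProfile a b ρ ρ' v) (hH : AssumptionH P μ) (hρs : 0 < ρs)
    (hr : 0 < r) :
    (∫ x in a..b, 1 / ρ x * (ρ x * v x + μ (ρ x) / ρ x * ρ' x) ^ 2)
      ≤ 2 * lyapunov P μ ρs r a b ρ ρ' v ∧
    (v b - k μ ρs (ρ b)) ^ 2 ≤ 2 * lyapunov P μ ρs r a b ρ ρ' v ∧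
    U P ρs a b ρ ≤ lyapunov P μ ρs r a b ρ ρ' v ∧
    v a ^ 2 ≤ 2 / r * lyapunov P μ ρs r a b ρ ρ' v ∧
    v b ^ 2 ≤ 2 / r * lyapunov P μ ρs r a b ρ ρ' v ∧
    (∫ x in a..b, ρ x * v x ^ 2) ≤ 2 / r * lyapunov P μ ρs r a b ρ ρ' v := by
  have h1 := h.integral_w_nonneg (μ := μ)
  have h2 := h.integral_kinetic_nonneg
  have h3 := h.U_nonneg hH hρs
  have h4 := sq_nonneg (v b - k μ ρs (ρ b))
  have h5 := sq_nonneg (v a + k μ ρs (ρ a))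
  have h6 := mul_nonneg hr.le h2
  have h7 := mul_nonneg hr.le h3
  have h8 := mul_nonneg hr.le (sq_nonneg (v a))
  have h9 := mul_nonneg hr.le (sq_nonneg (v b))
  have hdiv : ∀ x y : ℝ, r * x ≤ 2 * y → x ≤ 2 / r * y := fun x y hxy => by
    rw [div_mul_eq_mul_div, le_div_iff₀ hr]
    linarith
  refine ⟨?_, ?_, ?_, hdiv _ _ ?_, hdiv _ _ ?_, hdiv _ _ ?_⟩ <;> unfold lyapunov <;> linarith

theorem lyapunov_nonneg (h : IsProfile a b ρ ρ' v) (hH : AssumptionH P μ) (hρs : 0 < ρs)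
    (hr : 0 < r) : 0 ≤ lyapunov P μ ρs r a b ρ ρ' v :=
  (h.U_nonneg hH hρs).trans (h.terms_le_lyapunov hH hρs hr).2.2.1

/-- With A = ρv and B = k(ρ)ₓ, the pointwise gap 2(A + B)² + 2A² - B² is the square (2A + B)². The
kinetic energy in E thus frees the density gradient from the transformed momentum. -/
theorem integral_gradient_le (h : IsProfile a b ρ ρ' v) (hH : AssumptionH P μ) :
    (∫ x in a..b, 1 / ρ x * (μ (ρ x) / ρ x * ρ' x) ^ 2)
      ≤ 2 * (∫ x in a..b, 1 / ρ x * (ρ x * v x + μ (ρ x) / ρ x * ρ' x) ^ 2)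
        + 2 * ∫ x in a..b, ρ x * v x ^ 2 := by
  have hw := h.cont_w hH
  have hk := h.cont_kinetic
  rw [← intervalIntegral.integral_const_mul, ← intervalIntegral.integral_const_mul,
    ← intervalIntegral.integral_add ((hw.intervalIntegrable_of_Icc h.lt.le).const_mul _)
      ((hk.intervalIntegrable_of_Icc h.lt.le).const_mul _)]
  refine integral_le_integral_of_continuousOn h.lt.le (h.cont_gradient hH)
    ((continuousOn_const.mul hw).add (continuousOn_const.mul hk)) fun x hx => ?_
  have hx0 := h.pos x hx
  have : 2 * (1 / ρ x * (ρ x * v x + μ (ρ x) / ρ x * ρ' x) ^ 2) + 2 * (ρ x * v x ^ 2)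
      - 1 / ρ x * (μ (ρ x) / ρ x * ρ' x) ^ 2
      = 1 / ρ x * (2 * (ρ x * v x) + μ (ρ x) / ρ x * ρ' x) ^ 2 := by
    field_simp
    ring
  have h2 : 0 ≤ 1 / ρ x * (2 * (ρ x * v x) + μ (ρ x) / ρ x * ρ' x) ^ 2 := by positivity
  linarith

theorem integral_w_le (h : IsProfile a b ρ ρ' v) (hH : AssumptionH P μ) :
    (∫ x in a..b, 1 / ρ x * (ρ x * v x + μ (ρ x) / ρ x * ρ' x) ^ 2)
      ≤ 2 * (∫ x in a..b, 1 / ρ x * (μ (ρ x) / ρ x * ρ' x) ^ 2)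
        + 2 * ∫ x in a..b, ρ x * v x ^ 2 := by
  have hw := h.cont_gradient hH
  have hk := h.cont_kinetic
  rw [← intervalIntegral.integral_const_mul, ← intervalIntegral.integral_const_mul,
    ← intervalIntegral.integral_add ((hw.intervalIntegrable_of_Icc h.lt.le).const_mul _)
      ((hk.intervalIntegrable_of_Icc h.lt.le).const_mul _)]
  refine integral_le_integral_of_continuousOn h.lt.le (h.cont_w hH)
    ((continuousOn_const.mul hw).add (continuousOn_const.mul hk)) fun x hx => ?_
  have hx0 := h.pos x hx
  have : 2 * (1 / ρ x * (μ (ρ x) / ρ x * ρ' x) ^ 2) + 2 * (ρ x * v x ^ 2)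
      - 1 / ρ x * (ρ x * v x + μ (ρ x) / ρ x * ρ' x) ^ 2
      = 1 / ρ x * (ρ x * v x - μ (ρ x) / ρ x * ρ' x) ^ 2 := by
    field_simp
    ring
  have h2 : 0 ≤ 1 / ρ x * (ρ x * v x - μ (ρ x) / ρ x * ρ' x) ^ 2 := by positivity
  linarith

/-! ### Bounds for the density -/

/-- The derivative of G(ρ(x)) factors as A√Q(ρ), where A² is the integrand of the gradient energy;
the elementary bound |A|√Q ≤ A² + Q is then integrated. -/
theorem G_sub_le (h : IsProfile a b ρ ρ' v) (hH : AssumptionH P μ) (hρs : 0 < ρs)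
    {x y : ℝ} (hx : x ∈ Icc a b) (hy : y ∈ Icc a b) :
    |G P μ ρs (ρ x) - G P μ ρs (ρ y)|
      ≤ (∫ x in a..b, 1 / ρ x * (μ (ρ x) / ρ x * ρ' x) ^ 2) + U P ρs a b ρ := by
  wlog hxy : y ≤ x generalizing x y
  · rw [abs_sub_comm]
    exact this hy hx (le_of_not_ge hxy)
  have hsub : Icc y x ⊆ Icc a b := Icc_subset_Icc hy.1 hx.2
  have hG : ContinuousOn (G P μ ρs) (Ioi 0) :=
    fun _ hl => (hH.hasDerivAt_G hρs hl).continuousAt.continuousWithinAt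
  have hQ := h.comp (hH.continuousOn_Q hρs)
  have hg := h.cont_gradient hH
  have hG' : ContinuousOn (fun z => μ (ρ z) / ρ z ^ (3 / 2 : ℝ) * √(Q P ρs (ρ z)) * ρ' z)
      (Icc a b) := (h.comp (hH.continuousOn_G' hρs)).mul h.cont'
  rw [← intervalIntegral.integral_eq_sub_of_hasDerivAt_of_le hxy ((h.comp hG).mono hsub)
    (fun z hz => by
      have hz' : z ∈ Ioo a b := ⟨hy.1.trans_lt hz.1, hz.2.trans_le hx.2⟩
      exact (hH.hasDerivAt_G hρs (h.pos z (Ioo_subset_Icc_self hz'))).comp z (h.hasDerivAt z hz'))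
    ((hG'.mono hsub).intervalIntegrable_of_Icc hxy), U,
    ← intervalIntegral.integral_add (hg.intervalIntegrable_of_Icc h.lt.le)
      (hQ.intervalIntegrable_of_Icc h.lt.le)]
  refine (intervalIntegral.abs_integral_le_integral_abs hxy).trans ?_
  have hnn : ∀ z ∈ Icc a b, 0 ≤ 1 / ρ z * (μ (ρ z) / ρ z * ρ' z) ^ 2 + Q P ρs (ρ z) :=
    fun z hz => add_nonneg (mul_nonneg (one_div_nonneg.2 (h.pos z hz).le) (sq_nonneg _))
      (hH.Q_nonneg hρs (h.pos z hz))
  refine (integral_le_integral_of_continuousOn hxy (hG'.mono hsub).abs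
    ((hg.add hQ).mono hsub) fun z hz => ?_).trans ?_
  · have hz0 := h.pos z (hsub hz)
    have hQ0 := hH.Q_nonneg hρs hz0
    have e1 : ρ z ^ (3 / 2 : ℝ) = ρ z * √(ρ z) := by
      rw [Real.sqrt_eq_rpow, show (3 / 2 : ℝ) = 1 + 1 / 2 by norm_num, Real.rpow_add hz0,
        Real.rpow_one]
    set A := μ (ρ z) / ρ z * ρ' z / √(ρ z) with hA
    have e2 : μ (ρ z) / ρ z ^ (3 / 2 : ℝ) * √(Q P ρs (ρ z)) * ρ' z = A * √(Q P ρs (ρ z)) := by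
      rw [e1, hA]
      have := (Real.sqrt_pos.2 hz0).ne'
      field_simp
    have e3 : 1 / ρ z * (μ (ρ z) / ρ z * ρ' z) ^ 2 = A ^ 2 := by
      rw [hA, div_pow _ (√(ρ z)), Real.sq_sqrt hz0.le]
      ring
    simp only [Pi.add_apply]
    rw [e2, e3, abs_mul]
    have e4 : Q P ρs (ρ z) = |√(Q P ρs (ρ z))| ^ 2 := by rw [sq_abs, Real.sq_sqrt hQ0]
    conv_rhs => rw [e4]
    rw [← sq_abs A]
    nlinarith [sq_nonneg (|A| - |√(Q P ρs (ρ z))|), sq_nonneg (|A|),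
      sq_nonneg (|√(Q P ρs (ρ z))|)]
  · refine intervalIntegral.integral_mono_interval hy.1 hxy hx.2 ?_
      ((hg.add hQ).intervalIntegrable_of_Icc h.lt.le)
    filter_upwards [ae_restrict_mem measurableSet_Ioc] with z hz
    exact hnn z (Ioc_subset_Icc_self hz)

/-- The oscillation of G(ρ) is at most B, so one point where ρ is not too small and one where it is
not too large suffice. The limits of G at 0 and at infinity then confine ρ on the whole interval. -/
theorem exists_density_bounds (hH : AssumptionH P μ) (hρs : 0 < ρs) (hr : 0 < r) (S : ℝ) :
    ∃ m M, 0 < m ∧ ∀ (a b : ℝ) (ρ ρ' v : ℝ → ℝ), IsProfile a b ρ ρ' v →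
      lyapunov P μ ρs r a b ρ ρ' v ≤ S → ∀ x ∈ Icc a b, ρ x ∈ Icc m M := by
  set B := 2 * (2 * S) + 2 * (2 / r * S) + S with hB
  have hGB : ∀ (a b : ℝ) (ρ ρ' v : ℝ → ℝ), IsProfile a b ρ ρ' v →
      lyapunov P μ ρs r a b ρ ρ' v ≤ S → ∀ x ∈ Icc a b, ∀ y ∈ Icc a b,
        |G P μ ρs (ρ x) - G P μ ρs (ρ y)| ≤ B := by
    intro a b ρ ρ' v h hS x hx y hy
    refine (h.G_sub_le hH hρs hx hy).trans ?_
    obtain ⟨h1, -, h3, -, -, h6⟩ := h.terms_le_lyapunov hH hρs hr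
    have h7 := h.integral_gradient_le hH
    have h8 : 2 / r * lyapunov P μ ρs r a b ρ ρ' v ≤ 2 / r * S := by gcongr
    linarith
  -- The density exceeds δ somewhere: otherwise Q(ρ) > Sρ throughout, and unit mass would give a
  -- potential energy above S.
  obtain ⟨δ, hδ, hδS⟩ := hH.exists_lt_specific hρs S
  -- The parenthesis after 1 bounds k(ρ(b))², through v(b) and v(b) - k(ρ(b)). A number whose square
  -- is at most q cannot exceed 1 + q, whence ρ(b) ≤ L.
  obtain ⟨L, hL, hL0⟩ := ((((hH.k_atTop ρs hρs).eventually_gt_atTop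
    (1 + (2 * (2 * S) + 2 * (2 / r * S)))).and (eventually_gt_atTop 0))).exists
  obtain ⟨M, hM⟩ := (eventually_atTop.1 ((hH.G_atTop ρs hρs).eventually_gt_atTop
    (G P μ ρs L + B)))
  obtain ⟨m, hm0, hm⟩ := mem_nhdsGT_iff_exists_Ioc_subset.1
    ((hH.G_zero ρs hρs).eventually_lt_atBot (G P μ ρs δ - B))
  refine ⟨m, M, hm0, fun a b ρ ρ' v h hS x hx => ⟨?_, ?_⟩⟩
  · obtain ⟨y, hy, hyδ⟩ : ∃ y ∈ Icc a b, δ < ρ y := by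
      by_contra! hcon
      have h1 : ∫ x in a..b, S * ρ x < ∫ x in a..b, Q P ρs (ρ x) := by
        refine intervalIntegral.integral_lt_integral_of_continuousOn_of_le_of_exists_lt h.lt
          (continuousOn_const.mul h.cont) (h.comp (hH.continuousOn_Q hρs))
          (fun z hz => (hδS _ (h.pos z (Ioc_subset_Icc_self hz))
            (hcon z (Ioc_subset_Icc_self hz))).le)
          ⟨a, h.left_mem, hδS _ (h.pos a h.left_mem) (hcon a h.left_mem)⟩
      rw [intervalIntegral.integral_const_mul, h.mass, mul_one] at h1
      have h2 := (h.terms_le_lyapunov hH hρs hr).2.2.1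
      rw [U] at h2
      linarith
    by_contra! hlt
    have h1 : G P μ ρs (ρ x) < G P μ ρs δ - B := hm ⟨h.pos x hx, hlt.le⟩
    have h2 := hH.monotoneOn_G hρs hδ (h.pos y hy) hyδ.le
    have h3 := (abs_le.1 (hGB a b ρ ρ' v h hS x hx y hy)).1
    linarith
  · have hbL : ρ b ≤ L := by
      by_contra! hlt
      have h1 := (hH.strictMonoOn_k hρs) hL0 (h.pos b h.right_mem) hlt
      obtain ⟨-, h2, -, -, h3, -⟩ := h.terms_le_lyapunov hH hρs hr
      have h8 : 2 / r * lyapunov P μ ρs r a b ρ ρ' v ≤ 2 / r * S := by gcongr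
      have hS0 := (h.lyapunov_nonneg hH hρs hr).trans hS
      have h9 : 0 ≤ 2 / r * S := by positivity
      have h10 : k μ ρs (ρ b) ^ 2 ≤ 2 * (2 * S) + 2 * (2 / r * S) := by
        nlinarith [sq_nonneg (v b - k μ ρs (ρ b) + v b)]
      nlinarith
    by_contra! hlt
    have h1 := hM (ρ x) hlt.le
    have h2 := hH.monotoneOn_G hρs (h.pos b h.right_mem) hL0 hbL
    have h3 := (abs_le.1 (hGB a b ρ ρ' v h hS x hx b h.right_mem)).2
    linarith

/-! ### Equivalence of the Lyapunov functional with the norm -/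

theorem integral_mul_sq_le (h : IsProfile a b ρ ρ' v) {f g : ℝ → ℝ}
    (hf : ContinuousOn f (Icc a b)) (hg : ContinuousOn g (Icc a b))
    (hC : ∀ x ∈ Icc a b, f x ≤ C) :
    ∫ x in a..b, f x * g x ^ 2 ≤ C * ∫ x in a..b, g x ^ 2 := by
  rw [← intervalIntegral.integral_const_mul]
  exact integral_le_integral_of_continuousOn h.lt.le (hf.mul (hg.pow 2))
    (continuousOn_const.mul (hg.pow 2)) fun x hx =>
      mul_le_mul_of_nonneg_right (hC x hx) (sq_nonneg _)

theorem integral_sq_le_mul (h : IsProfile a b ρ ρ' v) {f g : ℝ → ℝ}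
    (hf : ContinuousOn f (Icc a b)) (hg : ContinuousOn g (Icc a b))
    (hC : ∀ x ∈ Icc a b, 1 ≤ C * f x) :
    ∫ x in a..b, g x ^ 2 ≤ C * ∫ x in a..b, f x * g x ^ 2 := by
  rw [← intervalIntegral.integral_const_mul]
  refine integral_le_integral_of_continuousOn h.lt.le (hg.pow 2)
    (continuousOn_const.mul (hf.mul (hg.pow 2))) fun x hx => ?_
  nlinarith [hC x hx, sq_nonneg (g x)]

/-- Unit mass converts a lower bound on the density into an upper bound on the length. Such a bound
is needed in every estimate that passes from a point value to the whole interval. -/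
theorem length_le (h : IsProfile a b ρ ρ' v) (hC : ∀ x ∈ Icc a b, Comparable P μ ρs C (ρ x)) :
    b - a ≤ C := by
  have h1 : ∫ _ in a..b, (1 : ℝ) ≤ ∫ x in a..b, C * ρ x :=
    integral_le_integral_of_continuousOn h.lt.le continuousOn_const
      (continuousOn_const.mul h.cont) fun x hx => (hC x hx).one_le
  rw [intervalIntegral.integral_const_mul, h.mass] at h1
  simpa using h1

theorem one_le_length (h : IsProfile a b ρ ρ' v) (hC : ∀ x ∈ Icc a b, Comparable P μ ρs C (ρ x)) :
    1 ≤ C * (b - a) := by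
  have h1 := integral_le_integral_of_continuousOn h.lt.le h.cont
    continuousOn_const fun x hx => (hC x hx).le
  rw [h.mass] at h1
  simpa [mul_comm] using h1

theorem cont_sub (h : IsProfile a b ρ ρ' v) (c : ℝ) :
    ContinuousOn (fun x => ρ x - c) (Icc a b) :=
  h.cont.sub continuousOn_const

theorem continuousOn_gradient_coeff (h : IsProfile a b ρ ρ' v) (hH : AssumptionH P μ) :
    ContinuousOn (fun x => μ (ρ x) ^ 2 / ρ x ^ 3) (Icc a b) :=
  ((h.comp hH.continuousOn_μ).pow 2).div (h.cont.pow 3) fun x hx => (pow_pos (h.pos x hx) 3).ne'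

theorem integral_gradient_eq (h : IsProfile a b ρ ρ' v) :
    ∫ x in a..b, 1 / ρ x * (μ (ρ x) / ρ x * ρ' x) ^ 2
      = ∫ x in a..b, μ (ρ x) ^ 2 / ρ x ^ 3 * ρ' x ^ 2 := by
  refine intervalIntegral.integral_congr fun x hx => ?_
  rw [uIcc_of_le h.lt.le] at hx
  have := (h.pos x hx).ne'
  field_simp

theorem sq_k_le {l : ℝ} (hl : Comparable P μ ρs C l) : k μ ρs l ^ 2 ≤ C ^ 2 * (l - ρs) ^ 2 := by
  rw [← sq_abs, ← sq_abs (l - ρs), ← mul_pow]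
  exact pow_le_pow_left₀ (abs_nonneg _) hl.k_le 2

theorem sq_sub_le {l : ℝ} (hl : Comparable P μ ρs C l) : (l - ρs) ^ 2 ≤ C ^ 2 * k μ ρs l ^ 2 := by
  rw [← sq_abs, ← sq_abs (k μ ρs l), ← mul_pow]
  exact pow_le_pow_left₀ (abs_nonneg _) hl.le_k 2

/-- The gradient term dictates the exponent: its coefficient μ²/ρ³ is at most C²·C³. The remaining
terms need lower powers of C ≥ 1, and the factor 1 + r collects W and rE. -/
theorem lyapunov_le (h : IsProfile a b ρ ρ' v) (hH : AssumptionH P μ) (hρs : 0 < ρs)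
    (hr : 0 < r) (hC1 : 1 ≤ C) (hC : ∀ x ∈ Icc a b, Comparable P μ ρs C (ρ x)) :
    lyapunov P μ ρs r a b ρ ρ' v ≤ (1 + r) * C ^ 5 * (2 * v a ^ 2 + 2 * v b ^ 2
      + 2 * (∫ x in a..b, v x ^ 2) + (∫ x in a..b, ρ' x ^ 2) + (ρ a - ρs) ^ 2 + (ρ b - ρs) ^ 2
      + ∫ x in a..b, (ρ x - ρs) ^ 2) := by
  have hC0 : 0 < C := by linarith
  have hkin : ∫ x in a..b, ρ x * v x ^ 2 ≤ C * ∫ x in a..b, v x ^ 2 :=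
    h.integral_mul_sq_le h.cont h.cont_v fun x hx => (hC x hx).le
  have hU : U P ρs a b ρ ≤ C * ∫ x in a..b, (ρ x - ρs) ^ 2 := by
    rw [← intervalIntegral.integral_const_mul]
    exact integral_le_integral_of_continuousOn h.lt.le (h.comp (hH.continuousOn_Q hρs))
      (continuousOn_const.mul ((h.cont_sub ρs).pow 2)) fun x hx => (hC x hx).Q_le
  have hgrad : ∫ x in a..b, 1 / ρ x * (μ (ρ x) / ρ x * ρ' x) ^ 2
      ≤ C ^ 5 * ∫ x in a..b, ρ' x ^ 2 := by
    rw [h.integral_gradient_eq]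
    refine h.integral_mul_sq_le (h.continuousOn_gradient_coeff hH) h.cont' fun x hx => ?_
    have h0 := h.pos x hx
    have hμ := hH.μ_pos _ h0
    have h1 := (hC x hx).one_le
    have h2 := (hC x hx).μ_le
    rw [div_le_iff₀ (by positivity)]
    calc μ (ρ x) ^ 2 = μ (ρ x) ^ 2 * 1 := by ring
      _ ≤ C ^ 2 * (C * ρ x) ^ 3 := by gcongr; exact one_le_pow₀ h1
      _ = C ^ 5 * ρ x ^ 3 := by ring
  have hw := h.integral_w_le hH
  have hka := sq_k_le (hC a h.left_mem)
  have hkb := sq_k_le (hC b h.right_mem)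
  have hvb : (v b - k μ ρs (ρ b)) ^ 2 ≤ 2 * v b ^ 2 + 2 * k μ ρs (ρ b) ^ 2 := by
    nlinarith [sq_nonneg (v b + k μ ρs (ρ b))]
  have hva : (v a + k μ ρs (ρ a)) ^ 2 ≤ 2 * v a ^ 2 + 2 * k μ ρs (ρ a) ^ 2 := by
    nlinarith [sq_nonneg (v a - k μ ρs (ρ a))]
  have hN : 0 ≤ ∫ x in a..b, v x ^ 2 :=
    intervalIntegral.integral_nonneg h.lt.le fun _ _ => sq_nonneg _
  have hA : 0 ≤ ∫ x in a..b, ρ' x ^ 2 :=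
    intervalIntegral.integral_nonneg h.lt.le fun _ _ => sq_nonneg _
  have hZ : 0 ≤ ∫ x in a..b, (ρ x - ρs) ^ 2 :=
    intervalIntegral.integral_nonneg h.lt.le fun _ _ => sq_nonneg _
  have hC15 : C ≤ C ^ 5 := by simpa using pow_le_pow_right₀ hC1 (show 1 ≤ 5 by norm_num)
  have hC25 : C ^ 2 ≤ C ^ 5 := pow_le_pow_right₀ hC1 (by norm_num)
  have hC05 : 1 ≤ C ^ 5 := one_le_pow₀ hC1
  unfold lyapunov
  have e1 := mul_le_mul_of_nonneg_right hC15 hN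
  have e2 := mul_le_mul_of_nonneg_right hC15 hZ
  have e3 := mul_le_mul_of_nonneg_right hC25 (sq_nonneg (ρ a - ρs))
  have e4 := mul_le_mul_of_nonneg_right hC25 (sq_nonneg (ρ b - ρs))
  have e5 := mul_le_mul_of_nonneg_right hC05 (sq_nonneg (v a))
  have e6 := mul_le_mul_of_nonneg_right hC05 (sq_nonneg (v b))
  have e7 : 0 ≤ C ^ 5 * ∫ x in a..b, v x ^ 2 := by positivity
  have e8 : 0 ≤ C ^ 5 * ∫ x in a..b, ρ' x ^ 2 := by positivity
  have e9 : 0 ≤ C ^ 5 * ∫ x in a..b, (ρ x - ρs) ^ 2 := by positivity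
  have e10 : 0 ≤ C ^ 5 * (ρ a - ρs) ^ 2 := by positivity
  have e11 : 0 ≤ C ^ 5 * (ρ b - ρs) ^ 2 := by positivity
  have hE : v a ^ 2 / 2 + v b ^ 2 / 2 + (1 / 2) * (∫ x in a..b, ρ x * v x ^ 2) + U P ρs a b ρ
      ≤ C ^ 5 * (2 * v a ^ 2 + 2 * v b ^ 2
      + 2 * (∫ x in a..b, v x ^ 2) + (∫ x in a..b, ρ' x ^ 2) + (ρ a - ρs) ^ 2 + (ρ b - ρs) ^ 2
      + ∫ x in a..b, (ρ x - ρs) ^ 2) := by linarith [sq_nonneg (v a), sq_nonneg (v b)]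
  have hrE := mul_le_mul_of_nonneg_left hE hr.le
  linarith [sq_nonneg (v a), sq_nonneg (v b)]

/-- E controls the velocity. Subtracting it from W recovers the gradient of ρ and the value ρ(b);
one end value is enough, as the gradient controls the rest of the profile. -/
theorem le_lyapunov (h : IsProfile a b ρ ρ' v) (hH : AssumptionH P μ) (hρs : 0 < ρs)
    (hr : 0 < r) (hC1 : 1 ≤ C) (hC : ∀ x ∈ Icc a b, Comparable P μ ρs C (ρ x)) :
    v a ^ 2 + v b ^ 2 + (∫ x in a..b, v x ^ 2) + (∫ x in a..b, ρ' x ^ 2) + (ρ b - ρs) ^ 2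
      ≤ (8 + 14 / r) * C ^ 5 * lyapunov P μ ρs r a b ρ ρ' v := by
  have hC0 : 0 < C := by linarith
  obtain ⟨t1, t2, -, t4, t5, t6⟩ := h.terms_le_lyapunov hH hρs hr
  have hL := h.lyapunov_nonneg hH hρs hr
  have hkin : ∫ x in a..b, v x ^ 2 ≤ C * ∫ x in a..b, ρ x * v x ^ 2 :=
    h.integral_sq_le_mul h.cont h.cont_v fun x hx => (hC x hx).one_le
  have hgrad : ∫ x in a..b, ρ' x ^ 2
      ≤ C ^ 5 * ∫ x in a..b, 1 / ρ x * (μ (ρ x) / ρ x * ρ' x) ^ 2 := by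
    rw [h.integral_gradient_eq]
    refine h.integral_sq_le_mul (h.continuousOn_gradient_coeff hH) h.cont' fun x hx => ?_
    have h0 := h.pos x hx
    have h1 := (hC x hx).le
    have h2 := (hC x hx).one_le_μ
    rw [← mul_div_assoc, le_div_iff₀ (by positivity)]
    calc 1 * ρ x ^ 3 ≤ 1 * C ^ 3 := by gcongr
      _ ≤ (C * μ (ρ x)) ^ 2 * C ^ 3 := by gcongr; exact one_le_pow₀ h2
      _ = C ^ 5 * μ (ρ x) ^ 2 := by ring
  have hw := h.integral_gradient_le hH
  have hkb := sq_sub_le (hC b h.right_mem)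
  have hvb : k μ ρs (ρ b) ^ 2 ≤ 2 * (v b - k μ ρs (ρ b)) ^ 2 + 2 * v b ^ 2 := by
    nlinarith [sq_nonneg (v b - k μ ρs (ρ b) + v b)]
  set L := lyapunov P μ ρs r a b ρ ρ' v with hLdef
  have hrL : 0 ≤ 2 / r * L := by positivity
  have hC15 : C ≤ C ^ 5 := by simpa using pow_le_pow_right₀ hC1 (show 1 ≤ 5 by norm_num)
  have hC25 : C ^ 2 ≤ C ^ 5 := pow_le_pow_right₀ hC1 (by norm_num)
  have hC05 : 1 ≤ C ^ 5 := one_le_pow₀ hC1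
  have e1 : v a ^ 2 ≤ C ^ 5 * (2 / r * L) := t4.trans (le_mul_of_one_le_left hrL hC05)
  have e2 : v b ^ 2 ≤ C ^ 5 * (2 / r * L) := t5.trans (le_mul_of_one_le_left hrL hC05)
  have e3 : ∫ x in a..b, v x ^ 2 ≤ C ^ 5 * (2 / r * L) :=
    hkin.trans (mul_le_mul hC15 t6 h.integral_kinetic_nonneg (by positivity))
  have e4 : ∫ x in a..b, ρ' x ^ 2 ≤ C ^ 5 * (2 * (2 * L) + 2 * (2 / r * L)) :=
    hgrad.trans (mul_le_mul_of_nonneg_left (by linarith) (by positivity))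
  have e5 : (ρ b - ρs) ^ 2 ≤ C ^ 5 * (2 * (2 * L) + 2 * (2 / r * L)) :=
    hkb.trans (mul_le_mul hC25 (by linarith) (sq_nonneg _) (by positivity))
  calc _ ≤ C ^ 5 * (2 / r * L) + C ^ 5 * (2 / r * L) + C ^ 5 * (2 / r * L)
        + C ^ 5 * (2 * (2 * L) + 2 * (2 / r * L)) + C ^ 5 * (2 * (2 * L) + 2 * (2 / r * L)) := by
          linarith
    -- Three velocity terms contribute 2/r each, the gradient and ρ(b) contribute 4 + 4/r each.
    _ = (8 + 14 / r) * C ^ 5 * L := by ring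

theorem sq_sub_le_integral (h : IsProfile a b ρ ρ' v)
    (hC : ∀ x ∈ Icc a b, Comparable P μ ρs C (ρ x)) {x y : ℝ} (hx : x ∈ Icc a b)
    (hy : y ∈ Icc a b) :
    (ρ x - ρs) ^ 2 ≤ 2 * (ρ y - ρs) ^ 2 + 2 * (C * ∫ x in a..b, ρ' x ^ 2) := by
  have h1 := sq_sub_le_integral_sq h.cont h.cont' h.hasDerivAt hx hy
  have h2 : (b - a) * ∫ x in a..b, ρ' x ^ 2 ≤ C * ∫ x in a..b, ρ' x ^ 2 :=
    mul_le_mul_of_nonneg_right (h.length_le hC)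
      (intervalIntegral.integral_nonneg h.lt.le fun _ _ => sq_nonneg _)
  nlinarith [sq_nonneg (ρ x - ρ y - (ρ y - ρs))]

theorem integral_le_of_forall_le (h : IsProfile a b ρ ρ' v)
    (hC : ∀ x ∈ Icc a b, Comparable P μ ρs C (ρ x)) {f : ℝ → ℝ} (hf : ContinuousOn f (Icc a b))
    {B : ℝ} (hB : 0 ≤ B) (hfB : ∀ x ∈ Icc a b, f x ≤ B) : ∫ x in a..b, f x ≤ C * B := by
  have h1 := integral_le_integral_of_continuousOn h.lt.le hf continuousOn_const hfB
  rw [intervalIntegral.integral_const, smul_eq_mul] at h1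
  exact h1.trans (mul_le_mul_of_nonneg_right (h.length_le hC) hB)

/-- The boundary terms k(ρ)(P(ρ) - P(ρ*)) control ρ - ρ* at both ends. The feedback square then
yields v(a), which the viscous dissipation propagates to all of v, while the pressure gradient term
propagates ρ(a) - ρ* to the whole density. -/
theorem exists_lyapunov_le_dissipation (hH : AssumptionH P μ) (hρs : 0 < ρs) (hr : 0 < r)
    (hR : 0 < R) (hC1 : 1 ≤ C) :
    ∃ K, 0 < K ∧ ∀ (a b : ℝ) (ρ ρ' v v' : ℝ → ℝ), IsProfile a b ρ ρ' v →
      (∀ x ∈ Icc a b, Comparable P μ ρs C (ρ x)) → ContinuousOn v' (Icc a b) →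
      (∀ x ∈ Ioo a b, HasDerivAt v (v' x) x) →
      lyapunov P μ ρs r a b ρ ρ' v ≤ K * dissipation P μ ρs R r a b ρ ρ' v v' := by
  have hC0 : 0 < C := by linarith
  -- In units of the dissipation, `K1` will bound v(a)², `K2` the square of v at every point, and
  -- `K3` the square of ρ - ρ* at every point.
  obtain ⟨K1, hK1⟩ : ∃ K1, K1 = 2 / R + 2 * C ^ 3 := ⟨_, rfl⟩
  obtain ⟨K2, hK2⟩ : ∃ K2, K2 = 2 * K1 + 2 * (C * (C / r)) := ⟨_, rfl⟩
  obtain ⟨K3, hK3⟩ : ∃ K3, K3 = 2 * C + 2 * (C * C ^ 4) := ⟨_, rfl⟩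
  have hK1p : 0 < K1 := by rw [hK1]; positivity
  have hK2p : 0 < K2 := by rw [hK2]; positivity
  have hK3p : 0 < K3 := by rw [hK3]; positivity
  refine ⟨(1 + r) * C ^ 5 * (2 * K1 + 2 * K2 + 2 * (C * K2) + C ^ 4 + C + C + C * K3),
    by positivity, fun a b ρ ρ' v v' h hC hv' hd => ?_⟩
  refine (h.lyapunov_le hH hρs hr hC1 hC).trans ?_
  rw [mul_assoc ((1 + r) * C ^ 5)]
  refine mul_le_mul_of_nonneg_left ?_ (by positivity)
  have hcoef : ContinuousOn (fun x => deriv P (ρ x) * μ (ρ x) / ρ x ^ 2) (Icc a b) :=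
    ((h.comp hH.continuousOn_deriv_P).mul (h.comp hH.continuousOn_μ)).div (h.cont.pow 2)
      fun x hx => (pow_pos (h.pos x hx) 2).ne'
  have hA : ∫ x in a..b, ρ' x ^ 2
      ≤ C ^ 4 * ∫ x in a..b, deriv P (ρ x) * μ (ρ x) / ρ x ^ 2 * ρ' x ^ 2 := by
    refine h.integral_sq_le_mul hcoef h.cont' fun x hx => ?_
    have h0 := h.pos x hx
    have h1 := (hC x hx).le
    have h2 := (hC x hx).one_le_μ
    have h3 := (hC x hx).one_le_deriv_P
    rw [← mul_div_assoc, le_div_iff₀ (by positivity)]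
    calc 1 * ρ x ^ 2 ≤ (1 * 1) * C ^ 2 := by rw [mul_one]; gcongr
      _ ≤ ((C * deriv P (ρ x)) * (C * μ (ρ x))) * C ^ 2 := by gcongr
      _ = C ^ 4 * (deriv P (ρ x) * μ (ρ x)) := by ring
  have hB : ∫ x in a..b, v' x ^ 2 ≤ C * ∫ x in a..b, μ (ρ x) * v' x ^ 2 :=
    h.integral_sq_le_mul (h.comp hH.continuousOn_μ) hv' fun x hx => (hC x hx).one_le_μ
  have d1 : 0 ≤ ∫ x in a..b, deriv P (ρ x) * μ (ρ x) / ρ x ^ 2 * ρ' x ^ 2 :=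
    intervalIntegral.integral_nonneg h.lt.le fun x hx => by
      have h0 := h.pos x hx
      have h1 := hH.μ_pos _ h0
      have h2 := hH.deriv_P_pos _ h0
      positivity
  have d2 : 0 ≤ ∫ x in a..b, μ (ρ x) * v' x ^ 2 :=
    intervalIntegral.integral_nonneg h.lt.le fun x hx => by
      have h1 := hH.μ_pos _ (h.pos x hx)
      positivity
  have d3 := hH.k_mul_nonneg hρs (h.pos b h.right_mem)
  have d4 := hH.k_mul_nonneg hρs (h.pos a h.left_mem)
  have d5 : 0 ≤ R * ((r + 1) * v a + k μ ρs (ρ a)) ^ 2 := by positivity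
  have d2r := mul_nonneg hr.le d2
  obtain ⟨D, hD⟩ : ∃ D, D = dissipation P μ ρs R r a b ρ ρ' v v' := ⟨_, rfl⟩
  rw [← hD]
  rw [dissipation] at hD
  have hAD : ∫ x in a..b, ρ' x ^ 2 ≤ C ^ 4 * D :=
    hA.trans (mul_le_mul_of_nonneg_left (by linarith) (by positivity))
  have hBD : ∫ x in a..b, v' x ^ 2 ≤ C / r * D := by
    rw [div_mul_eq_mul_div, le_div_iff₀ hr]
    calc (∫ x in a..b, v' x ^ 2) * r ≤ (C * ∫ x in a..b, μ (ρ x) * v' x ^ 2) * r := by gcongr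
      _ = C * (r * ∫ x in a..b, μ (ρ x) * v' x ^ 2) := by ring
      _ ≤ C * D := mul_le_mul_of_nonneg_left (by linarith) hC0.le
  have hbD : (ρ b - ρs) ^ 2 ≤ C * D :=
    (hC b h.right_mem).sq_le_k_mul.trans (mul_le_mul_of_nonneg_left (by linarith) hC0.le)
  have haD : (ρ a - ρs) ^ 2 ≤ C * D :=
    (hC a h.left_mem).sq_le_k_mul.trans (mul_le_mul_of_nonneg_left (by linarith) hC0.le)
  have hD0 : 0 ≤ D := by linarith
  have hvaD : v a ^ 2 ≤ K1 * D := by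
    have e1 : ((r + 1) * v a + k μ ρs (ρ a)) ^ 2 ≤ 1 / R * D := by
      rw [div_mul_eq_mul_div, le_div_iff₀ hR]
      linarith
    have e2 : k μ ρs (ρ a) ^ 2 ≤ C ^ 2 * (C * D) :=
      (sq_k_le (hC a h.left_mem)).trans (mul_le_mul_of_nonneg_left haD (by positivity))
    -- The weight r + 1 of the feedback law is at least 1 and can be dropped.
    have e3 : v a ^ 2 ≤ ((r + 1) * v a) ^ 2 := by
      rw [mul_pow]
      exact le_mul_of_one_le_left (sq_nonneg _) (one_le_pow₀ (by linarith))
    have e4 : ((r + 1) * v a) ^ 2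
        ≤ 2 * ((r + 1) * v a + k μ ρs (ρ a)) ^ 2 + 2 * k μ ρs (ρ a) ^ 2 := by
      nlinarith [sq_nonneg ((r + 1) * v a + 2 * k μ ρs (ρ a))]
    calc v a ^ 2 ≤ 2 * (1 / R * D) + 2 * (C ^ 2 * (C * D)) := by linarith
      _ = K1 * D := by rw [hK1]; ring
  have hv : ∀ x ∈ Icc a b, v x ^ 2 ≤ K2 * D := fun x hx => by
    have h1 := sq_sub_le_integral_sq h.cont_v hv' hd hx h.left_mem
    have h2 : (b - a) * ∫ x in a..b, v' x ^ 2 ≤ C * (C / r * D) :=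
      mul_le_mul (h.length_le hC) hBD
        (intervalIntegral.integral_nonneg h.lt.le fun _ _ => sq_nonneg _) hC0.le
    calc v x ^ 2 ≤ 2 * v a ^ 2 + 2 * (v x - v a) ^ 2 := by
          nlinarith [sq_nonneg (v x - v a - v a)]
      _ ≤ 2 * (K1 * D) + 2 * (C * (C / r * D)) := by linarith
      _ = K2 * D := by rw [hK2]; ring
  have hρ : ∀ x ∈ Icc a b, (ρ x - ρs) ^ 2 ≤ K3 * D := fun x hx => by
    have h1 := h.sq_sub_le_integral hC hx h.left_mem
    calc (ρ x - ρs) ^ 2 ≤ 2 * (C * D) + 2 * (C * (C ^ 4 * D)) := by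
          refine h1.trans ?_
          gcongr
      _ = K3 * D := by rw [hK3]; ring
  have hvI : ∫ x in a..b, v x ^ 2 ≤ C * (K2 * D) := h.integral_le_of_forall_le hC (h.cont_v.pow 2) (by positivity) hv
  have hρI : ∫ x in a..b, (ρ x - ρs) ^ 2 ≤ C * (K3 * D) := h.integral_le_of_forall_le hC ((h.cont_sub ρs).pow 2) (by positivity) hρ
  calc _ ≤ 2 * (K1 * D) + 2 * (K2 * D) + 2 * (C * (K2 * D)) + C ^ 4 * D + C * D + C * D
        + C * (K3 * D) := by linarith [hv b h.right_mem]
    _ = (2 * K1 + 2 * K2 + 2 * (C * K2) + C ^ 4 + C + C + C * K3) * D := by ring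

end IsProfile


/-! ### Uniform limits on compact sets -/

theorem tendstoUniformlyOn_of_isCompact {X Y : Type*} [TopologicalSpace X] [TopologicalSpace Y]
    {f : X → Y → ℝ} {s : Set X} {K : Set Y} {q : X} (hK : IsCompact K)
    (hf : ContinuousOn f.uncurry (s ×ˢ K)) (hq : q ∈ s) :
    TendstoUniformlyOn f (f q) (𝓝[s] q) K := by
  intro u hu
  obtain ⟨w, hw, hwu⟩ := hK.mem_uniformity_of_prod hf hq (symm_le_uniformity hu)
  filter_upwards [hw] with p hp x hx using hwu p hp x hx

/-- The derivative in one variable passes to the boundary in the other variable. -/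
theorem hasDerivAt_of_continuousOn_prod {X : Type*} [TopologicalSpace X] {f f' : X → ℝ → ℝ}
    {T : Set X} {q : X} (hq : q ∈ T) {l : Filter X} [NeBot l] (hl : l ≤ 𝓝[T] q) {c d : ℝ}
    (hf : ContinuousOn f.uncurry (T ×ˢ Icc c d)) (hf' : ContinuousOn f'.uncurry (T ×ˢ Icc c d))
    (hd : ∀ᶠ y in l, ∀ x ∈ Ioo c d, HasDerivAt (f y) (f' y x) x) {x : ℝ} (hx : x ∈ Ioo c d) :
    HasDerivAt (f q) (f' q x) x := by
  refine hasDerivAt_of_tendstoUniformlyOn isOpen_Ioo (l := l) (f := f) (f' := f') ?_ hd ?_ hx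
  · exact (fun u hu => hl ((tendstoUniformlyOn_of_isCompact isCompact_Icc hf' hq).mono
      Ioo_subset_Icc_self u hu))
  · intro y hy
    have h1 : ContinuousOn (fun z => f z y) T :=
      hf.comp (continuousOn_id.prodMk continuousOn_const)
        fun z hz => ⟨hz, Ioo_subset_Icc_self hy⟩
    exact (h1 q hq).mono_left hl

theorem continuousOn_integral {X : Type*} [TopologicalSpace X] [FirstCountableTopology X]
    {g : X → ℝ → ℝ} {T : Set X} {c d : ℝ}
    (hcd : c ≤ d) (hg : ContinuousOn g.uncurry (T ×ˢ Icc c d)) :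
    ContinuousOn (fun t => ∫ θ in c..d, g t θ) T := by
  have hsl : ∀ t ∈ T, ContinuousOn (g t) (Icc c d) := fun t ht =>
    hg.comp (continuousOn_const.prodMk continuousOn_id) fun z hz => ⟨ht, hz⟩
  intro q hq
  have hunif := Metric.tendstoUniformlyOn_iff.1
    (tendstoUniformlyOn_of_isCompact isCompact_Icc hg hq) 1 one_pos
  -- Uniform convergence on the compact interval supplies the dominating function |g q| + 1 near q.
  refine intervalIntegral.continuousWithinAt_of_dominated_interval
    (bound := fun θ => |g q θ| + 1) ?_ ?_ ?_ ?_
  · filter_upwards [self_mem_nhdsWithin] with t ht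
    exact (hsl t ht |>.intervalIntegrable_of_Icc hcd : IntervalIntegrable _ volume _ _).aestronglyMeasurable_restrict_uIoc
  · filter_upwards [hunif] with t ht
    refine Eventually.of_forall fun θ hθ => ?_
    rw [uIoc_of_le hcd] at hθ
    have h1 := ht θ (Ioc_subset_Icc_self hθ)
    rw [Real.dist_eq] at h1
    rw [Real.norm_eq_abs]
    have h2 := abs_sub_abs_le_abs_sub (g t θ) (g q θ)
    rw [abs_sub_comm] at h2
    linarith
  · exact ((hsl q hq).abs.add continuousOn_const).intervalIntegrable_of_Icc hcd
  · refine Eventually.of_forall fun θ hθ => ?_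
    rw [uIoc_of_le hcd] at hθ
    have h1 : ContinuousOn (fun z => g z θ) T :=
      hg.comp (continuousOn_id.prodMk continuousOn_const)
        fun z hz => ⟨hz, Ioc_subset_Icc_self hθ⟩
    exact h1 q hq

theorem hasDerivAt_integral_of_continuousOn {g p : ℝ → ℝ → ℝ} {t c d : ℝ} {T : Set ℝ}
    (hT : T ∈ 𝓝 t) (hcd : c ≤ d) (hg : ContinuousOn g.uncurry (T ×ˢ Icc c d))
    (hp : ContinuousOn p.uncurry (T ×ˢ Icc c d))
    (hd : ∀ s ∈ T, ∀ θ ∈ Icc c d, HasDerivAt (fun s => g s θ) (p s θ) s) :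
    HasDerivAt (fun s => ∫ θ in c..d, g s θ) (∫ θ in c..d, p t θ) t := by
  have ht := mem_of_mem_nhds hT
  have hsl : ∀ (f : ℝ → ℝ → ℝ), ContinuousOn f.uncurry (T ×ˢ Icc c d) → ∀ s ∈ T,
      ContinuousOn (f s) (Icc c d) := fun f hf s hs =>
    hf.comp (continuousOn_const.prodMk continuousOn_id) fun z hz => ⟨hs, hz⟩
  have hunif := Metric.tendstoUniformlyOn_iff.1
    (tendstoUniformlyOn_of_isCompact isCompact_Icc hp ht) 1 one_pos
  rw [nhdsWithin_eq_nhds.2 hT] at hunif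
  refine (intervalIntegral.hasDerivAt_integral_of_dominated_loc_of_deriv_le
    (s := T ∩ {s | ∀ x ∈ Icc c d, dist (p t x) (p s x) < 1}) (bound := fun θ => |p t θ| + 1)
    (inter_mem hT hunif) ?_ ?_ ?_ ?_ ?_ ?_).2
  · filter_upwards [hT] with s hs
    exact (hsl g hg s hs |>.intervalIntegrable_of_Icc hcd : IntervalIntegrable _ volume _ _).aestronglyMeasurable_restrict_uIoc
  · exact (hsl g hg t ht).intervalIntegrable_of_Icc hcd
  · exact (hsl p hp t ht |>.intervalIntegrable_of_Icc hcd : IntervalIntegrable _ volume _ _).aestronglyMeasurable_restrict_uIoc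
  · refine Eventually.of_forall fun θ hθ s hs => ?_
    rw [uIoc_of_le hcd] at hθ
    have h1 := hs.2 θ (Ioc_subset_Icc_self hθ)
    rw [Real.dist_eq] at h1
    rw [Real.norm_eq_abs]
    have h2 := abs_sub_abs_le_abs_sub (p s θ) (p t θ)
    rw [abs_sub_comm] at h2
    linarith
  · exact ((hsl p hp t ht).abs.add continuousOn_const).intervalIntegrable_of_Icc hcd
  · refine Eventually.of_forall fun θ hθ s hs => ?_
    rw [uIoc_of_le hcd] at hθ
    exact hd s hs.1 θ (Ioc_subset_Icc_self hθ)

theorem abs_integral_sub_integral_le {f : ℝ → ℝ} (hf : ContinuousOn f (Icc 0 1)) {B : ℝ}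
    (hB : ∀ θ ∈ Icc (0 : ℝ) 1, |f θ| ≤ B) {ε : ℝ} (hε : 0 < ε) (hε' : ε < 1 / 2) :
    |(∫ θ in (0 : ℝ)..1, f θ) - ∫ θ in ε..(1 - ε), f θ| ≤ 2 * ε * B := by
  have hint : ∀ x ∈ Icc (0 : ℝ) 1, ∀ y ∈ Icc (0 : ℝ) 1, IntervalIntegrable f volume x y :=
    fun x hx y hy => (hf.mono (ordConnected_Icc.uIcc_subset hx hy)).intervalIntegrable
  have m0 : (0 : ℝ) ∈ Icc (0 : ℝ) 1 := by simp
  have m1 : (1 : ℝ) ∈ Icc (0 : ℝ) 1 := by simp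
  have mε : ε ∈ Icc (0 : ℝ) 1 := ⟨hε.le, by linarith⟩
  have mε' : 1 - ε ∈ Icc (0 : ℝ) 1 := ⟨by linarith, by linarith⟩
  have hb : ∀ x ∈ Icc (0 : ℝ) 1, ∀ y ∈ Icc (0 : ℝ) 1, |∫ θ in x..y, f θ| ≤ B * |y - x| :=
    fun x hx y hy => intervalIntegral.norm_integral_le_of_norm_le_const (E := ℝ) fun θ hθ =>
      hB θ (ordConnected_Icc.uIcc_subset hx hy (uIoc_subset_uIcc hθ))
  have h1 := hb 0 m0 ε mε
  have h2 := hb (1 - ε) mε' 1 m1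
  rw [sub_zero, abs_of_pos hε] at h1
  rw [sub_sub_cancel, abs_of_pos hε] at h2
  have h3 : (∫ θ in (0 : ℝ)..1, f θ) - ∫ θ in ε..(1 - ε), f θ
      = (∫ θ in (0 : ℝ)..ε, f θ) + ∫ θ in (1 - ε)..1, f θ := by
    rw [← intervalIntegral.integral_add_adjacent_intervals (hint 0 m0 ε mε) (hint ε mε 1 m1),
      ← intervalIntegral.integral_add_adjacent_intervals (hint ε mε _ mε') (hint _ mε' 1 m1)]
    ring
  rw [h3]
  refine (abs_add_le _ _).trans ?_
  linarith

/-- Differentiation of an integral whose integrand is differentiable, up to a flux that vanishes at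
the end points, with a continuous derivative. -/
theorem hasDerivAt_integral_of_flux {g p H q : ℝ → ℝ → ℝ} {t : ℝ} {T : Set ℝ} (hT : T ∈ 𝓝 t)
    (hg : ContinuousOn g.uncurry (T ×ˢ Icc 0 1)) (hH : ContinuousOn H.uncurry (T ×ˢ Icc 0 1))
    (hq : ContinuousOn q.uncurry (T ×ˢ Icc 0 1)) (hp : ContinuousOn p.uncurry (T ×ˢ Ioo 0 1))
    (hd : ∀ s ∈ T, ∀ θ ∈ Ioo (0 : ℝ) 1, HasDerivAt (fun s => g s θ) (p s θ) s)
    (hqd : ∀ s ∈ T, ∀ θ ∈ Ioo (0 : ℝ) 1, HasDerivAt (q s) (p s θ - H s θ) θ)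
    (hq0 : ∀ s ∈ T, q s 0 = 0) (hq1 : ∀ s ∈ T, q s 1 = 0) :
    HasDerivAt (fun s => ∫ θ in (0 : ℝ)..1, g s θ) (∫ θ in (0 : ℝ)..1, H t θ) t := by
  obtain ⟨K, hK, hKT, hKc⟩ := local_compact_nhds hT
  have hswap : ContinuousOn (Function.uncurry fun θ s => q s θ) (Icc 0 1 ×ˢ K) :=
    hq.comp continuous_swap.continuousOn fun z hz => ⟨hKT hz.2, hz.1⟩
  have hsl : ∀ (f : ℝ → ℝ → ℝ) (A : Set ℝ), ContinuousOn f.uncurry (T ×ˢ A) → ∀ s ∈ T,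
      ContinuousOn (f s) A := fun f A hf s hs =>
    hf.comp (continuousOn_const.prodMk continuousOn_id) fun z hz => ⟨hs, hz⟩
  have hsmall : ∀ᶠ ε : ℝ in 𝓝[>] 0, 0 < ε ∧ ε < 1 / 2 := by
    filter_upwards [Ioo_mem_nhdsGT (show (0 : ℝ) < 1 / 2 by norm_num)] with ε hε using hε
  have hIoo : ∀ {ε θ : ℝ}, 0 < ε → θ ∈ Icc ε (1 - ε) → θ ∈ Ioo (0 : ℝ) 1 := fun hε hθ =>
    ⟨hε.trans_le hθ.1, by linarith [hθ.2]⟩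
  have hId : Tendsto (fun ε : ℝ => ε) (𝓝[>] 0) (𝓝[Icc 0 1] 0) := by
    refine tendsto_nhdsWithin_iff.2 ⟨tendsto_id.mono_left nhdsWithin_le_nhds, ?_⟩
    filter_upwards [hsmall] with ε hε using ⟨hε.1.le, by linarith [hε.2]⟩
  have hRefl : Tendsto (fun ε : ℝ => 1 - ε) (𝓝[>] 0) (𝓝[Icc 0 1] 1) := by
    refine tendsto_nhdsWithin_iff.2 ⟨?_, ?_⟩
    · have : Tendsto (fun ε : ℝ => 1 - ε) (𝓝 0) (𝓝 (1 - 0)) :=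
        (continuous_const.sub continuous_id).tendsto 0
      rw [sub_zero] at this
      exact this.mono_left nhdsWithin_le_nhds
    · filter_upwards [hsmall] with ε hε using ⟨by linarith [hε.2], by linarith [hε.1]⟩
  have htK := mem_of_mem_nhds hK
  -- On [ε, 1 - ε] the derivative p is continuous and the integral may be differentiated under the
  -- sign. As p = H + ∂q/∂θ there, the result is the truncated integral of H plus the flux q(1 - ε)
  -- - q(ε). Since q vanishes at the end points, these derivatives converge uniformly on the compact
  -- set K of times as ε → 0.
  refine hasDerivAt_of_tendstoUniformlyOn (s := interior K) isOpen_interior (l := 𝓝[>] (0 : ℝ))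
    (f := fun ε s => ∫ θ in ε..(1 - ε), g s θ) (g' := fun s => ∫ θ in (0 : ℝ)..1, H s θ)
    (f' := fun ε s => (∫ θ in ε..(1 - ε), H s θ) + (q s (1 - ε) - q s ε)) ?_ ?_ ?_
    (mem_interior_iff_mem_nhds.2 hK)
  · obtain ⟨B, hB⟩ := (hKc.prod (isCompact_Icc (a := (0 : ℝ)) (b := 1))).exists_bound_of_continuousOn
      (hH.mono (prod_mono hKT Subset.rfl))
    have hB0 : 0 ≤ B := (norm_nonneg _).trans (hB (t, 0) ⟨htK, by simp⟩)
    refine Metric.tendstoUniformlyOn_iff.2 fun η hη => ?_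
    have u0 := hId.eventually (Metric.tendstoUniformlyOn_iff.1
      (tendstoUniformlyOn_of_isCompact hKc hswap (q := 0) (by simp)) (η / 4) (by linarith))
    have u1 := hRefl.eventually (Metric.tendstoUniformlyOn_iff.1
      (tendstoUniformlyOn_of_isCompact hKc hswap (q := 1) (by simp)) (η / 4) (by linarith))
    -- This makes the truncation error 2εB at most η/2; B + 1 keeps the denominator positive when B
    -- = 0.
    have u2 : ∀ᶠ ε : ℝ in 𝓝[>] 0, ε < η / (4 * (B + 1)) :=
      nhdsWithin_le_nhds (Iio_mem_nhds (by positivity))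
    filter_upwards [u0, u1, u2, hsmall] with ε h0 h1 h2 hε s hs
    have hsK := interior_subset hs
    have e0 := h0 s hsK
    have e1 := h1 s hsK
    rw [Real.dist_eq, hq0 s (hKT hsK), zero_sub, abs_neg] at e0
    rw [Real.dist_eq, hq1 s (hKT hsK), zero_sub, abs_neg] at e1
    have e2 := abs_integral_sub_integral_le (hsl H _ hH s (hKT hsK))
      (fun θ hθ => hB (s, θ) ⟨hsK, hθ⟩) hε.1 hε.2
    have e3 : 2 * ε * B ≤ η / 2 := by
      rw [lt_div_iff₀ (by positivity)] at h2
      nlinarith [hε.1]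
    rw [Real.dist_eq, ← sub_sub]
    have e4 := abs_sub ((∫ θ in (0 : ℝ)..1, H s θ) - ∫ θ in ε..(1 - ε), H s θ)
      (q s (1 - ε) - q s ε)
    have e5 := abs_sub (q s (1 - ε)) (q s ε)
    linarith
  · filter_upwards [hsmall] with ε hε s hs
    have hsT : T ∈ 𝓝 s := mem_of_superset (mem_interior_iff_mem_nhds.1 hs) hKT
    have hle : ε ≤ 1 - ε := by linarith [hε.2]
    have hsub : Icc ε (1 - ε) ⊆ Ioo (0 : ℝ) 1 := fun θ hθ => hIoo hε.1 hθ
    have hsub' : Icc ε (1 - ε) ⊆ Icc (0 : ℝ) 1 := hsub.trans Ioo_subset_Icc_self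
    have h1 := hasDerivAt_integral_of_continuousOn hsT hle
      (hg.mono (prod_mono Subset.rfl hsub')) (hp.mono (prod_mono Subset.rfl hsub))
      fun s' hs' θ hθ => hd s' hs' θ (hsub hθ)
    refine h1.congr_deriv ?_
    have hs' := mem_of_mem_nhds hsT
    have hpi := ((hsl p _ hp s hs').mono hsub).intervalIntegrable_of_Icc (μ := volume) hle
    have hHi := ((hsl H _ hH s hs').mono hsub').intervalIntegrable_of_Icc (μ := volume) hle
    rw [← intervalIntegral.integral_eq_sub_of_hasDerivAt_of_le hle
      ((hsl q _ hq s hs').mono hsub')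
      (fun θ hθ => hqd s hs' θ (hsub (Ioo_subset_Icc_self hθ))) (hpi.sub hHi),
      intervalIntegral.integral_sub hpi hHi]
    ring
  · intro s hs
    have hs' := hKT (interior_subset hs)
    obtain ⟨B, hB⟩ := (isCompact_Icc (a := (0 : ℝ)) (b := 1)).exists_bound_of_continuousOn
      (hsl g _ hg s hs')
    rw [tendsto_iff_norm_sub_tendsto_zero]
    have hlim : Tendsto (fun ε : ℝ => 2 * ε * B) (𝓝[>] 0) (𝓝 0) := by
      have : Tendsto (fun ε : ℝ => 2 * ε * B) (𝓝 0) (𝓝 (2 * 0 * B)) :=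
        ((continuous_const.mul continuous_id).mul continuous_const).tendsto 0
      rw [mul_zero, zero_mul] at this
      exact this.mono_left nhdsWithin_le_nhds
    refine squeeze_zero' (Eventually.of_forall fun _ => norm_nonneg _) ?_ hlim
    filter_upwards [hsmall] with ε hε
    rw [norm_sub_rev]
    exact abs_integral_sub_integral_le (hsl g _ hg s hs') (fun θ hθ => hB θ hθ) hε.1 hε.2


/-! ### Moving intervals -/

/-- The interval `[a(t), b(t)]` with continuously differentiable end points. -/
structure MovingInterval (a b a' b' : ℝ → ℝ) : Prop where
  lt : ∀ t, 0 ≤ t → a t < b t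
  cont_left : ContinuousOn a (Ici 0)
  cont_right : ContinuousOn b (Ici 0)
  deriv_left : ∀ t, 0 < t → HasDerivAt a (a' t) t
  deriv_right : ∀ t, 0 < t → HasDerivAt b (b' t) t
  cont_deriv_left : ContinuousOn a' (Ioi 0)
  cont_deriv_right : ContinuousOn b' (Ioi 0)

/-- The affine parametrization of the moving interval by `[0, 1]`. -/
def strip (a b : ℝ → ℝ) (z : ℝ × ℝ) : ℝ × ℝ := (z.1, a z.1 + (b z.1 - a z.1) * z.2)

theorem Ω_subset_Ωtilde {a b : ℝ → ℝ} : Ω a b ⊆ Ωtilde a b :=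
  fun _ hz => ⟨hz.1, Ioo_subset_Icc_self hz.2⟩

theorem Ωtilde_subset_Ωbar {a b : ℝ → ℝ} : Ωtilde a b ⊆ Ωbar a b :=
  fun _ hz => ⟨hz.1.le, hz.2⟩

namespace MovingInterval

variable {a b a' b' : ℝ → ℝ}

theorem isOpen_Ω (I : MovingInterval a b a' b') : IsOpen (Ω a b) := by
  have ha : ContinuousOn (fun z : ℝ × ℝ => a z.1) (Ioi 0 ×ˢ univ) :=
    I.cont_left.comp continuousOn_fst fun z hz => Ioi_subset_Ici_self hz.1
  have hb : ContinuousOn (fun z : ℝ × ℝ => b z.1) (Ioi 0 ×ˢ univ) :=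
    I.cont_right.comp continuousOn_fst fun z hz => Ioi_subset_Ici_self hz.1
  have h := ((continuousOn_snd.sub ha).prodMk (hb.sub continuousOn_snd)).isOpen_inter_preimage
    (isOpen_Ioi.prod isOpen_univ) ((isOpen_Ioi (a := (0 : ℝ))).prod (isOpen_Ioi (a := (0 : ℝ))))
  convert h using 1
  ext z
  simp [Ω]

theorem continuousOn_strip (I : MovingInterval a b a' b') :
    ContinuousOn (strip a b) (Ici 0 ×ˢ univ) := by
  have ha : ContinuousOn (fun z : ℝ × ℝ => a z.1) (Ici 0 ×ˢ univ) :=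
    I.cont_left.comp continuousOn_fst fun z hz => hz.1
  have hb : ContinuousOn (fun z : ℝ × ℝ => b z.1) (Ici 0 ×ˢ univ) :=
    I.cont_right.comp continuousOn_fst fun z hz => hz.1
  exact continuousOn_fst.prodMk (ha.add ((hb.sub ha).mul continuousOn_snd))

theorem strip_mem_Icc (I : MovingInterval a b a' b') {t θ : ℝ} (ht : 0 ≤ t)
    (hθ : θ ∈ Icc (0 : ℝ) 1) : a t + (b t - a t) * θ ∈ Icc (a t) (b t) := by
  have h := I.lt t ht
  constructor <;> nlinarith [hθ.1, hθ.2]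

theorem strip_mem_Ioo (I : MovingInterval a b a' b') {t θ : ℝ} (ht : 0 ≤ t)
    (hθ : θ ∈ Ioo (0 : ℝ) 1) : a t + (b t - a t) * θ ∈ Ioo (a t) (b t) := by
  have h := I.lt t ht
  constructor <;> nlinarith [hθ.1, hθ.2]

theorem mapsTo_Ωbar (I : MovingInterval a b a' b') :
    MapsTo (strip a b) (Ici 0 ×ˢ Icc 0 1) (Ωbar a b) :=
  fun _ hz => ⟨hz.1, I.strip_mem_Icc hz.1 hz.2⟩

theorem mapsTo_Ωtilde (I : MovingInterval a b a' b') :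
    MapsTo (strip a b) (Ioi 0 ×ˢ Icc 0 1) (Ωtilde a b) :=
  fun _ hz => ⟨hz.1, I.strip_mem_Icc (le_of_lt hz.1) hz.2⟩

theorem mapsTo_Ω (I : MovingInterval a b a' b') :
    MapsTo (strip a b) (Ioi 0 ×ˢ Ioo 0 1) (Ω a b) :=
  fun _ hz => ⟨hz.1, I.strip_mem_Ioo (le_of_lt hz.1) hz.2⟩

theorem comp_strip_Ωbar (I : MovingInterval a b a' b') {F : Type*} [TopologicalSpace F]
    {f : ℝ × ℝ → F} (hf : ContinuousOn f (Ωbar a b)) :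
    ContinuousOn (fun z => f (strip a b z)) (Ici 0 ×ˢ Icc 0 1) :=
  hf.comp (I.continuousOn_strip.mono (prod_mono Subset.rfl (subset_univ _))) I.mapsTo_Ωbar

theorem comp_strip_Ωtilde (I : MovingInterval a b a' b') {F : Type*} [TopologicalSpace F]
    {f : ℝ × ℝ → F} (hf : ContinuousOn f (Ωtilde a b)) :
    ContinuousOn (fun z => f (strip a b z)) (Ioi 0 ×ˢ Icc 0 1) :=
  hf.comp (I.continuousOn_strip.mono (prod_mono Ioi_subset_Ici_self (subset_univ _)))
    I.mapsTo_Ωtilde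

theorem comp_strip_Ω (I : MovingInterval a b a' b') {F : Type*} [TopologicalSpace F]
    {f : ℝ × ℝ → F} (hf : ContinuousOn f (Ω a b)) :
    ContinuousOn (fun z => f (strip a b z)) (Ioi 0 ×ˢ Ioo 0 1) :=
  hf.comp (I.continuousOn_strip.mono (prod_mono Ioi_subset_Ici_self (subset_univ _)))
    I.mapsTo_Ω

theorem mul_integral_strip (f : ℝ × ℝ → ℝ) (t : ℝ) :
    ∫ θ in (0 : ℝ)..1, (b t - a t) * f (strip a b (t, θ)) = ∫ x in a t..b t, f (t, x) := by
  have := intervalIntegral.smul_integral_comp_add_mul (a := 0) (b := 1) (fun x => f (t, x))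
    (b t - a t) (a t)
  rw [intervalIntegral.integral_const_mul]
  simpa [strip] using this

theorem continuousOn_slice_Ωbar {f : ℝ × ℝ → ℝ} (hf : ContinuousOn f (Ωbar a b)) {t : ℝ}
    (ht : 0 ≤ t) : ContinuousOn (fun x => f (t, x)) (Icc (a t) (b t)) :=
  hf.comp (continuousOn_const.prodMk continuousOn_id) fun _ hx => ⟨ht, hx⟩

theorem continuousOn_slice_Ωtilde {f : ℝ × ℝ → ℝ} (hf : ContinuousOn f (Ωtilde a b)) {t : ℝ}
    (ht : 0 < t) : ContinuousOn (fun x => f (t, x)) (Icc (a t) (b t)) :=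
  hf.comp (continuousOn_const.prodMk continuousOn_id) fun _ hx => ⟨ht, hx⟩

theorem continuousOn_left (I : MovingInterval a b a' b') {f : ℝ × ℝ → ℝ}
    (hf : ContinuousOn f (Ωbar a b)) : ContinuousOn (fun t => f (t, a t)) (Ici 0) :=
  hf.comp (continuousOn_id.prodMk I.cont_left) fun t ht =>
    ⟨ht, left_mem_Icc.2 (I.lt t ht).le⟩

theorem continuousOn_right (I : MovingInterval a b a' b') {f : ℝ × ℝ → ℝ}
    (hf : ContinuousOn f (Ωbar a b)) : ContinuousOn (fun t => f (t, b t)) (Ici 0) :=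
  hf.comp (continuousOn_id.prodMk I.cont_right) fun t ht =>
    ⟨ht, right_mem_Icc.2 (I.lt t ht).le⟩

theorem continuousOn_integral_moving (I : MovingInterval a b a' b') {f : ℝ × ℝ → ℝ}
    (hf : ContinuousOn f (Ωbar a b)) :
    ContinuousOn (fun t => ∫ x in a t..b t, f (t, x)) (Ici 0) := by
  simp_rw [← mul_integral_strip f]
  refine continuousOn_integral zero_le_one ?_
  refine ContinuousOn.mul ?_ (I.comp_strip_Ωbar hf)
  exact (I.cont_right.sub I.cont_left).comp continuousOn_fst fun z hz => hz.1

theorem hasDerivAt_strip (I : MovingInterval a b a' b') {f : ℝ × ℝ → ℝ} {t θ : ℝ} (ht : 0 < t)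
    (hf : DifferentiableAt ℝ f (strip a b (t, θ))) :
    HasDerivAt (fun s => f (strip a b (s, θ)))
      (fderiv ℝ f (strip a b (t, θ)) (1, a' t + (b' t - a' t) * θ)) t := by
  have h1 : HasDerivAt (fun s => strip a b (s, θ)) (1, a' t + (b' t - a' t) * θ) t :=
    (hasDerivAt_id t).prodMk ((I.deriv_left t ht).add
      (((I.deriv_right t ht).sub (I.deriv_left t ht)).mul_const θ))
  exact hf.hasFDerivAt.comp_hasDerivAt t h1

theorem hasDerivAt_slice {f : ℝ × ℝ → ℝ} {t x : ℝ} (hf : DifferentiableAt ℝ f (t, x)) :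
    HasDerivAt (fun y => f (t, y)) (fderiv ℝ f (t, x) (0, 1)) x :=
  hf.hasFDerivAt.comp_hasDerivAt x ((hasDerivAt_const x t).prodMk (hasDerivAt_id x))

/-- The transport theorem of Reynolds. Only the material derivative of `f` has to be continuous up
to the boundary. -/
theorem hasDerivAt_integral_of_transport (I : MovingInterval a b a' b') {f h v vx : ℝ × ℝ → ℝ}
    (hf : ContinuousOn f (Ωtilde a b)) (hf1 : ContDiffOn ℝ 1 f (Ω a b))
    (hh : ContinuousOn h (Ωtilde a b)) (hv : ContinuousOn v (Ωtilde a b))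
    (hvx : ∀ z ∈ Ω a b, HasDerivAt (fun y => v (z.1, y)) (vx z) z.2)
    (hva : ∀ t, 0 < t → v (t, a t) = a' t) (hvb : ∀ t, 0 < t → v (t, b t) = b' t)
    (htr : ∀ z ∈ Ω a b, fderiv ℝ f z (1, v z) = h z - f z * vx z) {t : ℝ} (ht : 0 < t) :
    HasDerivAt (fun s => ∫ x in a s..b s, f (s, x)) (∫ x in a t..b t, h (t, x)) t := by
  have hdiff : ∀ z ∈ Ω a b, DifferentiableAt ℝ f z := fun z hz =>
    (hf1.contDiffAt (I.isOpen_Ω.mem_nhds hz)).differentiableAt (by norm_num)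
  have hfd : ContinuousOn (fderiv ℝ f) (Ω a b) :=
    hf1.continuousOn_fderiv_of_isOpen I.isOpen_Ω le_rfl
  simp_rw [← mul_integral_strip f, ← mul_integral_strip h]
  have cl : ∀ A : Set ℝ, ContinuousOn (fun z : ℝ × ℝ => b z.1 - a z.1) (Ioi 0 ×ˢ A) := fun A =>
    ((I.cont_right.sub I.cont_left).mono Ioi_subset_Ici_self).comp continuousOn_fst
      fun z hz => hz.1
  have cl' : ∀ A : Set ℝ, ContinuousOn (fun z : ℝ × ℝ => b' z.1 - a' z.1) (Ioi 0 ×ˢ A) := fun A =>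
    (I.cont_deriv_right.sub I.cont_deriv_left).comp continuousOn_fst fun z hz => hz.1
  have ca' : ∀ A : Set ℝ, ContinuousOn (fun z : ℝ × ℝ => a' z.1) (Ioi 0 ×ˢ A) := fun A =>
    I.cont_deriv_left.comp continuousOn_fst fun z hz => hz.1
  have cξ : ∀ A : Set ℝ, ContinuousOn (fun z : ℝ × ℝ => a' z.1 + (b' z.1 - a' z.1) * z.2)
      (Ioi 0 ×ˢ A) := fun A => (ca' A).add ((cl' A).mul continuousOn_snd)
  -- A point of fixed relative position θ moves with velocity ξ = a' + (b' - a')θ. Here p is the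
  -- plain time derivative of the rescaled integrand, H keeps only the part that follows v, and q =
  -- (ξ - v)f is the flux relative to the grid. It vanishes at θ = 0, 1 because the gas moves with
  -- the end points.
  refine hasDerivAt_integral_of_flux (Ioi_mem_nhds ht)
    (g := fun s θ => (b s - a s) * f (strip a b (s, θ)))
    (H := fun s θ => (b s - a s) * h (strip a b (s, θ)))
    (p := fun s θ => (b' s - a' s) * f (strip a b (s, θ)) + (b s - a s) *
      fderiv ℝ f (strip a b (s, θ)) (1, a' s + (b' s - a' s) * θ))
    (q := fun s θ => (a' s + (b' s - a' s) * θ - v (strip a b (s, θ))) * f (strip a b (s, θ)))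
    ((cl _).mul (I.comp_strip_Ωtilde hf)) ((cl _).mul (I.comp_strip_Ωtilde hh))
    (((cξ _).sub (I.comp_strip_Ωtilde hv)).mul (I.comp_strip_Ωtilde hf)) ?_ ?_ ?_ ?_ ?_
  · refine ((cl' _).mul ((I.comp_strip_Ωtilde hf).mono (prod_mono Subset.rfl
      Ioo_subset_Icc_self))).add ((cl _).mul ?_)
    exact (I.comp_strip_Ω hfd).clm_apply (continuousOn_const.prodMk (cξ _))
  · intro s hs θ hθ
    exact ((I.deriv_right s hs).sub (I.deriv_left s hs)).mul
      (I.hasDerivAt_strip hs (hdiff _ (I.mapsTo_Ω (x := (s, θ)) ⟨hs, hθ⟩)))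
  · intro s hs θ hθ
    have hz := I.mapsTo_Ω (x := (s, θ)) ⟨hs, hθ⟩
    have h1 : HasDerivAt (fun θ => a s + (b s - a s) * θ) (b s - a s) θ := by
      simpa using ((hasDerivAt_id θ).const_mul (b s - a s)).const_add (a s)
    have h2 : HasDerivAt (fun θ => a' s + (b' s - a' s) * θ) (b' s - a' s) θ := by
      simpa using ((hasDerivAt_id θ).const_mul (b' s - a' s)).const_add (a' s)
    have h3 : HasDerivAt (fun θ => v (strip a b (s, θ)))
        (vx (strip a b (s, θ)) * (b s - a s)) θ :=
      HasDerivAt.comp (h₂ := fun y => v (s, y)) θ (hvx _ hz) h1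
    have h4 : HasDerivAt (fun θ => f (strip a b (s, θ)))
        (fderiv ℝ f (strip a b (s, θ)) (0, 1) * (b s - a s)) θ :=
      HasDerivAt.comp (h₂ := fun y => f (s, y)) θ (hasDerivAt_slice (hdiff _ hz)) h1
    refine ((h2.sub h3).mul h4).congr_deriv ?_
    have h5 := htr _ hz
    -- The grid direction splits into the material direction, known from `htr`, and a spatial
    -- remainder.
    have h6 : ∀ c : ℝ, fderiv ℝ f (strip a b (s, θ)) (1, c)
        = fderiv ℝ f (strip a b (s, θ)) (1, v (strip a b (s, θ)))
          + (c - v (strip a b (s, θ))) * fderiv ℝ f (strip a b (s, θ)) (0, 1) := fun c => by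
      rw [← smul_eq_mul, ← map_smul, ← map_add]
      simp
    rw [h6, h5]
    simp only [Pi.sub_apply]
    ring
  · intro s hs
    simp [strip, hva s hs]
  · intro s hs
    simp [strip, hvb s hs]

/-- Differentiation along the curves of constant relative position, the end points included. -/
theorem hasDerivAt_strip_of_C1UpTo (I : MovingInterval a b a' b') {f : ℝ × ℝ → ℝ}
    {g : ℝ × ℝ → ℝ × ℝ →L[ℝ] ℝ} (hf : ContinuousOn f (Ωtilde a b))
    (hf1 : ContDiffOn ℝ 1 f (Ω a b)) (hg : ContinuousOn g (Ωtilde a b))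
    (hfg : EqOn g (fderiv ℝ f) (Ω a b)) {t θ : ℝ} (ht : 0 < t) (hθ : θ ∈ Icc (0 : ℝ) 1) :
    HasDerivAt (fun s => f (strip a b (s, θ)))
      (g (strip a b (t, θ)) (1, a' t + (b' t - a' t) * θ)) t := by
  have hsub : Icc (t / 2) (2 * t) ⊆ Ioi 0 := fun s hs => (half_pos ht).trans_le hs.1
  have hmaps : MapsTo Prod.swap (Icc (0 : ℝ) 1 ×ˢ Icc (t / 2) (2 * t))
      (Ioi (0 : ℝ) ×ˢ Icc (0 : ℝ) 1) := fun z hz => ⟨hsub hz.2, hz.1⟩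
  have hne : (𝓝[Ioo (0 : ℝ) 1] θ).NeBot := by
    rw [← mem_closure_iff_nhdsWithin_neBot, closure_Ioo zero_ne_one]
    exact hθ
  have ca' : ContinuousOn (fun z : ℝ × ℝ => a' z.1) (Ioi 0 ×ˢ Icc 0 1) :=
    I.cont_deriv_left.comp continuousOn_fst fun z hz => hz.1
  have cb' : ContinuousOn (fun z : ℝ × ℝ => b' z.1) (Ioi 0 ×ˢ Icc 0 1) :=
    I.cont_deriv_right.comp continuousOn_fst fun z hz => hz.1
  have hG : ContinuousOn (fun z : ℝ × ℝ => g (strip a b z)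
      (1, a' z.1 + (b' z.1 - a' z.1) * z.2)) (Ioi 0 ×ˢ Icc 0 1) :=
    (I.comp_strip_Ωtilde hg).clm_apply
      (continuousOn_const.prodMk (ca'.add ((cb'.sub ca').mul continuousOn_snd)))
  -- Relative positions in (0, 1) approach θ, which may be an end point. The extended derivative
  -- converges uniformly on the compact time interval around t.
  refine hasDerivAt_of_continuousOn_prod (f := fun θ s => f (strip a b (s, θ)))
    (f' := fun θ s => g (strip a b (s, θ)) (1, a' s + (b' s - a' s) * θ)) hθ
    (l := 𝓝[Ioo (0 : ℝ) 1] θ) (nhdsWithin_mono _ Ioo_subset_Icc_self) (c := t / 2) (d := 2 * t)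
    ((I.comp_strip_Ωtilde hf).comp continuous_swap.continuousOn hmaps)
    (hG.comp continuous_swap.continuousOn hmaps) ?_ ⟨by linarith, by linarith⟩
  filter_upwards [self_mem_nhdsWithin] with η hη s hs
  have hs0 := hsub (Ioo_subset_Icc_self hs)
  have hz := I.mapsTo_Ω (x := (s, η)) ⟨hs0, hη⟩
  rw [hfg hz]
  exact I.hasDerivAt_strip hs0
    ((hf1.contDiffAt (I.isOpen_Ω.mem_nhds hz)).differentiableAt (by norm_num))

theorem hasDerivAt_left (I : MovingInterval a b a' b') {f : ℝ × ℝ → ℝ}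
    {g : ℝ × ℝ → ℝ × ℝ →L[ℝ] ℝ} (hf : ContinuousOn f (Ωtilde a b))
    (hf1 : ContDiffOn ℝ 1 f (Ω a b)) (hg : ContinuousOn g (Ωtilde a b))
    (hfg : EqOn g (fderiv ℝ f) (Ω a b)) {t : ℝ} (ht : 0 < t) :
    HasDerivAt (fun s => f (s, a s)) (g (t, a t) (1, a' t)) t := by
  simpa [strip] using I.hasDerivAt_strip_of_C1UpTo hf hf1 hg hfg ht (θ := 0) (by simp)

theorem hasDerivAt_right (I : MovingInterval a b a' b') {f : ℝ × ℝ → ℝ}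
    {g : ℝ × ℝ → ℝ × ℝ →L[ℝ] ℝ} (hf : ContinuousOn f (Ωtilde a b))
    (hf1 : ContDiffOn ℝ 1 f (Ω a b)) (hg : ContinuousOn g (Ωtilde a b))
    (hfg : EqOn g (fderiv ℝ f) (Ω a b)) {t : ℝ} (ht : 0 < t) :
    HasDerivAt (fun s => f (s, b s)) (g (t, b t) (1, b' t)) t := by
  simpa [strip] using I.hasDerivAt_strip_of_C1UpTo hf hf1 hg hfg ht (θ := 1) (by simp)

/-- The spatial derivative of a function of class `C¹` up to `t = 0`. -/
theorem hasDerivAt_slice_of_C1UpTo (I : MovingInterval a b a' b') {f : ℝ × ℝ → ℝ}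
    {g : ℝ × ℝ → ℝ × ℝ →L[ℝ] ℝ} (hf : ContinuousOn f (Ωbar a b))
    (hf1 : ContDiffOn ℝ 1 f (Ω a b)) (hg : ContinuousOn g (Ωbar a b))
    (hfg : EqOn g (fderiv ℝ f) (Ω a b)) {t x : ℝ} (ht : 0 ≤ t) (hx : x ∈ Ioo (a t) (b t)) :
    HasDerivAt (fun y => f (t, y)) (g (t, x) (0, 1)) x := by
  obtain ⟨c, hac, hcx⟩ := exists_between hx.1
  obtain ⟨d, hxd, hdb⟩ := exists_between hx.2
  set T : Set ℝ := {s | 0 ≤ s ∧ a s < c ∧ d < b s} with hT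
  have hTt : T ∈ 𝓝[Ici 0] t := by
    filter_upwards [self_mem_nhdsWithin, (I.cont_left t ht).eventually_lt_const hac,
      (I.cont_right t ht).eventually_const_lt hdb] with s h1 h2 h3 using ⟨h1, h2, h3⟩
  -- Only later times approach t, so that t = 0 is allowed.
  have hle : 𝓝[>] t ≤ 𝓝[T] t := by
    refine nhdsWithin_le_of_mem ?_
    exact nhdsWithin_mono t (fun s hs => ht.trans (le_of_lt hs)) hTt
  have hsub : T ×ˢ Icc c d ⊆ Ωbar a b := fun z hz =>
    ⟨hz.1.1, hz.1.2.1.le.trans hz.2.1, hz.2.2.trans hz.1.2.2.le⟩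
  refine hasDerivAt_of_continuousOn_prod (f := fun s y => f (s, y))
    (f' := fun s y => g (s, y) (0, 1)) (T := T) (mem_of_mem_nhdsWithin ht hTt) hle
    (c := c) (d := d) (hf.mono hsub) ((hg.mono hsub).clm_apply continuousOn_const) ?_ ⟨hcx, hxd⟩
  filter_upwards [self_mem_nhdsWithin, hle self_mem_nhdsWithin] with s hs hsT y hy
  have hz : (s, y) ∈ Ω a b := ⟨ht.trans_lt hs, hsT.2.1.trans hy.1, hy.2.trans hsT.2.2⟩
  rw [hfg hz]
  exact hasDerivAt_slice
    ((hf1.contDiffAt (I.isOpen_Ω.mem_nhds hz)).differentiableAt (by norm_num))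

end MovingInterval

/-- One-sided derivatives at the end points of an interval. -/
theorem derivWithin_Icc_left {f f' : ℝ → ℝ} {a b : ℝ} (hab : a < b) (hf : ContinuousOn f (Icc a b))
    (hf' : ContinuousOn f' (Icc a b)) (hd : ∀ x ∈ Ioo a b, HasDerivAt f (f' x) x) :
    derivWithin f (Icc a b) a = f' a := by
  have hs : Ioo a b ∈ 𝓝[>] a := Ioo_mem_nhdsGT hab
  have hl : Tendsto f' (𝓝[>] a) (𝓝 (f' a)) :=
    ((hf' a (left_mem_Icc.2 hab.le)).mono Ioo_subset_Icc_self).mono_left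
      (nhdsWithin_le_of_mem hs)
  have h1 := hasDerivWithinAt_Ici_of_tendsto_deriv (s := Ioo a b)
    (fun x hx => (hd x hx).differentiableAt.differentiableWithinAt)
    ((hf a (left_mem_Icc.2 hab.le)).mono Ioo_subset_Icc_self) hs
    (hl.congr' (by filter_upwards [hs] with x hx using (hd x hx).deriv.symm))
  exact (h1.mono Icc_subset_Ici_self).derivWithin
    (uniqueDiffOn_Icc hab a (left_mem_Icc.2 hab.le))

theorem derivWithin_Icc_right {f f' : ℝ → ℝ} {a b : ℝ} (hab : a < b)
    (hf : ContinuousOn f (Icc a b)) (hf' : ContinuousOn f' (Icc a b))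
    (hd : ∀ x ∈ Ioo a b, HasDerivAt f (f' x) x) :
    derivWithin f (Icc a b) b = f' b := by
  have hs : Ioo a b ∈ 𝓝[<] b := Ioo_mem_nhdsLT hab
  have hl : Tendsto f' (𝓝[<] b) (𝓝 (f' b)) :=
    ((hf' b (right_mem_Icc.2 hab.le)).mono Ioo_subset_Icc_self).mono_left
      (nhdsWithin_le_of_mem hs)
  have h1 := hasDerivWithinAt_Iic_of_tendsto_deriv (s := Ioo a b)
    (fun x hx => (hd x hx).differentiableAt.differentiableWithinAt)
    ((hf b (right_mem_Icc.2 hab.le)).mono Ioo_subset_Icc_self) hs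
    (hl.congr' (by filter_upwards [hs] with x hx using (hd x hx).deriv.symm))
  exact (h1.mono Icc_subset_Iic_self).derivWithin
    (uniqueDiffOn_Icc hab b (right_mem_Icc.2 hab.le))


/-! ### Gas flows and their material derivatives. -/

theorem Ωtilde_subset_closure_Ω {a b : ℝ → ℝ} (hab : ∀ t, 0 ≤ t → a t < b t) :
    Ωtilde a b ⊆ closure (Ω a b) := by
  rintro ⟨t, x⟩ ⟨ht, hx⟩
  have hx' : x ∈ closure (Ioo (a t) (b t)) := by
    rwa [closure_Ioo (hab t (le_of_lt ht)).ne]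
  exact map_mem_closure (f := fun y => (t, y)) (by fun_prop) hx' fun y hy => ⟨ht, hy⟩

/-- Density `ϱ` and velocity `w` of a gas in a moving interval, with the continuous extensions `dϱ`
and `dw` of their derivatives. -/
structure IsFlow (P μ a b : ℝ → ℝ) (ϱ w : ℝ × ℝ → ℝ) (dϱ dw : ℝ × ℝ → ℝ × ℝ →L[ℝ] ℝ) : Prop where
  interval : MovingInterval a b (fun t => w (t, a t)) (fun t => w (t, b t))
  pos : ∀ z ∈ Ωbar a b, 0 < ϱ z
  cont_ϱ : ContinuousOn ϱ (Ωbar a b)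
  contDiff_ϱ : ContDiffOn ℝ 2 ϱ (Ω a b)
  cont_dϱ : ContinuousOn dϱ (Ωbar a b)
  dϱ_eq : EqOn dϱ (fderiv ℝ ϱ) (Ω a b)
  cont_w : ContinuousOn w (Ωbar a b)
  contDiff_w : ContDiffOn ℝ 1 w (Ω a b)
  cont_dw : ContinuousOn dw (Ωtilde a b)
  dw_eq : EqOn dw (fderiv ℝ w) (Ω a b)
  mass : ∀ z ∈ Ωtilde a b, dϱ z (1, w z) = -(ϱ z * dw z (0, 1))
  momentum : ∀ z ∈ Ω a b, HasDerivAt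
    (fun y => μ (ϱ (z.1, y)) * dw (z.1, y) (0, 1) - P (ϱ (z.1, y))) (ϱ z * dw z (1, w z)) z.2

/-- The transformed momentum. -/
noncomputable def transformedMomentum (μ : ℝ → ℝ) (ϱ w : ℝ × ℝ → ℝ)
    (dϱ : ℝ × ℝ → ℝ × ℝ →L[ℝ] ℝ) (z : ℝ × ℝ) : ℝ :=
  ϱ z * w z + μ (ϱ z) / ϱ z * dϱ z (0, 1)

theorem hasDerivAt_line {F : Type*} [NormedAddCommGroup F] [NormedSpace ℝ F] {f : ℝ × ℝ → F}
    {z : ℝ × ℝ} (hf : DifferentiableAt ℝ f z) (d : ℝ × ℝ) :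
    HasDerivAt (fun s : ℝ => f (z + s • d)) (fderiv ℝ f z d) 0 :=
  hf.hasFDerivAt.hasLineDerivAt d

theorem fderiv_apply_of_line {f : ℝ × ℝ → ℝ} {z d : ℝ × ℝ} (hf : DifferentiableAt ℝ f z) {c : ℝ}
    (h : HasDerivAt (fun s : ℝ => f (z + s • d)) c 0) : fderiv ℝ f z d = c :=
  (hasDerivAt_line hf d).unique h

namespace IsFlow

variable {P μ a b : ℝ → ℝ} {ϱ w : ℝ × ℝ → ℝ} {dϱ dw : ℝ × ℝ → ℝ × ℝ →L[ℝ] ℝ} {ρs : ℝ}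

theorem pos_Ω (F : IsFlow P μ a b ϱ w dϱ dw) {z : ℝ × ℝ} (hz : z ∈ Ω a b) : 0 < ϱ z :=
  F.pos z (Ωtilde_subset_Ωbar (Ω_subset_Ωtilde hz))

theorem mem_nhds (F : IsFlow P μ a b ϱ w dϱ dw) {z : ℝ × ℝ} (hz : z ∈ Ω a b) : Ω a b ∈ 𝓝 z :=
  F.interval.isOpen_Ω.mem_nhds hz

theorem differentiableAt_ϱ (F : IsFlow P μ a b ϱ w dϱ dw) {z : ℝ × ℝ} (hz : z ∈ Ω a b) :
    DifferentiableAt ℝ ϱ z :=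
  (F.contDiff_ϱ.contDiffAt (F.mem_nhds hz)).differentiableAt (by norm_num)

theorem differentiableAt_w (F : IsFlow P μ a b ϱ w dϱ dw) {z : ℝ × ℝ} (hz : z ∈ Ω a b) :
    DifferentiableAt ℝ w z :=
  (F.contDiff_w.contDiffAt (F.mem_nhds hz)).differentiableAt (by norm_num)

theorem hasDerivAt_w (F : IsFlow P μ a b ϱ w dϱ dw) {z : ℝ × ℝ} (hz : z ∈ Ω a b) :
    HasDerivAt (fun y => w (z.1, y)) (dw z (0, 1)) z.2 := by
  rw [F.dw_eq hz]
  exact MovingInterval.hasDerivAt_slice (F.differentiableAt_w hz)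

theorem hasDerivAt_ϱ (F : IsFlow P μ a b ϱ w dϱ dw) {z : ℝ × ℝ} (hz : z ∈ Ω a b) :
    HasDerivAt (fun y => ϱ (z.1, y)) (dϱ z (0, 1)) z.2 := by
  rw [F.dϱ_eq hz]
  exact MovingInterval.hasDerivAt_slice (F.differentiableAt_ϱ hz)

theorem material_ϱ (F : IsFlow P μ a b ϱ w dϱ dw) {z : ℝ × ℝ} (hz : z ∈ Ω a b) :
    HasDerivAt (fun s : ℝ => ϱ (z + s • (1, w z))) (-(ϱ z * dw z (0, 1))) 0 := by
  rw [← F.mass z (Ω_subset_Ωtilde hz), F.dϱ_eq hz]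
  exact hasDerivAt_line (F.differentiableAt_ϱ hz) _

theorem material_w (F : IsFlow P μ a b ϱ w dϱ dw) {z : ℝ × ℝ} (hz : z ∈ Ω a b) :
    HasDerivAt (fun s : ℝ => w (z + s • (1, w z))) (dw z (1, w z)) 0 := by
  rw [F.dw_eq hz]
  exact hasDerivAt_line (F.differentiableAt_w hz) _

theorem comp_Ωbar (F : IsFlow P μ a b ϱ w dϱ dw) {f : ℝ → ℝ} (hf : ContinuousOn f (Ioi 0)) :
    ContinuousOn (fun z => f (ϱ z)) (Ωbar a b) :=
  hf.comp F.cont_ϱ F.pos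

theorem cont_transformedMomentum (F : IsFlow P μ a b ϱ w dϱ dw) (hH : AssumptionH P μ) :
    ContinuousOn (transformedMomentum μ ϱ w dϱ) (Ωbar a b) :=
  (F.cont_ϱ.mul F.cont_w).add ((F.comp_Ωbar hH.continuousOn_k').mul
    (F.cont_dϱ.clm_apply continuousOn_const))

theorem transformedMomentum_eq (F : IsFlow P μ a b ϱ w dϱ dw) (hH : AssumptionH P μ)
    (hρs : 0 < ρs) {z : ℝ × ℝ} (hz : z ∈ Ω a b) :
    transformedMomentum μ ϱ w dϱ z
      = ϱ z * w z + fderiv ℝ (fun z => k μ ρs (ϱ z)) z (0, 1) := by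
  have h := ((hH.hasDerivAt_k hρs (F.pos_Ω hz)).comp_hasFDerivAt z
    (F.differentiableAt_ϱ hz).hasFDerivAt).fderiv
  simp only [Function.comp_def] at h
  rw [h, transformedMomentum, F.dϱ_eq hz]
  rfl

theorem contDiffOn_comp_k (F : IsFlow P μ a b ϱ w dϱ dw) (hH : AssumptionH P μ) (hρs : 0 < ρs) :
    ContDiffOn ℝ 2 (fun z => k μ ρs (ϱ z)) (Ω a b) :=
  (hH.contDiffOn_k hρs).comp F.contDiff_ϱ fun _ hz => F.pos_Ω hz

/-- The gradient part is a first derivative of the C² function k(ρ). The base point of k shifts it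
by a constant only, so 1 is an arbitrary choice. -/
theorem contDiffOn_transformedMomentum (F : IsFlow P μ a b ϱ w dϱ dw) (hH : AssumptionH P μ) :
    ContDiffOn ℝ 1 (transformedMomentum μ ϱ w dϱ) (Ω a b) := by
  have h1 : ContDiffOn ℝ 1 (fun z => fderiv ℝ (fun z => k μ 1 (ϱ z)) z (0, 1)) (Ω a b) :=
    ((F.contDiffOn_comp_k hH one_pos).fderiv_of_isOpen F.interval.isOpen_Ω
      (by norm_num)).clm_apply contDiffOn_const
  exact (((F.contDiff_ϱ.of_le (by norm_num)).mul F.contDiff_w).add h1).congr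
    fun z hz => F.transformedMomentum_eq hH one_pos hz

/-- The material derivative of the gradient of `k(ρ)`. -/
theorem material_gradient (F : IsFlow P μ a b ϱ w dϱ dw) (hH : AssumptionH P μ) (hρs : 0 < ρs)
    {z : ℝ × ℝ} (hz : z ∈ Ω a b) :
    HasDerivAt (fun s : ℝ => fderiv ℝ (fun z => k μ ρs (ϱ z)) (z + s • (1, w z)) (0, 1))
      (-(ϱ z * dw z (1, w z) + deriv P (ϱ z) * dϱ z (0, 1))
        - dw z (0, 1) * fderiv ℝ (fun z => k μ ρs (ϱ z)) z (0, 1)) 0 := by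
  obtain ⟨K, hK⟩ : ∃ K, K = fun z => k μ ρs (ϱ z) := ⟨_, rfl⟩
  have hK2 : ContDiffOn ℝ 2 K (Ω a b) := hK ▸ F.contDiffOn_comp_k hH hρs
  rw [← hK]
  have hKat : ContDiffAt ℝ 2 K z := hK2.contDiffAt (F.mem_nhds hz)
  have hdiff : DifferentiableAt ℝ (fderiv ℝ K) z :=
    (hKat.fderiv_right (m := 1) (by norm_num)).differentiableAt (by norm_num)
  have hsymm : fderiv ℝ (fderiv ℝ K) z (1, w z) (0, 1)
      = fderiv ℝ (fderiv ℝ K) z (0, 1) (1, w z) :=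
    (hKat.isSymmSndFDerivAt (by simp)) _ _
  have h1 : HasDerivAt (fun s : ℝ => fderiv ℝ K (z + s • (1, w z)) (0, 1))
      (fderiv ℝ (fderiv ℝ K) z (1, w z) (0, 1)) 0 := by
    simpa using (hasDerivAt_line hdiff (1, w z)).clm_apply (hasDerivAt_const (0 : ℝ) ((0 : ℝ), (1 : ℝ)))
  refine h1.congr_deriv ?_
  rw [hsymm]
  have hΩx : ∀ᶠ y in 𝓝 z.2, (z.1, y) ∈ Ω a b :=
    (by fun_prop : ContinuousAt (fun y : ℝ => (z.1, y)) z.2).eventually_mem (F.mem_nhds hz)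
  -- Material and spatial derivatives do not commute: differentiating the material derivative of K
  -- in x leaves the commutator wₓ Kₓ.
  have h2 : HasDerivAt (fun y => fderiv ℝ K (z.1, y) (1, w (z.1, y)))
      (fderiv ℝ (fderiv ℝ K) z (0, 1) (1, w z) + fderiv ℝ K z (0, dw z (0, 1))) z.2 := by
    have e1 : HasDerivAt (fun y => fderiv ℝ K (z.1, y)) (fderiv ℝ (fderiv ℝ K) z (0, 1)) z.2 :=
      hdiff.hasFDerivAt.comp_hasDerivAt z.2
        ((hasDerivAt_const z.2 z.1).prodMk (hasDerivAt_id z.2))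
    exact e1.clm_apply ((hasDerivAt_const z.2 (1 : ℝ)).prodMk (F.hasDerivAt_w hz))
  have h3 : HasDerivAt (fun y => -(μ (ϱ (z.1, y)) * dw (z.1, y) (0, 1)))
      (-(ϱ z * dw z (1, w z) + deriv P (ϱ z) * dϱ z (0, 1))) z.2 := by
    have e1 := (hH.hasDerivAt_P (F.pos_Ω hz)).comp (h := fun y => ϱ (z.1, y)) z.2 (F.hasDerivAt_ϱ hz)
    refine ((F.momentum z hz).add e1).neg.congr_of_eventuallyEq (Eventually.of_forall fun y => ?_)
    simp
  -- Conservation of mass makes the material derivative of k(ρ) equal to -μ wₓ, whose spatial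
  -- derivative is known from the balance of momentum.
  have h4 : (fun y => fderiv ℝ K (z.1, y) (1, w (z.1, y)))
      =ᶠ[𝓝 z.2] fun y => -(μ (ϱ (z.1, y)) * dw (z.1, y) (0, 1)) := by
    filter_upwards [hΩx] with y hy
    have hy0 := F.pos_Ω hy
    have e1 := (hH.hasDerivAt_k hρs hy0).comp_hasFDerivAt (z.1, y)
      (F.differentiableAt_ϱ hy).hasFDerivAt
    have e2 : fderiv ℝ K (z.1, y) = (μ (ϱ (z.1, y)) / ϱ (z.1, y)) • fderiv ℝ ϱ (z.1, y) := by
      rw [hK]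
      exact e1.fderiv
    have e3 := F.mass _ (Ω_subset_Ωtilde hy)
    rw [F.dϱ_eq hy] at e3
    rw [e2, smul_apply, e3, smul_eq_mul]
    field_simp
  have h5 := h2.unique (h3.congr_of_eventuallyEq h4)
  have h6 : fderiv ℝ K z (0, dw z (0, 1)) = dw z (0, 1) * fderiv ℝ K z (0, 1) := by
    rw [← smul_eq_mul, ← map_smul]
    simp
  rw [h6] at h5
  linarith

/-- The acceleration ρ Dw enters the derivatives of ρw and of k(ρ)ₓ with opposite signs and cancels.
What remains involves only first derivatives and extends to the pistons. -/
theorem material_transformedMomentum (F : IsFlow P μ a b ϱ w dϱ dw) (hH : AssumptionH P μ)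
    {z : ℝ × ℝ} (hz : z ∈ Ω a b) :
    HasDerivAt (fun s : ℝ => transformedMomentum μ ϱ w dϱ (z + s • (1, w z)))
      (-(deriv P (ϱ z) * dϱ z (0, 1)) - dw z (0, 1) * transformedMomentum μ ϱ w dϱ z) 0 := by
  have hΩ : ∀ᶠ s : ℝ in 𝓝 0, z + s • (1, w z) ∈ Ω a b := by
    refine (by fun_prop : ContinuousAt (fun s : ℝ => z + s • (1, w z)) 0).eventually_mem ?_
    simpa using F.mem_nhds hz
  refine ((((F.material_ϱ hz).mul (F.material_w hz)).add
    (F.material_gradient hH one_pos hz)).congr_of_eventuallyEq ?_).congr_deriv ?_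
  · filter_upwards [hΩ] with s hs using F.transformedMomentum_eq hH one_pos hs
  · rw [F.transformedMomentum_eq hH one_pos hz]
    simp only [zero_smul, add_zero]
    ring

/-! ### Evolution of the integrals -/

theorem hasDerivAt_integral (F : IsFlow P μ a b ϱ w dϱ dw) {f h : ℝ × ℝ → ℝ}
    (hf : ContinuousOn f (Ωbar a b)) (hf1 : ContDiffOn ℝ 1 f (Ω a b))
    (hh : ContinuousOn h (Ωtilde a b))
    (htr : ∀ z ∈ Ω a b,
      HasDerivAt (fun s : ℝ => f (z + s • (1, w z))) (h z - f z * dw z (0, 1)) 0)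
    {t : ℝ} (ht : 0 < t) :
    HasDerivAt (fun s => ∫ x in a s..b s, f (s, x)) (∫ x in a t..b t, h (t, x)) t :=
  F.interval.hasDerivAt_integral_of_transport (hf.mono Ωtilde_subset_Ωbar) hf1 hh
    (F.cont_w.mono Ωtilde_subset_Ωbar) (fun _ hz => F.hasDerivAt_w hz) (fun _ _ => rfl)
    (fun _ _ => rfl) (fun z hz => fderiv_apply_of_line
      ((hf1.contDiffAt (F.mem_nhds hz)).differentiableAt (by norm_num)) (htr z hz)) ht

theorem hasDerivAt_integral_kinetic (F : IsFlow P μ a b ϱ w dϱ dw) {t : ℝ} (ht : 0 < t) :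
    HasDerivAt (fun s => ∫ x in a s..b s, ϱ (s, x) * w (s, x) ^ 2)
      (∫ x in a t..b t, 2 * (w (t, x) * (ϱ (t, x) * dw (t, x) (1, w (t, x))))) t := by
  have hw := F.cont_w.mono Ωtilde_subset_Ωbar
  refine F.hasDerivAt_integral (f := fun z => ϱ z * w z ^ 2)
    (h := fun z => 2 * (w z * (ϱ z * dw z (1, w z)))) (F.cont_ϱ.mul (F.cont_w.pow 2))
    ((F.contDiff_ϱ.of_le (by norm_num)).mul (F.contDiff_w.pow 2)) ?_ ?_ ht
  · exact continuousOn_const.mul (hw.mul ((F.cont_ϱ.mono Ωtilde_subset_Ωbar).mul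
      (F.cont_dw.clm_apply (continuousOn_const.prodMk hw))))
  · intro z hz
    refine ((F.material_ϱ hz).mul ((F.material_w hz).pow 2)).congr_deriv ?_
    simp only [zero_smul, add_zero, Pi.pow_apply]
    push_cast
    ring

/-- By the identity ρQ' = Q + P - P(ρ*), the material derivative of Q(ρ) is -(Q + P - P(ρ*))wₓ. Its
Q part cancels the change of volume, leaving the pressure work. -/
theorem hasDerivAt_integral_potential (F : IsFlow P μ a b ϱ w dϱ dw) (hH : AssumptionH P μ)
    (hρs : 0 < ρs) {t : ℝ} (ht : 0 < t) :
    HasDerivAt (fun s => ∫ x in a s..b s, Q P ρs (ϱ (s, x)))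
      (∫ x in a t..b t, -((P (ϱ (t, x)) - P ρs) * dw (t, x) (0, 1))) t := by
  refine F.hasDerivAt_integral (f := fun z => Q P ρs (ϱ z))
    (h := fun z => -((P (ϱ z) - P ρs) * dw z (0, 1))) (F.comp_Ωbar (hH.continuousOn_Q hρs))
    ((hH.contDiffOn_Q hρs).comp (F.contDiff_ϱ.of_le (by norm_num)) fun _ hz => F.pos_Ω hz) ?_ ?_ ht
  · exact ((((F.comp_Ωbar hH.continuousOn_P).mono Ωtilde_subset_Ωbar).sub continuousOn_const).mul
      (F.cont_dw.clm_apply continuousOn_const)).neg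
  · intro z hz
    have hz0 := F.pos_Ω hz
    refine (HasDerivAt.comp (h := fun s : ℝ => ϱ (z + s • (1, w z))) (h₂ := Q P ρs) (0 : ℝ)
      (h₂' := (Q P ρs (ϱ z) + (P (ϱ z) - P ρs)) / ϱ z) ?_ (F.material_ϱ hz)).congr_deriv ?_
    · simpa using hH.hasDerivAt_Q hρs hz0
    · field_simp
      ring

/-- In T²/ρ, the factor 1/ρ contributes wₓ times the integrand and T² contributes -2wₓ times it;
together they cancel the change of volume, and only the pressure gradient is left. -/
theorem hasDerivAt_integral_transformed (F : IsFlow P μ a b ϱ w dϱ dw) (hH : AssumptionH P μ)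
    {t : ℝ} (ht : 0 < t) :
    HasDerivAt (fun s => ∫ x in a s..b s, 1 / ϱ (s, x) * transformedMomentum μ ϱ w dϱ (s, x) ^ 2)
      (∫ x in a t..b t, -(2 * (deriv P (ϱ (t, x)) * dϱ (t, x) (0, 1)
        * (transformedMomentum μ ϱ w dϱ (t, x) / ϱ (t, x))))) t := by
  have hT := F.cont_transformedMomentum hH
  have hne : ∀ z ∈ Ωbar a b, ϱ z ≠ 0 := fun z hz => (F.pos z hz).ne'
  refine F.hasDerivAt_integral (f := fun z => 1 / ϱ z * transformedMomentum μ ϱ w dϱ z ^ 2)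
    (h := fun z => -(2 * (deriv P (ϱ z) * dϱ z (0, 1)
      * (transformedMomentum μ ϱ w dϱ z / ϱ z)))) ?_ ?_ ?_ ?_ ht
  · exact (continuousOn_const.div F.cont_ϱ hne).mul (hT.pow 2)
  · exact (contDiffOn_const.div (F.contDiff_ϱ.of_le (by norm_num))
      fun z hz => (F.pos_Ω hz).ne').mul ((F.contDiffOn_transformedMomentum hH).pow 2)
  · exact ((continuousOn_const.mul (((F.comp_Ωbar hH.continuousOn_deriv_P).mul
      (F.cont_dϱ.clm_apply continuousOn_const)).mul (hT.div F.cont_ϱ hne))).neg).mono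
      Ωtilde_subset_Ωbar
  · intro z hz
    have hz0 := (F.pos_Ω hz).ne'
    refine ((((hasDerivAt_const (0 : ℝ) (1 : ℝ)).div (F.material_ϱ hz) (by simpa using hz0)).mul
      ((F.material_transformedMomentum hH hz).pow 2))).congr_deriv ?_
    simp only [zero_smul, add_zero, Pi.pow_apply, Pi.div_apply]
    field_simp
    ring

end IsFlow


/-! ### Energy identities and dissipation of the Lyapunov functional. -/

theorem integral_mul_deriv_eq_of_continuousOn {f f' g g' : ℝ → ℝ} {a b : ℝ} (hab : a ≤ b)
    (hf : ContinuousOn f (Icc a b)) (hf' : ContinuousOn f' (Icc a b))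
    (hg : ContinuousOn g (Icc a b)) (hg' : ContinuousOn g' (Icc a b))
    (hfd : ∀ x ∈ Ioo a b, HasDerivAt f (f' x) x) (hgd : ∀ x ∈ Ioo a b, HasDerivAt g (g' x) x) :
    ∫ x in a..b, f x * g' x = f b * g b - f a * g a - ∫ x in a..b, f' x * g x := by
  refine intervalIntegral.integral_mul_deriv_eq_deriv_mul_of_hasDerivAt ?_ ?_ ?_ ?_
    (hf'.intervalIntegrable_of_Icc hab) (hg'.intervalIntegrable_of_Icc hab)
  · rwa [uIcc_of_le hab]
  · rwa [uIcc_of_le hab]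
  · rwa [min_eq_left hab, max_eq_right hab]
  · rwa [min_eq_left hab, max_eq_right hab]

namespace IsFlow

variable {P μ a b : ℝ → ℝ} {ϱ w : ℝ × ℝ → ℝ} {dϱ dw : ℝ × ℝ → ℝ × ℝ →L[ℝ] ℝ} {ρs R r : ℝ}

theorem isProfile (F : IsFlow P μ a b ϱ w dϱ dw) {t : ℝ} (ht : 0 ≤ t)
    (hmass : ∫ x in a t..b t, ϱ (t, x) = 1) :
    IsProfile (a t) (b t) (fun x => ϱ (t, x)) (fun x => dϱ (t, x) (0, 1)) (fun x => w (t, x)) where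
  lt := F.interval.lt t ht
  pos x hx := F.pos (t, x) ⟨ht, hx⟩
  cont := MovingInterval.continuousOn_slice_Ωbar F.cont_ϱ ht
  cont' := MovingInterval.continuousOn_slice_Ωbar (F.cont_dϱ.clm_apply continuousOn_const) ht
  hasDerivAt _ hx := F.interval.hasDerivAt_slice_of_C1UpTo F.cont_ϱ
    (F.contDiff_ϱ.of_le (by norm_num)) F.cont_dϱ F.dϱ_eq ht hx
  cont_v := MovingInterval.continuousOn_slice_Ωbar F.cont_w ht
  mass := hmass

theorem continuousOn_wx (F : IsFlow P μ a b ϱ w dϱ dw) {t : ℝ} (ht : 0 < t) :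
    ContinuousOn (fun x => dw (t, x) (0, 1)) (Icc (a t) (b t)) :=
  MovingInterval.continuousOn_slice_Ωtilde (f := fun z => dw z (0, 1))
    (F.cont_dw.clm_apply continuousOn_const) ht

theorem hasDerivAt_wx (F : IsFlow P μ a b ϱ w dϱ dw) {t : ℝ} (ht : 0 < t) :
    ∀ x ∈ Ioo (a t) (b t), HasDerivAt (fun x => w (t, x)) (dw (t, x) (0, 1)) x :=
  fun x hx => F.hasDerivAt_w (z := (t, x)) ⟨ht, hx⟩

theorem continuousOn_lyapunov (F : IsFlow P μ a b ϱ w dϱ dw) (hH : AssumptionH P μ)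
    (hρs : 0 < ρs) :
    ContinuousOn (fun t => lyapunov P μ ρs r (a t) (b t) (fun x => ϱ (t, x))
      (fun x => dϱ (t, x) (0, 1)) (fun x => w (t, x))) (Ici 0) := by
  have I := F.interval
  have hT := F.cont_transformedMomentum hH
  have hne : ∀ z ∈ Ωbar a b, ϱ z ≠ 0 := fun z hz => (F.pos z hz).ne'
  have c1 : ContinuousOn (fun t => ∫ x in a t..b t,
      1 / ϱ (t, x) * transformedMomentum μ ϱ w dϱ (t, x) ^ 2) (Ici 0) :=
    I.continuousOn_integral_moving (f := fun z => 1 / ϱ z * transformedMomentum μ ϱ w dϱ z ^ 2)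
      ((continuousOn_const.div F.cont_ϱ hne).mul (hT.pow 2))
  have c2 : ContinuousOn (fun t => ∫ x in a t..b t, ϱ (t, x) * w (t, x) ^ 2) (Ici 0) :=
    I.continuousOn_integral_moving (f := fun z => ϱ z * w z ^ 2) (F.cont_ϱ.mul (F.cont_w.pow 2))
  have c3 : ContinuousOn (fun t => ∫ x in a t..b t, Q P ρs (ϱ (t, x))) (Ici 0) :=
    I.continuousOn_integral_moving (f := fun z => Q P ρs (ϱ z))
      (F.comp_Ωbar (hH.continuousOn_Q hρs))
  have ca := I.continuousOn_left F.cont_w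
  have cb := I.continuousOn_right F.cont_w
  have cka := I.continuousOn_left (F.comp_Ωbar (hH.continuousOn_k hρs))
  have ckb := I.continuousOn_right (F.comp_Ωbar (hH.continuousOn_k hρs))
  exact ((((continuousOn_const.mul c1).add (continuousOn_const.mul ((cb.sub ckb).pow 2))).add
    (continuousOn_const.mul ((ca.add cka).pow 2))).add c3).add (continuousOn_const.mul
      (((((ca.pow 2).div_const 2).add ((cb.pow 2).div_const 2)).add
        (continuousOn_const.mul c2)).add c3))

/-- The piston is a gas particle, so this is the material derivative of k(ρ). Added to Newton's law
it cancels the viscous force on the piston. -/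
theorem hasDerivAt_k_left (F : IsFlow P μ a b ϱ w dϱ dw) (hH : AssumptionH P μ) (hρs : 0 < ρs)
    {t : ℝ} (ht : 0 < t) : HasDerivAt (fun s => k μ ρs (ϱ (s, a s)))
      (-(μ (ϱ (t, a t)) * dw (t, a t) (0, 1))) t := by
  have hz : (t, a t) ∈ Ωtilde a b := ⟨ht, left_mem_Icc.2 (F.interval.lt t ht.le).le⟩
  have hz0 := F.pos _ (Ωtilde_subset_Ωbar hz)
  have h1 := F.interval.hasDerivAt_left (F.cont_ϱ.mono Ωtilde_subset_Ωbar)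
    (F.contDiff_ϱ.of_le (by norm_num)) (F.cont_dϱ.mono Ωtilde_subset_Ωbar) F.dϱ_eq ht
  rw [F.mass _ hz] at h1
  refine ((hH.hasDerivAt_k hρs hz0).comp (h := fun s => ϱ (s, a s)) t h1).congr_deriv ?_
  field_simp

theorem hasDerivAt_k_right (F : IsFlow P μ a b ϱ w dϱ dw) (hH : AssumptionH P μ) (hρs : 0 < ρs)
    {t : ℝ} (ht : 0 < t) : HasDerivAt (fun s => k μ ρs (ϱ (s, b s)))
      (-(μ (ϱ (t, b t)) * dw (t, b t) (0, 1))) t := by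
  have hz : (t, b t) ∈ Ωtilde a b := ⟨ht, right_mem_Icc.2 (F.interval.lt t ht.le).le⟩
  have hz0 := F.pos _ (Ωtilde_subset_Ωbar hz)
  have h1 := F.interval.hasDerivAt_right (F.cont_ϱ.mono Ωtilde_subset_Ωbar)
    (F.contDiff_ϱ.of_le (by norm_num)) (F.cont_dϱ.mono Ωtilde_subset_Ωbar) F.dϱ_eq ht
  rw [F.mass _ hz] at h1
  refine ((hH.hasDerivAt_k hρs hz0).comp (h := fun s => ϱ (s, b s)) t h1).congr_deriv ?_
  field_simp

/-- Work of the stress. -/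
theorem integral_w_mul_momentum (F : IsFlow P μ a b ϱ w dϱ dw) (hH : AssumptionH P μ) {t : ℝ}
    (ht : 0 < t) :
    ∫ x in a t..b t, w (t, x) * (ϱ (t, x) * dw (t, x) (1, w (t, x)))
      = w (t, b t) * (μ (ϱ (t, b t)) * dw (t, b t) (0, 1) - P (ϱ (t, b t)))
        - w (t, a t) * (μ (ϱ (t, a t)) * dw (t, a t) (0, 1) - P (ϱ (t, a t)))
        - ((∫ x in a t..b t, μ (ϱ (t, x)) * dw (t, x) (0, 1) ^ 2)
          - ∫ x in a t..b t, dw (t, x) (0, 1) * P (ϱ (t, x))) := by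
  have hab := (F.interval.lt t ht.le).le
  have hw := MovingInterval.continuousOn_slice_Ωbar F.cont_w ht.le
  have hϱ := MovingInterval.continuousOn_slice_Ωbar F.cont_ϱ ht.le
  have hμ := MovingInterval.continuousOn_slice_Ωbar (F.comp_Ωbar hH.continuousOn_μ) ht.le
  have hP := MovingInterval.continuousOn_slice_Ωbar (F.comp_Ωbar hH.continuousOn_P) ht.le
  have hwx := F.continuousOn_wx ht
  have hDw : ContinuousOn (fun x => dw (t, x) (1, w (t, x))) (Icc (a t) (b t)) :=
    MovingInterval.continuousOn_slice_Ωtilde (f := fun z => dw z (1, w z))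
      (F.cont_dw.clm_apply (continuousOn_const.prodMk (F.cont_w.mono Ωtilde_subset_Ωbar))) ht
  have i1 : IntervalIntegrable (fun x => μ (ϱ (t, x)) * dw (t, x) (0, 1) ^ 2) volume (a t) (b t) :=
    (hμ.mul (hwx.pow 2)).intervalIntegrable_of_Icc hab
  have i2 : IntervalIntegrable (fun x => dw (t, x) (0, 1) * P (ϱ (t, x))) volume (a t) (b t) :=
    (hwx.mul hP).intervalIntegrable_of_Icc hab
  rw [← intervalIntegral.integral_sub i1 i2]
  refine (integral_mul_deriv_eq_of_continuousOn hab hw hwx ((hμ.mul hwx).sub hP) (hϱ.mul hDw)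
    (F.hasDerivAt_wx ht) (fun x hx => F.momentum (t, x) ⟨ht, hx⟩)).trans ?_
  simp only [Pi.sub_apply, Pi.mul_apply]
  congr 1
  refine intervalIntegral.integral_congr fun x _ => ?_
  ring

/-- Split T/ρ = w + μρₓ/ρ². The first part is integrated by parts into pressure work; the second is
the gradient dissipation. -/
theorem integral_pressure_gradient (F : IsFlow P μ a b ϱ w dϱ dw) (hH : AssumptionH P μ) {t : ℝ}
    (ht : 0 < t) :
    ∫ x in a t..b t, deriv P (ϱ (t, x)) * dϱ (t, x) (0, 1)
        * (transformedMomentum μ ϱ w dϱ (t, x) / ϱ (t, x))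
      = w (t, b t) * P (ϱ (t, b t)) - w (t, a t) * P (ϱ (t, a t))
        - (∫ x in a t..b t, dw (t, x) (0, 1) * P (ϱ (t, x)))
        + ∫ x in a t..b t, deriv P (ϱ (t, x)) * μ (ϱ (t, x)) / ϱ (t, x) ^ 2
          * dϱ (t, x) (0, 1) ^ 2 := by
  have hab := (F.interval.lt t ht.le).le
  have hw := MovingInterval.continuousOn_slice_Ωbar F.cont_w ht.le
  have hϱ := MovingInterval.continuousOn_slice_Ωbar F.cont_ϱ ht.le
  have hϱx := MovingInterval.continuousOn_slice_Ωbar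
    (F.cont_dϱ.clm_apply (continuousOn_const (c := ((0 : ℝ), (1 : ℝ))))) ht.le
  have hμ := MovingInterval.continuousOn_slice_Ωbar (F.comp_Ωbar hH.continuousOn_μ) ht.le
  have hP := MovingInterval.continuousOn_slice_Ωbar (F.comp_Ωbar hH.continuousOn_P) ht.le
  have hP' := MovingInterval.continuousOn_slice_Ωbar (F.comp_Ωbar hH.continuousOn_deriv_P) ht.le
  have hwx := F.continuousOn_wx ht
  have hne : ∀ x ∈ Icc (a t) (b t), ϱ (t, x) ≠ 0 := fun x hx => (F.pos (t, x) ⟨ht.le, hx⟩).ne'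
  have i1 : IntervalIntegrable (fun x => w (t, x) * (deriv P (ϱ (t, x)) * dϱ (t, x) (0, 1)))
      volume (a t) (b t) := (hw.mul (hP'.mul hϱx)).intervalIntegrable_of_Icc hab
  have i2 : IntervalIntegrable (fun x => deriv P (ϱ (t, x)) * μ (ϱ (t, x)) / ϱ (t, x) ^ 2
      * dϱ (t, x) (0, 1) ^ 2) volume (a t) (b t) :=
    (((hP'.mul hμ).div (hϱ.pow 2) fun x hx => pow_ne_zero 2 (hne x hx)).mul
      (hϱx.pow 2)).intervalIntegrable_of_Icc hab
  rw [← integral_mul_deriv_eq_of_continuousOn hab hw hwx hP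
    (g' := fun x => deriv P (ϱ (t, x)) * dϱ (t, x) (0, 1)) (hP'.mul hϱx) (F.hasDerivAt_wx ht)
    (fun x hx => by
      have hz : (t, x) ∈ Ω a b := ⟨ht, hx⟩
      exact (hH.hasDerivAt_P (F.pos_Ω hz)).comp (h := fun y => ϱ (t, y)) x (F.hasDerivAt_ϱ hz)),
    ← intervalIntegral.integral_add i1 i2]
  refine intervalIntegral.integral_congr fun x hx => ?_
  rw [uIcc_of_le hab] at hx
  have := hne x hx
  simp only [transformedMomentum]
  field_simp

theorem integral_potential_rate (F : IsFlow P μ a b ϱ w dϱ dw) (hH : AssumptionH P μ) (c : ℝ)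
    {t : ℝ} (ht : 0 < t) :
    ∫ x in a t..b t, -((P (ϱ (t, x)) - c) * dw (t, x) (0, 1))
      = c * (w (t, b t) - w (t, a t)) - ∫ x in a t..b t, dw (t, x) (0, 1) * P (ϱ (t, x)) := by
  have hab := (F.interval.lt t ht.le).le
  have hw := MovingInterval.continuousOn_slice_Ωbar F.cont_w ht.le
  have hP := MovingInterval.continuousOn_slice_Ωbar (F.comp_Ωbar hH.continuousOn_P) ht.le
  have hwx := F.continuousOn_wx ht
  have i1 : IntervalIntegrable (fun x => dw (t, x) (0, 1) * P (ϱ (t, x))) volume (a t) (b t) :=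
    (hwx.mul hP).intervalIntegrable_of_Icc hab
  rw [← intervalIntegral.integral_eq_sub_of_hasDerivAt_of_le hab hw (F.hasDerivAt_wx ht)
    (hwx.intervalIntegrable_of_Icc hab), ← intervalIntegral.integral_const_mul,
    ← intervalIntegral.integral_sub ((hwx.intervalIntegrable_of_Icc hab).const_mul c) i1]
  refine intervalIntegral.integral_congr fun x _ => ?_
  ring

/-- The Lyapunov functional dissipates along flows between pistons obeying Newton's law under the
feedback law. -/
theorem hasDerivAt_lyapunov (F : IsFlow P μ a b ϱ w dϱ dw) (hH : AssumptionH P μ) (hρs : 0 < ρs)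
    {t : ℝ} (ht : 0 < t)
    (hright : HasDerivAt (fun s => w (s, b s))
      (P (ϱ (t, b t)) - μ (ϱ (t, b t)) * dw (t, b t) (0, 1) - P ρs) t)
    (hleft : HasDerivAt (fun s => w (s, a s))
      (-R * ((r + 1) * w (t, a t) + k μ ρs (ϱ (t, a t))) + P ρs - P (ϱ (t, a t))
        + μ (ϱ (t, a t)) * dw (t, a t) (0, 1)) t) :
    HasDerivAt (fun t => lyapunov P μ ρs r (a t) (b t) (fun x => ϱ (t, x))
        (fun x => dϱ (t, x) (0, 1)) (fun x => w (t, x)))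
      (-dissipation P μ ρs R r (a t) (b t) (fun x => ϱ (t, x)) (fun x => dϱ (t, x) (0, 1))
        (fun x => w (t, x)) (fun x => dw (t, x) (0, 1))) t := by
  have d1 := F.hasDerivAt_integral_transformed hH ht
  have d2 := F.hasDerivAt_integral_kinetic ht
  have d3 := F.hasDerivAt_integral_potential hH hρs ht
  rw [intervalIntegral.integral_neg, intervalIntegral.integral_const_mul,
    F.integral_pressure_gradient hH ht] at d1
  rw [intervalIntegral.integral_const_mul, F.integral_w_mul_momentum hH ht] at d2
  rw [F.integral_potential_rate hH _ ht] at d3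
  have ka := F.hasDerivAt_k_left hH hρs ht
  have kb := F.hasDerivAt_k_right hH hρs ht
  -- In W and in E alike, the potential energy absorbs the integral of wₓP. After Newton's laws the
  -- boundary work reduces to the terms k(P - P(ρ*)) in W and to the input times w(a) + k(ρ(a)) in W
  -- and times w(a) in E; the feedback law completes the square.
  have key := ((((d1.const_mul (1 / 2)).add (((hright.sub kb).pow 2).const_mul (1 / 2))).add
    (((hleft.add ka).pow 2).const_mul (1 / 2))).add d3).add
    ((((((hleft.pow 2).div_const 2).add ((hright.pow 2).div_const 2)).add
        (d2.const_mul (1 / 2))).add d3).const_mul r)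
  refine HasDerivAt.congr_deriv (f := fun t => lyapunov P μ ρs r (a t) (b t) (fun x => ϱ (t, x))
        (fun x => dϱ (t, x) (0, 1)) (fun x => w (t, x))) key ?_
  simp only [dissipation, Pi.add_apply, Pi.sub_apply]
  push_cast
  ring

end IsFlow


/-! ### Classical solutions as flows. -/

theorem hasDerivAt_fst_slice {f : ℝ × ℝ → ℝ} {t x : ℝ} (hf : DifferentiableAt ℝ f (t, x)) :
    HasDerivAt (fun s => f (s, x)) (fderiv ℝ f (t, x) (1, 0)) t :=
  hf.hasFDerivAt.comp_hasDerivAt t ((hasDerivAt_id t).prodMk (hasDerivAt_const t x))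

theorem clm_apply_one (L : ℝ × ℝ →L[ℝ] ℝ) (c : ℝ) : L (1, c) = L (1, 0) + c * L (0, 1) := by
  rw [← smul_eq_mul, ← map_smul, ← map_add]
  simp

namespace IsClassicalSolution

variable {P μ u a b : ℝ → ℝ} {Pext : ℝ} {ρ v : ℝ → ℝ → ℝ}

theorem hasDerivAt_left (hs : IsClassicalSolution P μ Pext u a b ρ v) {t : ℝ} (ht : 0 < t) :
    HasDerivAt a (v t (a t)) t := by
  have h := ((hs.a_C1.contDiffAt (Ici_mem_nhds ht)).differentiableAt (by norm_num)).hasDerivAt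
  rwa [← derivWithin_of_mem_nhds (Ici_mem_nhds ht), ← hs.left_velocity t ht.le] at h

theorem hasDerivAt_right (hs : IsClassicalSolution P μ Pext u a b ρ v) {t : ℝ} (ht : 0 < t) :
    HasDerivAt b (v t (b t)) t := by
  have h := ((hs.b_C1.contDiffAt (Ici_mem_nhds ht)).differentiableAt (by norm_num)).hasDerivAt
  rwa [← derivWithin_of_mem_nhds (Ici_mem_nhds ht), ← hs.right_velocity t ht.le] at h

theorem hasDerivAt_of_velocity {f w : ℝ → ℝ} (hf : ContDiffOn ℝ 2 f (Ioi 0))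
    (hw : ∀ t, 0 < t → HasDerivAt f (w t) t) {t : ℝ} (ht : 0 < t) :
    HasDerivAt w (deriv (deriv f) t) t := by
  have h : ContDiffOn ℝ 1 (deriv f) (Ioi 0) := hf.deriv_of_isOpen isOpen_Ioi (by norm_num)
  refine ((h.contDiffAt (Ioi_mem_nhds ht)).differentiableAt
    (by norm_num)).hasDerivAt.congr_of_eventuallyEq ?_
  filter_upwards [Ioi_mem_nhds ht] with s hs using (hw s hs).deriv.symm

theorem exists_isFlow (hs : IsClassicalSolution P μ Pext u a b ρ v) (hH : AssumptionH P μ) :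
    ∃ dϱ dw, IsFlow P μ a b (Function.uncurry ρ) (Function.uncurry v) dϱ dw := by
  obtain ⟨cρ, dρ, gρ, hgρ, eρ⟩ := hs.ρ_C1
  obtain ⟨-, dv, gv, hgv, ev⟩ := hs.v_C1
  have cva : ContinuousOn (fun t => Function.uncurry v (t, a t)) (Ici 0) :=
    hs.v_C0.comp (continuousOn_id.prodMk hs.a_C1.continuousOn)
      fun t ht => ⟨ht, left_mem_Icc.2 (hs.a_lt_b t ht).le⟩
  have cvb : ContinuousOn (fun t => Function.uncurry v (t, b t)) (Ici 0) :=
    hs.v_C0.comp (continuousOn_id.prodMk hs.b_C1.continuousOn)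
      fun t ht => ⟨ht, right_mem_Icc.2 (hs.a_lt_b t ht).le⟩
  have I : MovingInterval a b (fun t => Function.uncurry v (t, a t))
      (fun t => Function.uncurry v (t, b t)) :=
    ⟨hs.a_lt_b, hs.a_C1.continuousOn, hs.b_C1.continuousOn, fun t ht => hs.hasDerivAt_left ht,
      fun t ht => hs.hasDerivAt_right ht, cva.mono Ioi_subset_Ici_self,
      cvb.mono Ioi_subset_Ici_self⟩
  have hdρ : ∀ z ∈ Ω a b, DifferentiableAt ℝ (Function.uncurry ρ) z := fun z hz =>
    (dρ.contDiffAt (I.isOpen_Ω.mem_nhds hz)).differentiableAt (by norm_num)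
  have hdv : ∀ z ∈ Ω a b, DifferentiableAt ℝ (Function.uncurry v) z := fun z hz =>
    (dv.contDiffAt (I.isOpen_Ω.mem_nhds hz)).differentiableAt (by norm_num)
  have hpos : ∀ z ∈ Ωbar a b, 0 < Function.uncurry ρ z := fun z hz => hs.ρ_pos z.1 hz.1 z.2 hz.2
  refine ⟨gρ, gv, I, hpos, cρ, hs.ρ_C2, hgρ, eρ, hs.v_C0, dv, hgv, ev, ?_, ?_⟩
  · have hvt := hs.v_C0.mono Ωtilde_subset_Ωbar
    -- Both sides are continuous up to the pistons, so conservation of mass passes from the interior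
    -- to the boundary.
    refine EqOn.of_subset_closure (s := Ω a b) ?_ ?_ ?_ Ω_subset_Ωtilde
      (Ωtilde_subset_closure_Ω hs.a_lt_b)
    · rintro ⟨t, x⟩ hz
      have h1 := hs.mass_eq t hz.1 x hz.2
      have e1 : deriv (fun s => ρ s x) t = _ := (hasDerivAt_fst_slice (hdρ _ hz)).deriv
      have e2 : deriv (fun y => ρ t y * v t y) x = _ :=
        ((MovingInterval.hasDerivAt_slice (hdρ _ hz)).mul
          (MovingInterval.hasDerivAt_slice (hdv _ hz))).deriv
      rw [e1, e2] at h1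
      simp only
      rw [eρ hz, ev hz, clm_apply_one]
      simp only [Function.uncurry_apply_pair] at h1 ⊢
      linarith
    · exact (hgρ.mono Ωtilde_subset_Ωbar).clm_apply (continuousOn_const.prodMk hvt)
    · exact ((cρ.mono Ωtilde_subset_Ωbar).mul (hgv.clm_apply continuousOn_const)).neg
  · rintro ⟨t, x⟩ hz
    have ht : 0 < t := hz.1
    have hx : x ∈ Ioo (a t) (b t) := hz.2
    have hρ0 : 0 < ρ t x := hpos (t, x) (Ωtilde_subset_Ωbar (Ω_subset_Ωtilde hz))
    have hρx : HasDerivAt (fun y => ρ t y) _ x := MovingInterval.hasDerivAt_slice (hdρ _ hz)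
    have hμ : HasDerivAt μ (deriv μ (ρ t x)) (ρ t x) :=
      ((hH.μ_contDiff.contDiffAt (Ioi_mem_nhds hρ0)).differentiableAt (by norm_num)).hasDerivAt
    have hvx : HasDerivAt (deriv (v t)) (deriv (deriv (v t)) x) x := by
      have h : ContDiffOn ℝ 1 (deriv (v t)) (Ioo (a t) (b t)) :=
        (hs.v_C2 t ht).deriv_of_isOpen isOpen_Ioo (by norm_num)
      exact ((h.contDiffAt (isOpen_Ioo.mem_nhds hx)).differentiableAt (by norm_num)).hasDerivAt
    -- The momentum equation is stated with `deriv` and says nothing about differentiability, which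
    -- comes from v(t,·) being C² in space.
    have h1 : DifferentiableAt ℝ (fun y => μ (ρ t y) * deriv (v t) y - P (ρ t y)) x :=
      (((hμ.comp (h := fun y => ρ t y) x hρx).mul hvx).sub
        ((hH.hasDerivAt_P hρ0).comp (h := fun y => ρ t y) x hρx)).differentiableAt
    have h2 := h1.hasDerivAt
    rw [← hs.momentum_eq t ht x hx] at h2
    refine (h2.congr_of_eventuallyEq ?_).congr_deriv ?_
    · filter_upwards [isOpen_Ioo.mem_nhds hx] with y hy
      have hzy : (t, y) ∈ Ω a b := ⟨ht, hy⟩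
      have e : deriv (v t) y = _ := (MovingInterval.hasDerivAt_slice (hdv _ hzy)).deriv
      rw [e, ev hzy]
      rfl
    · have e1 : deriv (fun s => v s x) t = _ := (hasDerivAt_fst_slice (hdv _ hz)).deriv
      have e2 : deriv (v t) x = _ := (MovingInterval.hasDerivAt_slice (hdv _ hz)).deriv
      rw [e1, e2, ev hz, clm_apply_one _ (Function.uncurry v (t, x))]
      simp only [Function.uncurry_apply_pair]
      ring

theorem newton_right (hs : IsClassicalSolution P μ Pext u a b ρ v)
    {dϱ dw : ℝ × ℝ → ℝ × ℝ →L[ℝ] ℝ}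
    (F : IsFlow P μ a b (Function.uncurry ρ) (Function.uncurry v) dϱ dw) {t : ℝ} (ht : 0 < t) :
    HasDerivAt (fun s => v s (b s))
      (P (ρ t (b t)) - μ (ρ t (b t)) * dw (t, b t) (0, 1) - Pext) t := by
  refine (hasDerivAt_of_velocity hs.b_C2 (fun s => hs.hasDerivAt_right) ht).congr_deriv ?_
  have e : derivWithin (v t) (Icc (a t) (b t)) (b t) = dw (t, b t) (0, 1) :=
    derivWithin_Icc_right (hs.a_lt_b t ht.le)
      (MovingInterval.continuousOn_slice_Ωbar F.cont_w ht.le) (F.continuousOn_wx ht)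
      (F.hasDerivAt_wx ht)
  rw [hs.right_newton t ht, e]

theorem newton_left (hs : IsClassicalSolution P μ Pext u a b ρ v)
    {dϱ dw : ℝ × ℝ → ℝ × ℝ →L[ℝ] ℝ}
    (F : IsFlow P μ a b (Function.uncurry ρ) (Function.uncurry v) dϱ dw) {t : ℝ} (ht : 0 < t) :
    HasDerivAt (fun s => v s (a s))
      (u t + Pext - P (ρ t (a t)) + μ (ρ t (a t)) * dw (t, a t) (0, 1)) t := by
  refine (hasDerivAt_of_velocity hs.a_C2 (fun s => hs.hasDerivAt_left) ht).congr_deriv ?_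
  have e : derivWithin (v t) (Icc (a t) (b t)) (a t) = dw (t, a t) (0, 1) :=
    derivWithin_Icc_left (hs.a_lt_b t ht.le)
      (MovingInterval.continuousOn_slice_Ωbar F.cont_w ht.le) (F.continuousOn_wx ht)
      (F.hasDerivAt_wx ht)
  rw [hs.left_newton t ht, e]

end IsClassicalSolution


/-! ### The state space -/

namespace IsProfile

variable {P μ : ℝ → ℝ} {ρs r R a b C : ℝ} {ρ ρ' v v' : ℝ → ℝ}

theorem mapsTo_rescale (h : IsProfile a b ρ ρ' v) :
    MapsTo (fun θ => a + (b - a) * θ) (Icc 0 1) (Icc a b) := fun θ hθ => by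
  have := h.lt
  constructor <;> nlinarith [hθ.1, hθ.2]

theorem continuousOn_rescale (h : IsProfile a b ρ ρ' v) {f : ℝ → ℝ}
    (hf : ContinuousOn f (Icc a b)) :
    ContinuousOn (fun θ => f (a + (b - a) * θ)) (Icc 0 1) :=
  hf.comp (by fun_prop) h.mapsTo_rescale

theorem hasDerivAt_rescale (h : IsProfile a b ρ ρ' v) {θ : ℝ} (hθ : θ ∈ Ioo (0 : ℝ) 1) :
    HasDerivAt (fun θ => ρ (a + (b - a) * θ)) ((b - a) * ρ' (a + (b - a) * θ)) θ := by
  have h1 : HasDerivAt (fun θ => a + (b - a) * θ) (b - a) θ := by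
    simpa using ((hasDerivAt_id θ).const_mul (b - a)).const_add a
  have hx : a + (b - a) * θ ∈ Ioo a b := by
    have := h.lt
    constructor <;> nlinarith [hθ.1, hθ.2]
  rw [mul_comm]
  exact (h.hasDerivAt _ hx).comp θ h1

theorem memLp_of_continuousOn {f : ℝ → ℝ} {c d : ℝ} (hf : ContinuousOn f (Icc c d)) :
    MemLp f 2 (volume.restrict (Ioo c d)) := by
  obtain ⟨B, hB⟩ := isCompact_Icc.exists_bound_of_continuousOn hf
  refine MemLp.of_bound ((hf.mono Ioo_subset_Icc_self).aestronglyMeasurable measurableSet_Ioo) B ?_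
  filter_upwards [ae_restrict_mem measurableSet_Ioo] with x hx
    using hB x (Ioo_subset_Icc_self hx)

/-- The classical derivative serves as weak derivative: test functions supported in the open
interval vanish at its ends, so integration by parts has no boundary terms. -/
theorem memH1_of_hasDerivAt {f g : ℝ → ℝ} {c d : ℝ} (hcd : c ≤ d) (hf : ContinuousOn f (Icc c d))
    (hg : ContinuousOn g (Icc c d)) (hfg : ∀ x ∈ Ioo c d, HasDerivAt f (g x) x) :
    MemH1 c d f := by
  refine ⟨memLp_of_continuousOn hf, g, memLp_of_continuousOn hg, fun φ hφ _ hφs => ?_⟩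
  have hφc : φ c = 0 := image_eq_zero_of_notMem_tsupport fun h => (hφs h).1.false
  have hφd : φ d = 0 := image_eq_zero_of_notMem_tsupport fun h => (hφs h).2.false
  have h1 := integral_mul_deriv_eq_of_continuousOn hcd hf hg hφ.continuous.continuousOn
    (hφ.continuous_deriv (by simp)).continuousOn hfg
    (fun x _ => (hφ.differentiable (by simp) x).hasDerivAt)
  rw [hφc, hφd, mul_zero, mul_zero, sub_zero, zero_sub, intervalIntegral.integral_of_le hcd,
    intervalIntegral.integral_of_le hcd, integral_Ioc_eq_integral_Ioo,
    integral_Ioc_eq_integral_Ioo] at h1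
  exact h1

theorem Φ_mem_stateCone (h : IsProfile a b ρ ρ' v) : Φ a b ρ v ∈ stateCone :=
  ⟨h.continuousOn_rescale h.cont, fun _ hθ => h.pos _ (h.mapsTo_rescale hθ),
    memH1_of_hasDerivAt zero_le_one (h.continuousOn_rescale h.cont)
      (continuousOn_const.mul (h.continuousOn_rescale h.cont'))
      (fun _ hθ => h.hasDerivAt_rescale hθ), h.continuousOn_rescale h.cont_v⟩

theorem integral_rescale (h : IsProfile a b ρ ρ' v) (f : ℝ → ℝ) :
    ∫ θ in (0 : ℝ)..1, f (a + (b - a) * θ) = (∫ x in a..b, f x) / (b - a) := by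
  have hba : b - a ≠ 0 := (sub_pos.2 h.lt).ne'
  have h1 := intervalIntegral.smul_integral_comp_add_mul (a := 0) (b := 1) f (b - a) a
  rw [mul_zero, add_zero, mul_one, add_sub_cancel, smul_eq_mul] at h1
  rw [← h1, mul_div_cancel_left₀ _ hba]

/-- The distance to the equilibrium in terms of the unscaled profiles. -/
theorem exists_normX_eq (h : IsProfile a b ρ ρ' v) (ρs : ℝ) :
    ∃ s, (∀ x ∈ Icc a b, |ρ x - ρs| ≤ s) ∧ (∀ B, (∀ x ∈ Icc a b, |ρ x - ρs| ≤ B) → s ≤ B) ∧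
      normX (Φ a b ρ v - equilibrium ρs) = √(v a ^ 2 + v b ^ 2)
        + √((∫ x in a..b, v x ^ 2) / (b - a)) + s + √((b - a) * ∫ x in a..b, ρ' x ^ 2) := by
  have hba : 0 < b - a := sub_pos.2 h.lt
  have e2 : (Φ a b ρ v - equilibrium ρs).2 = fun θ => v (a + (b - a) * θ) := by
    ext θ
    simp [Φ, equilibrium]
  have e1 : ∀ θ ∈ Icc (0 : ℝ) 1,
      (Φ a b ρ v - equilibrium ρs).1 θ = ρ (a + (b - a) * θ) - ρs := fun θ hθ => by
    change ρ (a + (b - a) * θ) - (Icc (0 : ℝ) 1).indicator (fun _ => ρs) θ = _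
    rw [indicator_of_mem hθ]
  have himg : (fun θ => |(Φ a b ρ v - equilibrium ρs).1 θ|) '' Icc 0 1
      = (fun x => |ρ x - ρs|) '' Icc a b := by
    ext y
    constructor
    · rintro ⟨θ, hθ, rfl⟩
      exact ⟨_, h.mapsTo_rescale hθ, by simp only [e1 θ hθ]⟩
    · rintro ⟨x, hx, rfl⟩
      have hθ : (x - a) / (b - a) ∈ Icc (0 : ℝ) 1 :=
        ⟨div_nonneg (by linarith [hx.1]) hba.le, (div_le_one hba).2 (by linarith [hx.2])⟩
      refine ⟨_, hθ, ?_⟩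
      simp only [e1 _ hθ]
      rw [mul_div_cancel₀ _ hba.ne', add_sub_cancel]
  have e3 : ∫ θ in (0 : ℝ)..1, deriv (Φ a b ρ v - equilibrium ρs).1 θ ^ 2
      = (b - a) * ∫ x in a..b, ρ' x ^ 2 := by
    have : ∫ θ in (0 : ℝ)..1, deriv (Φ a b ρ v - equilibrium ρs).1 θ ^ 2
        = ∫ θ in (0 : ℝ)..1, (b - a) ^ 2 * ρ' (a + (b - a) * θ) ^ 2 := by
      refine intervalIntegral.integral_congr_Ioo_of_le zero_le_one fun θ hθ => ?_
      have hd : HasDerivAt (Φ a b ρ v - equilibrium ρs).1 ((b - a) * ρ' (a + (b - a) * θ)) θ := by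
        refine ((h.hasDerivAt_rescale hθ).sub_const ρs).congr_of_eventuallyEq ?_
        filter_upwards [isOpen_Ioo.mem_nhds hθ] with η hη using e1 η (Ioo_subset_Icc_self hη)
      simp only [hd.deriv, mul_pow]
    rw [this, intervalIntegral.integral_const_mul, h.integral_rescale fun x => ρ' x ^ 2]
    field_simp
  refine ⟨sSup ((fun x => |ρ x - ρs|) '' Icc a b), fun x hx => ?_, fun B hB => ?_, ?_⟩
  · exact le_csSup (isCompact_Icc.image_of_continuousOn
      (h.cont_sub ρs).abs).bddAbove ⟨x, hx, rfl⟩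
  · refine csSup_le ⟨_, a, h.left_mem, rfl⟩ ?_
    rintro _ ⟨x, hx, rfl⟩
    exact hB x hx
  · rw [normX, e3, himg, e2, h.integral_rescale fun x => v x ^ 2]
    simp only [mul_zero, add_zero, mul_one, add_sub_cancel]

/-- The four parts of the norm contribute 1 + 1 + 2 + 1 to the factor 5. The maximum of |ρ - ρ*|
counts twice, as it is recovered from ρ(b) and the gradient. -/
theorem normX_le (h : IsProfile a b ρ ρ' v) (hH : AssumptionH P μ) (hρs : 0 < ρs) (hr : 0 < r)
    (hC1 : 1 ≤ C) (hC : ∀ x ∈ Icc a b, Comparable P μ ρs C (ρ x)) :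
    normX (Φ a b ρ v - equilibrium ρs)
      ≤ 5 * √(C * ((8 + 14 / r) * C ^ 5 * lyapunov P μ ρs r a b ρ ρ' v)) := by
  obtain ⟨s, -, hs, hn⟩ := h.exists_normX_eq ρs
  have hL := h.le_lyapunov hH hρs hr hC1 hC
  obtain ⟨Y, hY⟩ : ∃ Y, Y = (8 + 14 / r) * C ^ 5 * lyapunov P μ ρs r a b ρ ρ' v := ⟨_, rfl⟩
  rw [← hY] at hL ⊢
  have hC0 : 0 < C := by linarith
  have hba : 0 < b - a := sub_pos.2 h.lt
  have hN : 0 ≤ ∫ x in a..b, v x ^ 2 :=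
    intervalIntegral.integral_nonneg h.lt.le fun _ _ => sq_nonneg _
  have hA : 0 ≤ ∫ x in a..b, ρ' x ^ 2 :=
    intervalIntegral.integral_nonneg h.lt.le fun _ _ => sq_nonneg _
  have p1 := sq_nonneg (v a)
  have p2 := sq_nonneg (v b)
  have p3 := sq_nonneg (ρ b - ρs)
  have hY0 : 0 ≤ Y := by linarith
  have hCY : Y ≤ C * Y := le_mul_of_one_le_left hY0 hC1
  have t1 : √(v a ^ 2 + v b ^ 2) ≤ √(C * Y) := Real.sqrt_le_sqrt (by linarith)
  have t2 : √((∫ x in a..b, v x ^ 2) / (b - a)) ≤ √(C * Y) := by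
    refine Real.sqrt_le_sqrt ?_
    rw [div_le_iff₀ hba]
    calc (∫ x in a..b, v x ^ 2) ≤ 1 * Y := by linarith
      _ ≤ (C * (b - a)) * Y := by gcongr; exact h.one_le_length hC
      _ = C * Y * (b - a) := by ring
  have t4 : √((b - a) * ∫ x in a..b, ρ' x ^ 2) ≤ √(C * Y) := by
    refine Real.sqrt_le_sqrt (mul_le_mul (h.length_le hC) (by linarith) hA hC0.le)
  have t3 : s ≤ 2 * √(C * Y) := by
    refine hs _ fun x hx => (Real.abs_le_sqrt (y := 4 * (C * Y)) ?_).trans ?_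
    · have h1 := h.sq_sub_le_integral hC hx h.right_mem
      have h2 : C * ∫ x in a..b, ρ' x ^ 2 ≤ C * Y := by gcongr; linarith
      linarith
    · rw [Real.sqrt_mul (by norm_num), show (4 : ℝ) = 2 ^ 2 by norm_num,
        Real.sqrt_sq (by norm_num)]
  rw [hn]
  linarith

theorem lyapunov_le_normX (h : IsProfile a b ρ ρ' v) (hH : AssumptionH P μ) (hρs : 0 < ρs)
    (hr : 0 < r) (hC1 : 1 ≤ C) (hC : ∀ x ∈ Icc a b, Comparable P μ ρs C (ρ x)) :
    lyapunov P μ ρs r a b ρ ρ' v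
      ≤ (1 + r) * C ^ 5 * (4 + 4 * C) * normX (Φ a b ρ v - equilibrium ρs) ^ 2 := by
  obtain ⟨s, hs, -, hn⟩ := h.exists_normX_eq ρs
  have hL := h.lyapunov_le hH hρs hr hC1 hC
  have hC0 : 0 < C := by linarith
  have hba : 0 < b - a := sub_pos.2 h.lt
  have hN : 0 ≤ ∫ x in a..b, v x ^ 2 :=
    intervalIntegral.integral_nonneg h.lt.le fun _ _ => sq_nonneg _
  have hA : 0 ≤ ∫ x in a..b, ρ' x ^ 2 :=
    intervalIntegral.integral_nonneg h.lt.le fun _ _ => sq_nonneg _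
  set n := normX (Φ a b ρ v - equilibrium ρs) with hndef
  have hs0 : 0 ≤ s := (abs_nonneg _).trans (hs a h.left_mem)
  have q1 := Real.sqrt_nonneg (v a ^ 2 + v b ^ 2)
  have q2 := Real.sqrt_nonneg ((∫ x in a..b, v x ^ 2) / (b - a))
  have q4 := Real.sqrt_nonneg ((b - a) * ∫ x in a..b, ρ' x ^ 2)
  have hle : ∀ y, 0 ≤ y → √y ≤ n → y ≤ n ^ 2 := fun y hy hyn => by
    rw [← Real.sq_sqrt hy]
    exact pow_le_pow_left₀ (Real.sqrt_nonneg y) hyn 2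
  have t1 : v a ^ 2 + v b ^ 2 ≤ n ^ 2 := hle _ (by positivity) (by linarith)
  have t2 : (∫ x in a..b, v x ^ 2) / (b - a) ≤ n ^ 2 := hle _ (by positivity) (by linarith)
  have t4 : (b - a) * ∫ x in a..b, ρ' x ^ 2 ≤ n ^ 2 := hle _ (by positivity) (by linarith)
  have t3 : ∀ x ∈ Icc a b, (ρ x - ρs) ^ 2 ≤ n ^ 2 := fun x hx => by
    rw [← sq_abs]
    exact pow_le_pow_left₀ (abs_nonneg _) ((hs x hx).trans (by linarith)) 2
  have u2 : ∫ x in a..b, v x ^ 2 ≤ C * n ^ 2 := by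
    rw [div_le_iff₀ hba] at t2
    calc _ ≤ n ^ 2 * (b - a) := t2
      _ ≤ n ^ 2 * C := by gcongr; exact h.length_le hC
      _ = C * n ^ 2 := mul_comm _ _
  have u4 : ∫ x in a..b, ρ' x ^ 2 ≤ C * n ^ 2 := by
    calc (∫ x in a..b, ρ' x ^ 2) = 1 * ∫ x in a..b, ρ' x ^ 2 := (one_mul _).symm
      _ ≤ (C * (b - a)) * ∫ x in a..b, ρ' x ^ 2 := by gcongr; exact h.one_le_length hC
      _ = C * ((b - a) * ∫ x in a..b, ρ' x ^ 2) := mul_assoc _ _ _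
      _ ≤ C * n ^ 2 := by gcongr
  have u3 : ∫ x in a..b, (ρ x - ρs) ^ 2 ≤ C * n ^ 2 :=
    h.integral_le_of_forall_le hC ((h.cont_sub ρs).pow 2) (sq_nonneg _) t3
  -- The velocities and densities at the two ends account for 4n², the three kinds of integrals for
  -- 4Cn².
  refine hL.trans ?_
  rw [mul_assoc ((1 + r) * C ^ 5)]
  refine mul_le_mul_of_nonneg_left ?_ (by positivity)
  have := t3 a h.left_mem
  have := t3 b h.right_mem
  linarith

theorem dissipation_nonneg (h : IsProfile a b ρ ρ' v) (hH : AssumptionH P μ) (hρs : 0 < ρs)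
    (hr : 0 < r) (hR : 0 < R) : 0 ≤ dissipation P μ ρs R r a b ρ ρ' v v' := by
  have d1 : 0 ≤ ∫ x in a..b, deriv P (ρ x) * μ (ρ x) / ρ x ^ 2 * ρ' x ^ 2 :=
    intervalIntegral.integral_nonneg h.lt.le fun x hx => by
      have h0 := h.pos x hx
      have h1 := hH.μ_pos _ h0
      have h2 := hH.deriv_P_pos _ h0
      positivity
  have d2 : 0 ≤ ∫ x in a..b, μ (ρ x) * v' x ^ 2 :=
    intervalIntegral.integral_nonneg h.lt.le fun x hx => by
      have h1 := hH.μ_pos _ (h.pos x hx)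
      positivity
  have d3 := hH.k_mul_nonneg hρs (h.pos b h.right_mem)
  have d4 := hH.k_mul_nonneg hρs (h.pos a h.left_mem)
  unfold dissipation
  positivity

end IsProfile

/-! ### Exponential decay and conclusion. -/

/-- The function exp(κs)V(s) is nonincreasing. Mere continuity at 0 suffices, which matters because
vₓ need not extend to t = 0. -/
theorem le_exp_mul_of_deriv_le {V D : ℝ → ℝ} {κ : ℝ} (hV : ContinuousOn V (Ici 0))
    (hd : ∀ t, 0 < t → HasDerivAt V (-D t) t) (hD : ∀ t, 0 < t → κ * V t ≤ D t) {t : ℝ}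
    (ht : 0 ≤ t) : V t ≤ Real.exp (-κ * t) * V 0 := by
  have hexp : ∀ s, HasDerivAt (fun s => Real.exp (κ * s)) (Real.exp (κ * s) * κ) s := fun s => by
    simpa using ((hasDerivAt_id s).const_mul κ).exp
  have hder : ∀ s, 0 < s → HasDerivAt (fun s => Real.exp (κ * s) * V s)
      (Real.exp (κ * s) * κ * V s + Real.exp (κ * s) * -D s) s := fun s hs => (hexp s).mul (hd s hs)
  have hanti : AntitoneOn (fun s => Real.exp (κ * s) * V s) (Ici 0) := by
    refine antitoneOn_of_deriv_nonpos (convex_Ici 0)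
      ((by fun_prop : Continuous fun s => Real.exp (κ * s)).continuousOn.mul hV) ?_ ?_
    · rw [interior_Ici]
      exact fun s hs => (hder s hs).differentiableAt.differentiableWithinAt
    · rw [interior_Ici]
      intro s hs
      rw [(hder s hs).deriv]
      have h1 := mul_le_mul_of_nonneg_left (hD s hs) (Real.exp_pos (κ * s)).le
      linarith
  have h2 := hanti self_mem_Ici ht ht
  simp only [mul_zero, Real.exp_zero, one_mul] at h2
  calc V t = Real.exp (-κ * t) * (Real.exp (κ * t) * V t) := by
        rw [← mul_assoc, ← Real.exp_add]
        simp
    _ ≤ Real.exp (-κ * t) * V 0 := by gcongr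

end TwoPiston

theorem theorem1 (P μ : ℝ → ℝ) (hH : TwoPiston.AssumptionH P μ)
    (Pext : ℝ) (hPext : 0 < Pext)
    (ρs : ℝ) (hρs : 0 < ρs) (hPρs : P ρs = Pext)
    (R r S : ℝ) (hR : 0 < R) (hr : 0 < r) (hS : 0 ≤ S) :
    ∃ M σ : ℝ, 0 < M ∧ 0 < σ ∧
      ∀ (u a b : ℝ → ℝ) (ρ v : ℝ → ℝ → ℝ),
        TwoPiston.IsClassicalSolution P μ Pext u a b ρ v →
        (∀ t, 0 < t → u t = -R * ((r + 1) * v t (a t) + TwoPiston.k μ ρs (ρ t (a t)))) →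
        TwoPiston.V P μ ρs r (a 0) (b 0) (ρ 0) (v 0) ≤ S →
        ∀ t, 0 ≤ t →
          TwoPiston.Φ (a t) (b t) (ρ t) (v t) ∈ TwoPiston.stateCone ∧
          TwoPiston.normX (TwoPiston.Φ (a t) (b t) (ρ t) (v t) - TwoPiston.equilibrium ρs)
            ≤ M * Real.exp (-σ * t) *
              TwoPiston.normX
                (TwoPiston.Φ (a 0) (b 0) (ρ 0) (v 0) - TwoPiston.equilibrium ρs) := by
  obtain ⟨m, M, hm, hbounds⟩ := TwoPiston.IsProfile.exists_density_bounds hH hρs hr S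
  obtain ⟨C, hC1, hC⟩ := hH.exists_comparable hρs (M := M) hm
  obtain ⟨K, hK, hdiss⟩ := TwoPiston.IsProfile.exists_lyapunov_le_dissipation hH hρs hr hR hC1
  have hC0 : 0 < C := by linarith
  set c := C * ((8 + 14 / r) * C ^ 5) with hc
  set d := (1 + r) * C ^ 5 * (4 + 4 * C) with hd
  have hc0 : 0 < c := by positivity
  have hd0 : 0 < d := by positivity
  -- The functional decays at rate 1/K; the norm is comparable to its square root and decays at half
  -- that rate.
  refine ⟨5 * √(c * d), 1 / (2 * K), by positivity, by positivity, ?_⟩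
  intro u a b ρ v hs hu hV t ht
  obtain ⟨dϱ, dw, F⟩ := hs.exists_isFlow hH
  have hprof : ∀ s, 0 ≤ s → TwoPiston.IsProfile (a s) (b s) (ρ s)
      (fun x => dϱ (s, x) (0, 1)) (v s) := fun s hs0 => F.isProfile hs0 (hs.mass_one s hs0)
  obtain ⟨L, hL⟩ : ∃ L : ℝ → ℝ, L = fun s => TwoPiston.lyapunov P μ ρs r (a s) (b s) (ρ s)
      (fun x => dϱ (s, x) (0, 1)) (v s) := ⟨_, rfl⟩
  obtain ⟨D, hD⟩ : ∃ D : ℝ → ℝ, D = fun s => TwoPiston.dissipation P μ ρs R r (a s) (b s) (ρ s)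
      (fun x => dϱ (s, x) (0, 1)) (v s) (fun x => dw (s, x) (0, 1)) := ⟨_, rfl⟩
  have hLs : ∀ s, L s = TwoPiston.lyapunov P μ ρs r (a s) (b s) (ρ s)
      (fun x => dϱ (s, x) (0, 1)) (v s) := fun s => by rw [hL]
  have hLcont : ContinuousOn L (Set.Ici 0) := by
    rw [hL]
    exact F.continuousOn_lyapunov hH hρs
  have hLder : ∀ s, 0 < s → HasDerivAt L (-D s) s := fun s hs0 => by
    have h1 := hs.newton_right F hs0
    have h2 := hs.newton_left F hs0
    rw [← hPρs] at h1 h2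
    rw [hu s hs0] at h2
    rw [hL, hD]
    exact F.hasDerivAt_lyapunov hH hρs hs0 h1 h2
  have hL0 : L 0 ≤ S := by
    rwa [hLs, ← (hprof 0 le_rfl).V_eq_lyapunov hH hρs]
  -- The rate κ = 0 needs only nonnegative dissipation and no density bounds. It keeps the solution
  -- in the sublevel set, where the constant C, and hence the rate 1/K, becomes available for all
  -- times.
  have hLS : ∀ s, 0 ≤ s → L s ≤ S := fun s hs0 => by
    have h1 := TwoPiston.le_exp_mul_of_deriv_le (κ := 0) hLcont hLder (fun s hs1 => by
      rw [zero_mul, hD]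
      exact (hprof s hs1.le).dissipation_nonneg hH hρs hr hR) hs0
    simp only [neg_zero, zero_mul, Real.exp_zero, one_mul] at h1
    exact h1.trans hL0
  have hcomp : ∀ s, 0 ≤ s → ∀ x ∈ Set.Icc (a s) (b s), TwoPiston.Comparable P μ ρs C (ρ s x) :=
    fun s hs0 x hx => hC _ (hbounds _ _ _ _ _ (hprof s hs0) (hLs s ▸ hLS s hs0) x hx)
  have hdecay := TwoPiston.le_exp_mul_of_deriv_le (κ := 1 / K) hLcont hLder (fun s hs1 => by
    rw [hLs, hD, div_mul_eq_mul_div, one_mul, div_le_iff₀ hK, mul_comm _ K]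
    exact hdiss _ _ _ _ _ _ (hprof s hs1.le) (hcomp s hs1.le) (F.continuousOn_wx hs1)
      (F.hasDerivAt_wx hs1)) ht
  refine ⟨(hprof t ht).Φ_mem_stateCone, ?_⟩
  have h1 := (hprof t ht).normX_le hH hρs hr hC1 (hcomp t ht)
  have h2 := (hprof 0 le_rfl).lyapunov_le_normX hH hρs hr hC1 (hcomp 0 le_rfl)
  rw [← hLs, ← mul_assoc, ← hc] at h1
  rw [← hLs, ← hd] at h2
  obtain ⟨n, hn⟩ : ∃ n, n = TwoPiston.normX
    (TwoPiston.Φ (a 0) (b 0) (ρ 0) (v 0) - TwoPiston.equilibrium ρs) := ⟨_, rfl⟩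
  have hn0 : 0 ≤ n := by
    obtain ⟨s, hs', -, hsn⟩ := (hprof 0 le_rfl).exists_normX_eq ρs
    have := (abs_nonneg _).trans (hs' _ (hprof 0 le_rfl).left_mem)
    rw [hn, hsn]
    positivity
  rw [← hn] at h2 ⊢
  have hexp : Real.exp (-(1 / K) * t) = Real.exp (-(1 / (2 * K)) * t) ^ 2 := by
    rw [← Real.exp_nat_mul]
    congr 1
    push_cast
    field_simp
  have h3 : c * L t ≤ (c * d) * (Real.exp (-(1 / (2 * K)) * t) * n) ^ 2 := by
    calc c * L t ≤ c * (Real.exp (-(1 / K) * t) * (d * n ^ 2)) := by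
          gcongr
          exact hdecay.trans (by gcongr)
      _ = (c * d) * (Real.exp (-(1 / (2 * K)) * t) * n) ^ 2 := by rw [hexp]; ring
  refine h1.trans ?_
  calc 5 * √(c * L t) ≤ 5 * √((c * d) * (Real.exp (-(1 / (2 * K)) * t) * n) ^ 2) := by gcongr
    _ = 5 * √(c * d) * Real.exp (-(1 / (2 * K)) * t) * n := by
      rw [Real.sqrt_mul (by positivity), Real.sqrt_sq (by positivity)]
      ring
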